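/- Let $d\ge 1$. For $z,w\in\mathbb C^d$ put $\langle z,w\rangle=z\cdot\overline w=\sum_j z_j\overline{w_j}$, and let $d\zeta$ be the surface measure on the unit sphere $S^{2d-1}\subset\mathbb C^d$. Let $Z_j=\frac{\partial}{\partial z_j}+\frac14\overline z_j$, $\overline Z_j=\frac{\partial}{\partial\overline z_j}-\frac14 z_j$, let $L=-2\sum_{j=1}^d(Z_j\overline Z_j+\overline Z_jZ_j)$ be the special Hermite operator, and define $$e^{-tL}f(z)=\int_{\mathbb C^d}f(z-w)\,p_t(w)\,e^{\frac i2\operatorname{Im}(z\cdot\overline w)}\,dw,\qquad p_t(w)=(4\pi\sinh t)^{-d}e^{-\frac14|w|^2\coth t},$$ $$L^{-1/2}f(z)=\frac1{\sqrt\pi}\int_0^\infty e^{-tL}f(z)\,t^{-1/2}\,dt .$$ We say that $L^{-1/2}f$ is defined if the resulting double integral in $(t,w)$ converges absolutely for almost every $z$ and $L^{-1/2}f$ is locally integrable; we then say that the vectors of Riesz transforms $Sf=(S_1f,\dots,S_df)$ and $\overline Sf=(\overline S_1f,\dots,\overline S_df)$ are defined if the distributions $S_jf=Z_jL^{-1/2}f$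 and $\overline S_jf=\overline Z_jL^{-1/2}f$ are locally integrable functions on $\mathbb C^d$. For $m,n\ge0$ let $\mathcal H_{m,n}$ be the space of restrictions to $S^{2d-1}$ of harmonic polynomials $\sum_{|\alpha|=m}\sum_{|\beta|=n}c_{\alpha,\beta}z^\alpha\overline z^\beta$, let $d(m,n)=\dim\mathcal H_{m,n}$, and fix for all $m,n$ an orthonormal basis $\{Y_{m,n}^j:1\le j\le d(m,n)\}$ of $\mathcal H_{m,n}$ in $L^2(S^{2d-1})$. Let $$F_{m,n}^j(r)=\int_{S^{2d-1}}L^{-1/2}f(r\zeta)\,\overline{Y_{m,n}^j(\zeta)}\,d\zeta,\qquad \lambda_d(m,n)=\tfrac14\big((m+n)^2+(4d-3)m-n\big).$$ **Proposition.** (a) If $f\in L^2(\mathbb C^d)$, then $L^{-1/2}f$, $Sf$ and $\overline Sf$ are defined, all $S_jf$ and $\overline S_jf$ belong to $L^2(\mathbb C^d)$, and $\int_{S^{2d-1}}\big(\langle Sf,Sf\rangle+\langle\overline Sf,\overline Sf\rangle\big)(r\zeta)\,d\zeta<\infty$ for almost every $r>0$. (b) Let $f:\mathbb C^d\to\mathbb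 C$ be any function for which $L^{-1/2}f$, $Sf$ and $\overline Sf$ are defined. Then every $F_{m,n}^j$ is locally integrable on $(0,\infty)$ with a locally integrable weak derivative $\frac{\partial}{\partial r}F_{m,n}^j$, and for almost every $r>0$ for which $\big(\langle Sf,Sf\rangle+\langle\overline Sf,\overline Sf\rangle\big)(r\,\cdot)$ is integrable on $S^{2d-1}$, the following five series converge absolutely and $$\int_{S^{2d-1}}\big(\langle Sf,Sf\rangle+\langle\overline Sf,\overline Sf\rangle\big)(r\zeta)\,d\zeta=A_1(r)^2+A_2(r)^2+A_3(r)^2+A_4(r)^2+A_5(r),$$ where $$A_1(r)^2=\sum_{m,n=0}^\infty\sum_{j=1}^{d(m,n)}\Big|\tfrac12\Big(\tfrac{\partial}{\partial r}+\tfrac12 r\Big)F_{m,n}^j(r)\Big|^2,\qquad A_2(r)^2=\sum_{m,n=0}^\infty\sum_{j=1}^{d(m,n)}\Big|\tfrac12\Big(\tfrac{\partial}{\partial r}-\tfrac12 r\Big)F_{m,n}^j(r)\Big|^2,$$ $$A_3(r)^2=\sum_{m,n=0}^\infty\sum_{j=1}^{d(m,n)}\tfrac1{r^2}\lambda_d(m,n)|F_{m,n}^j(r)|^2,\qquad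 A_4(r)^2=\sum_{m,n=0}^\infty\sum_{j=1}^{d(m,n)}\tfrac1{r^2}\lambda_d(n,m)|F_{m,n}^j(r)|^2,$$ $$A_5(r)=\sum_{m,n=0}^\infty\sum_{j=1}^{d(m,n)}\tfrac{m-n}2|F_{m,n}^j(r)|^2 .$$ -/

import Mathlib

open MeasureTheory Set
open scoped ContDiff InnerProductSpace ComplexConjugate

namespace SpecialHermite

/-- The space `ℂ^d` with its Hermitian norm; `volume` on it is Lebesgue measure `dx dy`. -/
abbrev Cn (d : ℕ) : Type := EuclideanSpace ℂ (Fin d)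

/-- The unit sphere of `ℂ^d`, of real dimension `2d - 1`. -/
abbrev Sph (d : ℕ) : Type := Metric.sphere (0 : Cn d) 1

/-- The surface measure of the unit sphere. -/
noncomputable def sphMeasure (d : ℕ) : Measure (Sph d) := (volume : Measure (Cn d)).toSphere

/-! ### Twisted convolution, heat semigroup, inverse square root -/

/-- `z · conj w = ∑ z_j conj w_j`. -/
noncomputable def dotConj {d : ℕ} (z w : Cn d) : ℂ := ∑ j, z j * conj (w j)

/-- Twisted convolution
`(f × g)(z) = ∫ f(z - w) g(w) exp((i/2) Im (z · conj w)) dw`. -/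
noncomputable def twistedConv {d : ℕ} (f g : Cn d → ℂ) (z : Cn d) : ℂ :=
  ∫ w, f (z - w) * g w * Complex.exp (Complex.I / 2 * ((dotConj z w).im : ℂ))

/-- The kernel of the semigroup generated by the special Hermite operator,
`p_t(z) = (4π sinh t)^{-d} exp(-(1/4) |z|² coth t)`, for `t > 0`. -/
noncomputable def heatKernel (d : ℕ) (t : ℝ) (z : Cn d) : ℝ :=
  ((4 * Real.pi * Real.sinh t) ^ d)⁻¹ *
    Real.exp (-(1 / 4) * ‖z‖ ^ 2 * (Real.cosh t / Real.sinh t))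

/-- The special Hermite semigroup `e^{-tL} f = f × p_t`. -/
noncomputable def heat {d : ℕ} (t : ℝ) (f : Cn d → ℂ) : Cn d → ℂ :=
  twistedConv f (fun w => (heatKernel d t w : ℂ))

/-- `L^{-1/2} f (z) = π^{-1/2} ∫_0^∞ e^{-tL} f (z) t^{-1/2} dt`. -/
noncomputable def invSqrt {d : ℕ} (f : Cn d → ℂ) (z : Cn d) : ℂ :=
  ((Real.sqrt Real.pi)⁻¹ : ℝ) *
    ∫ t in Ioi (0 : ℝ), heat t f z * ((t ^ (-(1 / 2) : ℝ) : ℝ) : ℂ)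

/-- `L^{-1/2} f` is well defined: the double integral defining it converges absolutely at almost
every point, and the resulting function is locally integrable. -/
def InvSqrtDefined {d : ℕ} (f : Cn d → ℂ) : Prop :=
  (∀ᵐ z : Cn d, Integrable
    (fun q : ℝ × Cn d => f (z - q.2) * (heatKernel d q.1 q.2 : ℂ) *
      Complex.exp (Complex.I / 2 * ((dotConj z q.2).im : ℂ)) *
      ((q.1 ^ (-(1 / 2) : ℝ) : ℝ) : ℂ))
    ((volume.restrict (Ioi (0 : ℝ))).prod volume)) ∧
  LocallyIntegrable (invSqrt f)

/-! ### The Riesz transforms -/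

/-- The Wirtinger derivative `∂φ/∂z_j = (∂φ/∂x_j - i ∂φ/∂y_j) / 2`. -/
noncomputable def dz {d : ℕ} (j : Fin d) (φ : Cn d → ℂ) (z : Cn d) : ℂ :=
  (fderiv ℝ φ z (EuclideanSpace.single j 1) -
    Complex.I * fderiv ℝ φ z (EuclideanSpace.single j Complex.I)) / 2

/-- The Wirtinger derivative `∂φ/∂(conj z_j) = (∂φ/∂x_j + i ∂φ/∂y_j) / 2`. -/
noncomputable def dzbar {d : ℕ} (j : Fin d) (φ : Cn d → ℂ) (z : Cn d) : ℂ :=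
  (fderiv ℝ φ z (EuclideanSpace.single j 1) +
    Complex.I * fderiv ℝ φ z (EuclideanSpace.single j Complex.I)) / 2

/-- `s` is the function `Z_j G`, with `Z_j = ∂/∂z_j + (1/4) conj z_j` taken in the sense of
distributions. -/
def IsZ {d : ℕ} (j : Fin d) (G s : Cn d → ℂ) : Prop :=
  LocallyIntegrable s ∧
    ∀ φ : Cn d → ℂ, ContDiff ℝ ∞ φ → HasCompactSupport φ →
      ∫ z, s z * φ z = ∫ z, G z * (-dz j φ z + 1 / 4 * conj (z j) * φ z)

/-- `s` is the function `Zbar_j G`, with `Zbar_j = ∂/∂(conj z_j) - (1/4) z_j` taken in the sense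
of distributions. -/
def IsZbar {d : ℕ} (j : Fin d) (G s : Cn d → ℂ) : Prop :=
  LocallyIntegrable s ∧
    ∀ φ : Cn d → ℂ, ContDiff ℝ ∞ φ → HasCompactSupport φ →
      ∫ z, s z * φ z = ∫ z, G z * (-dzbar j φ z - 1 / 4 * z j * φ z)

/-- `s` is the vector `S f = (S_1 f, …, S_d f)` of Riesz transforms, `S_j = Z_j L^{-1/2}`. -/
def IsRiesz {d : ℕ} (f : Cn d → ℂ) (s : Fin d → Cn d → ℂ) : Prop :=
  ∀ j, IsZ j (invSqrt f) (s j)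

/-- `s` is the vector of conjugate Riesz transforms `Zbar_j L^{-1/2} f`. -/
def IsRieszBar {d : ℕ} (f : Cn d → ℂ) (s : Fin d → Cn d → ℂ) : Prop :=
  ∀ j, IsZbar j (invSqrt f) (s j)

/-- The function `ζ ↦ (⟨Sf, Sf⟩ + ⟨Sbar f, Sbar f⟩)(r ζ)` on the unit sphere. -/
noncomputable def rieszSq {d : ℕ} (S Sbar : Fin d → Cn d → ℂ) (r : ℝ) (ζ : Sph d) : ℝ :=
  (∑ j, ‖S j (r • (ζ : Cn d))‖ ^ 2) + ∑ j, ‖Sbar j (r • (ζ : Cn d))‖ ^ 2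

/-! ### Bigraded spherical harmonics -/

/-- The value `∑ c_{α,β} z^α (conj z)^β` of a polynomial in `z` and `conj z`; the variables
`Sum.inl j` and `Sum.inr j` stand for `z_j` and `conj z_j`. -/
noncomputable def evalPoly {d : ℕ} (p : MvPolynomial (Fin d ⊕ Fin d) ℂ) (z : Cn d) : ℂ :=
  MvPolynomial.eval (Sum.elim (fun j => z j) (fun j => conj (z j))) p

lemma contDiff_evalPoly {d : ℕ} (p : MvPolynomial (Fin d ⊕ Fin d) ℂ) {n : WithTop ℕ∞} :
    ContDiff ℝ n (evalPoly p) := by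
  induction p using MvPolynomial.induction_on with
  | C a =>
    have : evalPoly (MvPolynomial.C a) = fun _ : Cn d => a := by
      funext z; simp [evalPoly]
    rw [this]; exact contDiff_const
  | add p q hp hq =>
    have : evalPoly (p + q) = fun z => evalPoly p z + evalPoly q z := by
      funext z; simp [evalPoly]
    rw [this]; exact hp.add hq
  | mul_X p i hp =>
    have : evalPoly (p * MvPolynomial.X i) = fun z => evalPoly p z *
        (Sum.elim (fun j => z j) (fun j => conj (z j)) i : ℂ) := by
      funext z; simp [evalPoly]
    rw [this]
    have hc : ∀ j : Fin d, ContDiff ℝ n (fun z : Cn d => z j) := fun j =>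
      ((EuclideanSpace.proj (𝕜 := ℂ) j).restrictScalars ℝ).contDiff
    refine hp.mul ?_
    rcases i with j | j
    · exact hc j
    · exact Complex.conjCLE.contDiff.comp (hc j)

/-- The space of bigraded solid harmonics of bidegree `(m, n)`: the harmonic functions on `ℂ^d` of
the form `∑_{|α| = m} ∑_{|β| = n} c_{α,β} z^α (conj z)^β`. -/
noncomputable def solidHarmonics (d m n : ℕ) : Submodule ℂ (Cn d → ℂ) where
  carrier := {P | (∃ p : MvPolynomial (Fin d ⊕ Fin d) ℂ,
      p.IsWeightedHomogeneous (Sum.elim (fun _ => 1) (fun _ => 0) : Fin d ⊕ Fin d → ℕ) m ∧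
      p.IsWeightedHomogeneous (Sum.elim (fun _ => 0) (fun _ => 1) : Fin d ⊕ Fin d → ℕ) n ∧
      P = evalPoly p) ∧ ∀ z, Laplacian.laplacian P z = 0}
  zero_mem' := by
    refine ⟨⟨0, MvPolynomial.isWeightedHomogeneous_zero _ _ _,
      MvPolynomial.isWeightedHomogeneous_zero _ _ _, by funext z; simp [evalPoly]⟩, fun z => ?_⟩
    have := InnerProductSpace.laplacian_smul (x := z) (0 : ℝ)
      (contDiff_evalPoly (d := d) 0).contDiffAt
    rw [zero_smul, zero_smul] at this
    exact this
  add_mem' := by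
    rintro P Q ⟨⟨p, hp1, hp2, rfl⟩, hp⟩ ⟨⟨q, hq1, hq2, rfl⟩, hq⟩
    refine ⟨⟨p + q, hp1.add hq1, hp2.add hq2, by funext z; simp [evalPoly]⟩, fun z => ?_⟩
    rw [(contDiff_evalPoly p).contDiffAt.laplacian_add (contDiff_evalPoly q).contDiffAt,
      hp, hq, add_zero]
  smul_mem' := by
    rintro c P ⟨⟨p, hp1, hp2, rfl⟩, hp⟩
    refine ⟨⟨MvPolynomial.C c * p, ?_, ?_, by funext z; simp [evalPoly]⟩, fun z => ?_⟩
    · simpa using (MvPolynomial.isWeightedHomogeneous_C _ c).mul hp1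
    · simpa using (MvPolynomial.isWeightedHomogeneous_C _ c).mul hp2
    · rw [InnerProductSpace.laplacian_smul c (contDiff_evalPoly p).contDiffAt, hp, smul_zero]

/-- The space `H_{m,n}` of bigraded spherical harmonics: the restrictions to the unit sphere of
the bigraded solid harmonics of bidegree `(m, n)`. -/
noncomputable def sphericalHarmonics (d m n : ℕ) : Submodule ℂ (Sph d → ℂ) :=
  (solidHarmonics d m n).map (LinearMap.funLeft ℂ ℂ (Subtype.val : Sph d → Cn d))

/-- `d(m,n) = dim H_{m,n}`. -/
noncomputable def harmDim (d m n : ℕ) : ℕ := Module.finrank ℂ (sphericalHarmonics d m n)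

/-- `Y^j_{m,n}`, `j = 1, …, d(m,n)`, is for all `m`, `n` an orthonormal basis of `H_{m,n}` with
respect to the inner product `(f, g) = ∫ f conj g` on the unit sphere. -/
def IsHarmonicBasis (d : ℕ) (Y : (m n : ℕ) → Fin (harmDim d m n) → Sph d → ℂ) : Prop :=
  ∀ m n, Submodule.span ℂ (Set.range (Y m n)) = sphericalHarmonics d m n ∧
    ∀ j k, ∫ ζ, Y m n j ζ * conj (Y m n k ζ) ∂sphMeasure d = if j = k then 1 else 0

/-- The spherical harmonic coefficient `r ↦ ∫ G(rζ) conj (Y ζ) dζ`. -/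
noncomputable def harmCoeff {d : ℕ} (G : Cn d → ℂ) (Y : Sph d → ℂ) (r : ℝ) : ℂ :=
  ∫ ζ, G (r • (ζ : Cn d)) * conj (Y ζ) ∂sphMeasure d

/-- `v` is the weak derivative `∂u/∂r` of `u` on the half-line `(0, ∞)`. -/
def IsWeakDeriv (u v : ℝ → ℂ) : Prop :=
  LocallyIntegrableOn u (Ioi 0) ∧ LocallyIntegrableOn v (Ioi 0) ∧
    ∀ φ : ℝ → ℂ, ContDiff ℝ ∞ φ → HasCompactSupport φ → tsupport φ ⊆ Ioi 0 →
      ∫ r in Ioi (0 : ℝ), u r * deriv φ r = -∫ r in Ioi (0 : ℝ), v r * φ r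

/-! ### The five terms

Here `F m n j` stands for the coefficient `F_{m,n}^j` and `D m n j` for its derivative. -/

/-- `λ_d(m,n) = ((m+n)² + (4d-3) m - n) / 4`. -/
noncomputable def lam (d m n : ℕ) : ℝ :=
  (((m : ℝ) + n) ^ 2 + (4 * (d : ℝ) - 3) * m - n) / 4

section Terms

variable {d : ℕ}

/-- `∑_j |(1/2)(∂_r + r/2) F_{m,n}^j(r)|²`. -/
noncomputable def term1 (F D : (m n : ℕ) → Fin (harmDim d m n) → ℝ → ℂ) (r : ℝ) (q : ℕ × ℕ) : ℝ :=
  ∑ j, ‖(1 / 2 : ℂ) * (D q.1 q.2 j r + (r / 2 : ℂ) * F q.1 q.2 j r)‖ ^ 2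

/-- `∑_j |(1/2)(∂_r - r/2) F_{m,n}^j(r)|²`. -/
noncomputable def term2 (F D : (m n : ℕ) → Fin (harmDim d m n) → ℝ → ℂ) (r : ℝ) (q : ℕ × ℕ) : ℝ :=
  ∑ j, ‖(1 / 2 : ℂ) * (D q.1 q.2 j r - (r / 2 : ℂ) * F q.1 q.2 j r)‖ ^ 2

/-- `∑_j r⁻² λ_d(m,n) |F_{m,n}^j(r)|²`. -/
noncomputable def term3 (F : (m n : ℕ) → Fin (harmDim d m n) → ℝ → ℂ) (r : ℝ) (q : ℕ × ℕ) : ℝ :=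
  ∑ j, 1 / r ^ 2 * lam d q.1 q.2 * ‖F q.1 q.2 j r‖ ^ 2

/-- `∑_j r⁻² λ_d(n,m) |F_{m,n}^j(r)|²`. -/
noncomputable def term4 (F : (m n : ℕ) → Fin (harmDim d m n) → ℝ → ℂ) (r : ℝ) (q : ℕ × ℕ) : ℝ :=
  ∑ j, 1 / r ^ 2 * lam d q.2 q.1 * ‖F q.1 q.2 j r‖ ^ 2

/-- `∑_j ((m-n)/2) |F_{m,n}^j(r)|²`. -/
noncomputable def term5 (F : (m n : ℕ) → Fin (harmDim d m n) → ℝ → ℂ) (r : ℝ) (q : ℕ × ℕ) : ℝ :=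
  ∑ j, ((q.1 : ℝ) - q.2) / 2 * ‖F q.1 q.2 j r‖ ^ 2

end Terms

end SpecialHermite

namespace SpecialHermite

variable {d : ℕ}

/-! Write G = L^{-1/2}f, s_j = Z_jG, t_j = Zbar_jG. On the sphere of radius r, Lagrange's identity
splits |s|² into |∑ ζ_j s_j|² and half the sum over j, k of |conj ζ_j s_k - conj ζ_k s_j|²; the same
holds for t with ζ conjugated. The two radial pieces a = ∑ ζ_j s_j and b = ∑ conj ζ_j t_j satisfy
|a|² + |b|² = |a+b|²/2 + |a-b|²/2. The zeroth-order parts of Z_j and Zbar_j cancel in a + b, which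
is ∂G/∂r, while a - b is the generator of z ↦ e^{iθ}z applied to G, divided by r, plus (r/2)G. The
antisymmetrised pieces are rotation fields applied to G, again free of zeroth-order terms. All these
angular fields act on the H_{m,n} explicitly. The generator of phases has eigenvalue m - n. The
fields conj z_j ∂_k - conj z_k ∂_j map H_{m,n} to H_{m-1,n+1}; they are, up to sign, adjoint to z_j
∂bar_k - z_k ∂bar_j, and the Casimir sums have eigenvalues 2m(n+d-1) and 2n(m+d-1)
(`sum_sphInner_rot_rot`, `sum_sphInner_rotBar_rotBar`). Parseval (`IsHarmonicBasis.hasSum_norm_sq`)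
turns the integral over the sphere into |∂_r F|²/2 plus a weight times |F|², summed over the basis,
and `angWeight_eq` identifies the weight with that of the five series. As the weight grows like
(m+n)², each series converges separately. Since G has only distributional derivatives, every
integration by parts is made against Q(z)φ(|z|) with φ a test function on (0, ∞): a divergence free
tangential field does not see φ, so the identity descends to almost every sphere
(`IsWirtinger.ae_sphere_integral_tangential`). The Euler field gives the weak radial derivative
(`IsWirtinger.isWeakDeriv`). For f in L², e^{-tL} is dominated by convolution with p_t, of mass
(cosh t)^{-d}, so L^{-1/2} is dominated by convolution with an integrable kernel. The Riesz
transforms are obtained by duality from the boundedness of L^{-1/2}Z_j and L^{-1/2}Zbar_j on test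
functions. Up to constants ‖L^{-1/2}χ‖² is at most ∫_0^1 ⟨e^{-uL}χ, χ⟩ du
(`lintegral_invSqrt_sq_le`), and for σ = 1 with Z_j, σ = -1 with Zbar_j, the sum over j of
⟨e^{-tL}Z_jφ, Z_jφ⟩ is -e^{-σ(d-2)t}/4 times the derivative of e^{σdt}⟨e^{-tL}φ, φ⟩
(`hasDerivAt_energy`). The fundamental theorem of calculus then bounds the integral by a multiple of
‖φ‖². -/

/-- The coordinate function `z ↦ z_j` as a real continuous linear map. -/
noncomputable def coordCLM (j : Fin d) : Cn d →L[ℝ] ℂ :=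
  (EuclideanSpace.proj (𝕜 := ℂ) j).restrictScalars ℝ

@[simp] lemma coordCLM_apply (j : Fin d) (z : Cn d) : coordCLM j z = z j := rfl

lemma hasFDerivAt_coord (j : Fin d) (z : Cn d) :
    HasFDerivAt (fun z : Cn d => z j) (coordCLM j) z := (coordCLM j).hasFDerivAt

lemma hasFDerivAt_conj_coord (j : Fin d) (z : Cn d) :
    HasFDerivAt (fun z : Cn d => conj (z j)) (Complex.conjCLE.toContinuousLinearMap.comp (coordCLM j)) z :=
  (Complex.conjCLE.toContinuousLinearMap.comp (coordCLM j)).hasFDerivAt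

lemma contDiff_coord (j : Fin d) {n : WithTop ℕ∞} : ContDiff ℝ n (fun z : Cn d => z j) :=
  (coordCLM j).contDiff

lemma contDiff_conj_coord (j : Fin d) {n : WithTop ℕ∞} :
    ContDiff ℝ n (fun z : Cn d => conj (z j)) :=
  (Complex.conjCLE.toContinuousLinearMap.comp (coordCLM j)).contDiff

/-! ### Rules for the Wirtinger derivatives -/

section Wirtinger

variable {u v : Cn d → ℂ} {z : Cn d}

lemma dz_add (j : Fin d) (hu : DifferentiableAt ℝ u z) (hv : DifferentiableAt ℝ v z) :
    dz j (fun z => u z + v z) z = dz j u z + dz j v z := by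
  simp only [dz, fderiv_fun_add hu hv, add_apply]; ring

lemma dzbar_add (j : Fin d) (hu : DifferentiableAt ℝ u z) (hv : DifferentiableAt ℝ v z) :
    dzbar j (fun z => u z + v z) z = dzbar j u z + dzbar j v z := by
  simp only [dzbar, fderiv_fun_add hu hv, add_apply]; ring

lemma dz_mul (j : Fin d) (hu : DifferentiableAt ℝ u z) (hv : DifferentiableAt ℝ v z) :
    dz j (fun z => u z * v z) z = u z * dz j v z + v z * dz j u z := by
  simp only [dz, fderiv_fun_mul hu hv, add_apply,
    smul_apply, smul_eq_mul]; ring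

lemma dzbar_mul (j : Fin d) (hu : DifferentiableAt ℝ u z) (hv : DifferentiableAt ℝ v z) :
    dzbar j (fun z => u z * v z) z = u z * dzbar j v z + v z * dzbar j u z := by
  simp only [dzbar, fderiv_fun_mul hu hv, add_apply,
    smul_apply, smul_eq_mul]; ring

lemma fderiv_conj (hu : DifferentiableAt ℝ u z) (e : Cn d) :
    fderiv ℝ (fun z => conj (u z)) z e = conj (fderiv ℝ u z e) := by
  have := (Complex.conjCLE.toContinuousLinearMap.hasFDerivAt (x := u z)).comp z hu.hasFDerivAt
  have h2 : HasFDerivAt (fun z => conj (u z))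
    (Complex.conjCLE.toContinuousLinearMap.comp (fderiv ℝ u z)) z := this
  rw [h2.fderiv]; rfl

lemma dz_conj (j : Fin d) (hu : DifferentiableAt ℝ u z) :
    dz j (fun z => conj (u z)) z = conj (dzbar j u z) := by
  simp only [dz, dzbar, fderiv_conj hu, map_add, map_mul, map_div₀, Complex.conj_I, map_ofNat]; ring

lemma dzbar_conj (j : Fin d) (hu : DifferentiableAt ℝ u z) :
    dzbar j (fun z => conj (u z)) z = conj (dz j u z) := by
  simp only [dz, dzbar, fderiv_conj hu, map_sub, map_mul, map_div₀, Complex.conj_I, map_ofNat]; ring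

lemma dz_coord (j k : Fin d) (z : Cn d) :
    dz j (fun z : Cn d => z k) z = if k = j then 1 else 0 := by
  rw [dz, (hasFDerivAt_coord k z).fderiv]
  by_cases h : k = j <;> simp [h]

lemma dzbar_coord (j k : Fin d) (z : Cn d) : dzbar j (fun z : Cn d => z k) z = 0 := by
  rw [dzbar, (hasFDerivAt_coord k z).fderiv]
  by_cases h : k = j <;> simp [h]

lemma dz_conj_coord (j k : Fin d) (z : Cn d) : dz j (fun z : Cn d => conj (z k)) z = 0 := by
  rw [dz_conj j (hasFDerivAt_coord k z).differentiableAt, dzbar_coord, map_zero]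

lemma dzbar_conj_coord (j k : Fin d) (z : Cn d) :
    dzbar j (fun z : Cn d => conj (z k)) z = if k = j then 1 else 0 := by
  rw [dzbar_conj j (hasFDerivAt_coord k z).differentiableAt, dz_coord]; split_ifs <;> simp

lemma dz_const (j : Fin d) (c : ℂ) : dz j (fun _ : Cn d => c) z = 0 := by simp [dz]

lemma dzbar_const (j : Fin d) (c : ℂ) : dzbar j (fun _ : Cn d => c) z = 0 := by simp [dzbar]

lemma contDiff_dz (j : Fin d) {u : Cn d → ℂ} (hu : ContDiff ℝ ∞ u) : ContDiff ℝ ∞ (dz j u) := by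
  have h : ContDiff ℝ ∞ (fderiv ℝ u) := hu.fderiv_right (by simp)
  unfold dz
  exact ((h.clm_apply contDiff_const).sub (contDiff_const.mul (h.clm_apply contDiff_const))).div_const _

lemma contDiff_dzbar (j : Fin d) {u : Cn d → ℂ} (hu : ContDiff ℝ ∞ u) :
    ContDiff ℝ ∞ (dzbar j u) := by
  have h : ContDiff ℝ ∞ (fderiv ℝ u) := hu.fderiv_right (by simp)
  unfold dzbar
  exact ((h.clm_apply contDiff_const).add (contDiff_const.mul (h.clm_apply contDiff_const))).div_const _

lemma hasCompactSupport_dz (j : Fin d) {u : Cn d → ℂ} (hu : HasCompactSupport u) :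
    HasCompactSupport (dz j u) := by
  have h := hu.fderiv (𝕜 := ℝ)
  refine h.mono fun z hz => ?_
  rw [Function.mem_support] at hz ⊢
  contrapose! hz; simp [dz, hz]

lemma hasCompactSupport_dzbar (j : Fin d) {u : Cn d → ℂ} (hu : HasCompactSupport u) :
    HasCompactSupport (dzbar j u) := by
  have h := hu.fderiv (𝕜 := ℝ)
  refine h.mono fun z hz => ?_
  rw [Function.mem_support] at hz ⊢
  contrapose! hz; simp [dzbar, hz]

end Wirtinger

/-! ### Derivatives of polynomials -/

section Polynomials

open MvPolynomial

variable (p q : MvPolynomial (Fin d ⊕ Fin d) ℂ)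

@[simp] lemma evalPoly_add (z : Cn d) : evalPoly (p + q) z = evalPoly p z + evalPoly q z := by
  simp [evalPoly]

@[simp] lemma evalPoly_sub (z : Cn d) : evalPoly (p - q) z = evalPoly p z - evalPoly q z := by
  simp [evalPoly]

@[simp] lemma evalPoly_neg (z : Cn d) : evalPoly (-q) z = - evalPoly q z := by
  simp [evalPoly]

@[simp] lemma evalPoly_mul (z : Cn d) : evalPoly (p * q) z = evalPoly p z * evalPoly q z := by
  simp [evalPoly]

@[simp] lemma evalPoly_C (c : ℂ) (z : Cn d) : evalPoly (C c) z = c := by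
  simp [evalPoly]

@[simp] lemma evalPoly_X_inl (j : Fin d) (z : Cn d) : evalPoly (X (Sum.inl j)) z = z j := by
  simp [evalPoly]

@[simp] lemma evalPoly_X_inr (j : Fin d) (z : Cn d) :
    evalPoly (X (Sum.inr j)) z = conj (z j) := by
  simp [evalPoly]

@[simp] lemma evalPoly_sum {ι : Type*} (s : Finset ι) (f : ι → MvPolynomial (Fin d ⊕ Fin d) ℂ)
    (z : Cn d) : evalPoly (∑ i ∈ s, f i) z = ∑ i ∈ s, evalPoly (f i) z := by
  simp [evalPoly]

lemma differentiableAt_evalPoly (z : Cn d) : DifferentiableAt ℝ (evalPoly p) z :=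
  (contDiff_evalPoly p (n := 1)).differentiable (by simp) z

lemma dz_evalPoly (j : Fin d) : dz j (evalPoly p) = evalPoly (pderiv (Sum.inl j) p) := by
  funext z
  induction p using MvPolynomial.induction_on with
  | C a =>
    have : evalPoly (C a) = fun _ : Cn d => a := by funext z; simp
    simp [this, dz_const]; simp [evalPoly]
  | add p q hp hq =>
    have : evalPoly (p + q) = fun z : Cn d => evalPoly p z + evalPoly q z := by funext z; simp
    rw [this, dz_add j (differentiableAt_evalPoly p z) (differentiableAt_evalPoly q z), hp, hq]
    simp
  | mul_X p i hp =>
    have : evalPoly (p * X i) = fun z : Cn d => evalPoly p z * evalPoly (X i) z := by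
      funext z; simp
    rw [this, dz_mul j (differentiableAt_evalPoly p z) (differentiableAt_evalPoly _ z), hp]
    rcases i with k | k
    · have h : evalPoly (X (Sum.inl k)) = fun z : Cn d => z k := by funext z; simp
      rw [h, dz_coord]
      by_cases hk : k = j <;> simp [pderiv_X, hk, mul_comm]
    · have h : evalPoly (X (Sum.inr k)) = fun z : Cn d => conj (z k) := by funext z; simp
      rw [h, dz_conj_coord]
      simp [pderiv_X, mul_comm]

lemma dzbar_evalPoly (j : Fin d) : dzbar j (evalPoly p) = evalPoly (pderiv (Sum.inr j) p) := by
  funext z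
  induction p using MvPolynomial.induction_on with
  | C a =>
    have : evalPoly (C a) = fun _ : Cn d => a := by funext z; simp
    simp [this, dzbar_const]; simp [evalPoly]
  | add p q hp hq =>
    have : evalPoly (p + q) = fun z : Cn d => evalPoly p z + evalPoly q z := by funext z; simp
    rw [this, dzbar_add j (differentiableAt_evalPoly p z) (differentiableAt_evalPoly q z), hp, hq]
    simp
  | mul_X p i hp =>
    have : evalPoly (p * X i) = fun z : Cn d => evalPoly p z * evalPoly (X i) z := by
      funext z; simp
    rw [this, dzbar_mul j (differentiableAt_evalPoly p z) (differentiableAt_evalPoly _ z), hp]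
    rcases i with k | k
    · have h : evalPoly (X (Sum.inl k)) = fun z : Cn d => z k := by funext z; simp
      rw [h, dzbar_coord]
      simp [pderiv_X, mul_comm]
    · have h : evalPoly (X (Sum.inr k)) = fun z : Cn d => conj (z k) := by funext z; simp
      rw [h, dzbar_conj_coord]
      by_cases hk : k = j <;> simp [pderiv_X, hk, mul_comm]

/-- The commutator of two derivations is a derivation, so it is enough that it kills the variables.
-/
lemma pderiv_comm {σ : Type*} (i j : σ) (p : MvPolynomial σ ℂ) :
    pderiv i (pderiv j p) = pderiv j (pderiv i p) := by
  have : ⁅(pderiv i : Derivation ℂ (MvPolynomial σ ℂ) (MvPolynomial σ ℂ)),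
      (pderiv j : Derivation ℂ (MvPolynomial σ ℂ) (MvPolynomial σ ℂ))⁆ = 0 := by
    apply MvPolynomial.derivation_ext
    intro k
    classical
    simp only [Derivation.commutator_apply, pderiv_X, Pi.single_apply]
    split_ifs <;> simp
  have h := congrArg (fun D => D p) this
  simpa [Derivation.commutator_apply, sub_eq_zero] using h

/-- The Laplacian of a polynomial in `z` and `conj z`. -/
noncomputable def polyLaplacian : MvPolynomial (Fin d ⊕ Fin d) ℂ :=
  ∑ j, C 4 * pderiv (Sum.inl j) (pderiv (Sum.inr j) p)

lemma fderiv_single_one (u : Cn d → ℂ) (z : Cn d) (j : Fin d) :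
    fderiv ℝ u z (EuclideanSpace.single j 1) = dz j u z + dzbar j u z := by
  simp only [dz, dzbar]; ring

lemma fderiv_single_I (u : Cn d → ℂ) (z : Cn d) (j : Fin d) :
    fderiv ℝ u z (EuclideanSpace.single j Complex.I) =
      Complex.I * (dz j u z - dzbar j u z) := by
  simp only [dz, dzbar]; ring_nf; simp

/-- In the real directions e_j and i e_j the derivatives are ∂_j + ∂bar_j and i(∂_j - ∂bar_j). In
the sum of their squares the pure second derivatives cancel and 4 ∂_j ∂bar_j remains. -/
lemma laplacian_evalPoly : Laplacian.laplacian (evalPoly p) = evalPoly (polyLaplacian p) := by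
  let b : OrthonormalBasis ((_ : Fin d) × Fin 2) ℝ (Cn d) :=
    Pi.orthonormalBasis fun _ : Fin d => Complex.orthonormalBasisOneI
  have hb0 : ∀ j, b ⟨j, 0⟩ = EuclideanSpace.single j (1 : ℂ) := by
    intro j; simp [b]
  have hb1 : ∀ j, b ⟨j, 1⟩ = EuclideanSpace.single j Complex.I := by
    intro j; simp [b]
  rw [InnerProductSpace.laplacian_eq_iteratedFDeriv_orthonormalBasis _ b]
  funext z
  have key : ∀ e : Cn d, iteratedFDeriv ℝ 2 (evalPoly p) z ![e, e] =
      fderiv ℝ (fun y => fderiv ℝ (evalPoly p) y e) z e := by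
    intro e
    rw [iteratedFDeriv_two_apply]
    have : DifferentiableAt ℝ (fderiv ℝ (evalPoly p)) z :=
      ((contDiff_evalPoly p (n := 2)).fderiv_right (m := 1) (by norm_num)).differentiable (by simp) z
    rw [fderiv_clm_apply this (by simp)]
    simp
  simp only [key, polyLaplacian, evalPoly_sum]
  rw [Fintype.sum_sigma]
  refine Finset.sum_congr rfl fun j _ => ?_
  rw [Fin.sum_univ_two, hb0, hb1]
  have h1 : (fun y => fderiv ℝ (evalPoly p) y (EuclideanSpace.single j (1 : ℂ))) =
      evalPoly (pderiv (Sum.inl j) p + pderiv (Sum.inr j) p) := by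
    funext y; rw [fderiv_single_one, dz_evalPoly, dzbar_evalPoly, evalPoly_add]
  have h2 : (fun y => fderiv ℝ (evalPoly p) y (EuclideanSpace.single j Complex.I)) =
      evalPoly (C Complex.I * (pderiv (Sum.inl j) p - pderiv (Sum.inr j) p)) := by
    funext y; rw [fderiv_single_I, dz_evalPoly, dzbar_evalPoly, evalPoly_mul, evalPoly_sub,
      evalPoly_C]
  rw [h1, h2, fderiv_single_one, fderiv_single_I, dz_evalPoly, dzbar_evalPoly, dz_evalPoly,
    dzbar_evalPoly]
  have hc : pderiv (Sum.inr j) (pderiv (Sum.inl j) p) = pderiv (Sum.inl j) (pderiv (Sum.inr j) p) :=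
    pderiv_comm _ _ _
  simp only [map_add, map_sub, evalPoly_add, pderiv_C_mul, evalPoly_mul, evalPoly_C,
    evalPoly_sub, hc]
  linear_combination (evalPoly (pderiv (Sum.inl j) (pderiv (Sum.inl j) p)) z -
    2 * evalPoly (pderiv (Sum.inl j) (pderiv (Sum.inr j) p)) z +
    evalPoly (pderiv (Sum.inr j) (pderiv (Sum.inr j) p)) z) * Complex.I_mul_I

end Polynomials

end SpecialHermite

namespace SpecialHermite

variable {d : ℕ}

/-! ### Algebra of bihomogeneous polynomials -/

section Bihomogeneous

open MvPolynomial

/-- `p` is homogeneous of degree `m` in `z` and of degree `n` in `conj z`. -/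
def IsBihom (p : MvPolynomial (Fin d ⊕ Fin d) ℂ) (m n : ℕ) : Prop :=
  p.IsWeightedHomogeneous (Sum.elim (fun _ => 1) (fun _ => 0) : Fin d ⊕ Fin d → ℕ) m ∧
  p.IsWeightedHomogeneous (Sum.elim (fun _ => 0) (fun _ => 1) : Fin d ⊕ Fin d → ℕ) n

variable {p q : MvPolynomial (Fin d ⊕ Fin d) ℂ} {m n m' n' : ℕ}

lemma IsBihom.mul (hp : IsBihom p m n) (hq : IsBihom q m' n') :
    IsBihom (p * q) (m + m') (n + n') := ⟨hp.1.mul hq.1, hp.2.mul hq.2⟩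

lemma IsBihom.add (hp : IsBihom p m n) (hq : IsBihom q m n) : IsBihom (p + q) m n :=
  ⟨hp.1.add hq.1, hp.2.add hq.2⟩

lemma IsBihom.C_mul (c : ℂ) (hp : IsBihom p m n) : IsBihom (C c * p) m n := by
  refine ⟨?_, ?_⟩
  · simpa using (isWeightedHomogeneous_C _ c).mul hp.1
  · simpa using (isWeightedHomogeneous_C _ c).mul hp.2

lemma IsBihom.sub (hp : IsBihom p m n) (hq : IsBihom q m n) : IsBihom (p - q) m n := by
  have := hp.add (hq.C_mul (-1)); simpa [sub_eq_add_neg] using this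

lemma isBihom_zero : IsBihom (0 : MvPolynomial (Fin d ⊕ Fin d) ℂ) m n :=
  ⟨isWeightedHomogeneous_zero _ _ _, isWeightedHomogeneous_zero _ _ _⟩

lemma IsBihom.sum {ι : Type*} {s : Finset ι} {f : ι → MvPolynomial (Fin d ⊕ Fin d) ℂ}
    (h : ∀ i ∈ s, IsBihom (f i) m n) : IsBihom (∑ i ∈ s, f i) m n := by
  classical
  induction s using Finset.induction_on with
  | empty => simpa using isBihom_zero
  | insert a s ha ih =>
    rw [Finset.sum_insert ha]
    exact (h a (by simp)).add (ih fun i hi => h i (by simp [hi]))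

lemma isBihom_X_inl (j : Fin d) :
    IsBihom (X (Sum.inl j) : MvPolynomial (Fin d ⊕ Fin d) ℂ) 1 0 :=
  ⟨isWeightedHomogeneous_X _ _ _, isWeightedHomogeneous_X _ _ _⟩

lemma isBihom_X_inr (j : Fin d) :
    IsBihom (X (Sum.inr j) : MvPolynomial (Fin d ⊕ Fin d) ℂ) 0 1 :=
  ⟨isWeightedHomogeneous_X _ _ _, isWeightedHomogeneous_X _ _ _⟩

lemma IsBihom.pderiv_inl (hp : IsBihom p (m + 1) n) (j : Fin d) :
    IsBihom (pderiv (Sum.inl j) p) m n :=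
  ⟨hp.1.pderiv rfl, hp.2.pderiv rfl⟩

lemma IsBihom.pderiv_inr (hp : IsBihom p m (n + 1)) (j : Fin d) :
    IsBihom (pderiv (Sum.inr j) p) m n :=
  ⟨hp.1.pderiv rfl, hp.2.pderiv rfl⟩

lemma IsBihom.pderiv_inl_eq_zero (hp : IsBihom p 0 n) (j : Fin d) :
    pderiv (Sum.inl j) p = 0 := by
  ext a
  rw [coeff_pderiv, coeff_zero]
  by_contra h
  have h1 := hp.1 (left_ne_zero_of_mul h)
  rw [map_add, Finsupp.weight_single] at h1
  simp at h1

lemma IsBihom.pderiv_inr_eq_zero (hp : IsBihom p m 0) (j : Fin d) :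
    pderiv (Sum.inr j) p = 0 := by
  ext a
  rw [coeff_pderiv, coeff_zero]
  by_contra h
  have h1 := hp.2 (left_ne_zero_of_mul h)
  rw [map_add, Finsupp.weight_single] at h1
  simp at h1

lemma IsBihom.euler_inl (hp : IsBihom p m n) :
    ∑ j, X (Sum.inl j) * pderiv (Sum.inl j) p = (m : MvPolynomial (Fin d ⊕ Fin d) ℂ) * p := by
  have := hp.1.sum_weight_X_mul_pderiv
  simpa [Fintype.sum_sum_type] using this

lemma IsBihom.euler_inr (hp : IsBihom p m n) :
    ∑ j, X (Sum.inr j) * pderiv (Sum.inr j) p = (n : MvPolynomial (Fin d ⊕ Fin d) ℂ) * p := by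
  have := hp.2.sum_weight_X_mul_pderiv
  simpa [Fintype.sum_sum_type] using this

lemma IsBihom.polyLaplacian (hp : IsBihom p (m + 1) (n + 1)) : IsBihom (polyLaplacian p) m n :=
  IsBihom.sum fun j _ => ((hp.pderiv_inr j).pderiv_inl j).C_mul 4

lemma IsBihom.polyLaplacian_eq_zero (hp : IsBihom p m n) (h : m = 0 ∨ n = 0) :
    SpecialHermite.polyLaplacian p = 0 := by
  unfold SpecialHermite.polyLaplacian
  refine Finset.sum_eq_zero fun j _ => ?_
  rcases h with rfl | rfl
  · rw [pderiv_comm, hp.pderiv_inl_eq_zero]; simp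
  · rw [hp.pderiv_inr_eq_zero]; simp

lemma polyLaplacian_zero : polyLaplacian (0 : MvPolynomial (Fin d ⊕ Fin d) ℂ) = 0 := by
  simp [polyLaplacian]

lemma polyLaplacian_add (p q : MvPolynomial (Fin d ⊕ Fin d) ℂ) :
    polyLaplacian (p + q) = polyLaplacian p + polyLaplacian q := by
  simp [polyLaplacian, mul_add, Finset.sum_add_distrib]

lemma polyLaplacian_C_mul (c : ℂ) (p : MvPolynomial (Fin d ⊕ Fin d) ℂ) :
    polyLaplacian (C c * p) = C c * polyLaplacian p := by
  simp only [polyLaplacian, pderiv_C_mul, Finset.mul_sum]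
  exact Finset.sum_congr rfl fun _ _ => by ring

lemma polyLaplacian_sub (p q : MvPolynomial (Fin d ⊕ Fin d) ℂ) :
    polyLaplacian (p - q) = polyLaplacian p - polyLaplacian q := by
  simp [polyLaplacian, mul_sub, Finset.sum_sub_distrib]

/-- The polynomial `|z|²`. -/
noncomputable def normSqPoly (d : ℕ) : MvPolynomial (Fin d ⊕ Fin d) ℂ :=
  ∑ j, X (Sum.inl j) * X (Sum.inr j)

lemma isBihom_normSqPoly : IsBihom (normSqPoly d) 1 1 :=
  IsBihom.sum fun j _ => (isBihom_X_inl j).mul (isBihom_X_inr j)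

lemma evalPoly_normSqPoly (z : Cn d) : evalPoly (normSqPoly d) z = ((‖z‖ ^ 2 : ℝ) : ℂ) := by
  simp [normSqPoly, EuclideanSpace.norm_sq_eq, Complex.mul_conj, Complex.normSq_eq_norm_sq]

lemma pderiv_inl_normSqPoly (j : Fin d) :
    pderiv (Sum.inl j) (normSqPoly d) = X (Sum.inr j) := by
  simp [normSqPoly, pderiv_X, Pi.single_apply]

lemma pderiv_inr_normSqPoly (j : Fin d) :
    pderiv (Sum.inr j) (normSqPoly d) = X (Sum.inl j) := by
  simp [normSqPoly, pderiv_X, Pi.single_apply]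

/-- The commutator of the Laplacian with |z|² is 4(d + E + Ebar), where E and Ebar are the Euler
operators in z and conj z; these act on a bihomogeneous polynomial as m and n. -/
lemma polyLaplacian_normSqPoly_mul (hp : IsBihom p m n) :
    polyLaplacian (normSqPoly d * p) =
      normSqPoly d * polyLaplacian p + C (4 * (d + m + n) : ℂ) * p := by
  have key : polyLaplacian (normSqPoly d * p) = normSqPoly d * polyLaplacian p +
      C 4 * ((d : MvPolynomial (Fin d ⊕ Fin d) ℂ) * p + ∑ j, X (Sum.inl j) * pderiv (Sum.inl j) p +
        ∑ j, X (Sum.inr j) * pderiv (Sum.inr j) p) := by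
    have hd : (d : MvPolynomial (Fin d ⊕ Fin d) ℂ) * p = ∑ _j : Fin d, p := by simp
    rw [hd, ← Finset.sum_add_distrib, ← Finset.sum_add_distrib]
    simp only [polyLaplacian, Finset.mul_sum]
    rw [← Finset.sum_add_distrib]
    refine Finset.sum_congr rfl fun j _ => ?_
    simp only [pderiv_mul, map_add, pderiv_inl_normSqPoly, pderiv_inr_normSqPoly, pderiv_X_self]
    ring
  rw [key, hp.euler_inl, hp.euler_inr]
  simp only [map_mul, map_add, map_natCast]
  ring

lemma IsBihom.normSqPoly_pow_mul (hp : IsBihom p m n) (k : ℕ) :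
    IsBihom (normSqPoly d ^ k * p) (k + m) (k + n) := by
  induction k with
  | zero => simpa using hp
  | succ k ih =>
    have := isBihom_normSqPoly.mul ih
    rw [pow_succ', mul_assoc]
    convert this using 1 <;> ring

/-- Iterating the commutator with |z|² only adds up constants 4(d + ...), each positive because d >
0. The value of c is irrelevant; that it can be inverted is what counts. -/
lemma exists_polyLaplacian_normSqPoly_pow_mul (hd : 0 < d) (hp : IsBihom p m n)
    (h : polyLaplacian p = 0) (k : ℕ) :
    ∃ c : ℕ, 0 < c ∧ polyLaplacian (normSqPoly d ^ (k + 1) * p) =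
      C (c : ℂ) * (normSqPoly d ^ k * p) := by
  induction k with
  | zero =>
    refine ⟨4 * (d + m + n), by positivity, ?_⟩
    rw [zero_add, pow_one, polyLaplacian_normSqPoly_mul hp, h]
    simp
  | succ k ih =>
    obtain ⟨c, hc, ih⟩ := ih
    refine ⟨c + 4 * (d + (k + 1 + m) + (k + 1 + n)), by positivity, ?_⟩
    rw [pow_succ', mul_assoc, polyLaplacian_normSqPoly_mul (hp.normSqPoly_pow_mul (k + 1)), ih,
      pow_succ']
    push_cast
    simp only [map_mul, map_add, map_natCast]
    ring

/-- Each Laplacian strips one factor |z|² at the cost of a positive constant. This is what permits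
solving Δ^k u = q with u a multiple of |z|^{2k} q. -/
lemma exists_iterate_polyLaplacian_normSqPoly_pow_mul (hd : 0 < d) (hp : IsBihom p m n)
    (h : polyLaplacian p = 0) (k : ℕ) :
    ∃ c : ℕ, 0 < c ∧ polyLaplacian^[k] (normSqPoly d ^ k * p) = C (c : ℂ) * p := by
  induction k with
  | zero => exact ⟨1, one_pos, by simp⟩
  | succ k ih =>
    obtain ⟨c, hc, ih⟩ := ih
    obtain ⟨c', hc', h'⟩ := exists_polyLaplacian_normSqPoly_pow_mul hd hp h k
    have hC : ∀ (i : ℕ) (a : ℂ) (r : MvPolynomial (Fin d ⊕ Fin d) ℂ),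
        polyLaplacian^[i] (C a * r) = C a * polyLaplacian^[i] r := by
      intro i a
      induction i with
      | zero => intro r; rfl
      | succ i ih => intro r; rw [Function.iterate_succ_apply, polyLaplacian_C_mul, ih,
          Function.iterate_succ_apply]
    refine ⟨c' * c, by positivity, ?_⟩
    rw [Function.iterate_succ_apply, h', hC, ih]
    push_cast; rw [map_mul]; ring

lemma iterate_polyLaplacian_sub (k : ℕ) (p q : MvPolynomial (Fin d ⊕ Fin d) ℂ) :
    polyLaplacian^[k] (p - q) = polyLaplacian^[k] p - polyLaplacian^[k] q := by
  induction k generalizing p q with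
  | zero => rfl
  | succ k ih => simp only [Function.iterate_succ_apply, polyLaplacian_sub, ih]

lemma iterate_polyLaplacian_C_mul (k : ℕ) (c : ℂ) (p : MvPolynomial (Fin d ⊕ Fin d) ℂ) :
    polyLaplacian^[k] (C c * p) = C c * polyLaplacian^[k] p := by
  induction k generalizing p with
  | zero => rfl
  | succ k ih => simp only [Function.iterate_succ_apply, polyLaplacian_C_mul, ih]

lemma iterate_polyLaplacian_zero (k : ℕ) :
    polyLaplacian^[k] (0 : MvPolynomial (Fin d ⊕ Fin d) ℂ) = 0 :=
  Function.iterate_fixed polyLaplacian_zero k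

/-- Both degrees drop by one at each step and the result vanishes once a degree is exhausted. The
alternative keeps the truncated differences `m - k` and `n - k` meaningful. -/
lemma IsBihom.iterate_polyLaplacian (hp : IsBihom p m n) (k : ℕ) :
    SpecialHermite.polyLaplacian^[k] p = 0 ∨
      (k ≤ m ∧ k ≤ n ∧ IsBihom (SpecialHermite.polyLaplacian^[k] p) (m - k) (n - k)) := by
  induction k generalizing p m n with
  | zero => right; simpa using hp
  | succ k ih =>
    rw [Function.iterate_succ_apply]
    rcases m with _ | m
    · left; rw [hp.polyLaplacian_eq_zero (Or.inl rfl), iterate_polyLaplacian_zero]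
    rcases n with _ | n
    · left; rw [hp.polyLaplacian_eq_zero (Or.inr rfl), iterate_polyLaplacian_zero]
    simpa using ih hp.polyLaplacian

/-! ### Rotation operators -/

/-- `conj z_j ∂_k - conj z_k ∂_j` on polynomials. -/
noncomputable def rot (j k : Fin d) (p : MvPolynomial (Fin d ⊕ Fin d) ℂ) :
    MvPolynomial (Fin d ⊕ Fin d) ℂ :=
  X (Sum.inr j) * pderiv (Sum.inl k) p - X (Sum.inr k) * pderiv (Sum.inl j) p

/-- `z_j ∂bar_k - z_k ∂bar_j` on polynomials. -/
noncomputable def rotBar (j k : Fin d) (p : MvPolynomial (Fin d ⊕ Fin d) ℂ) :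
    MvPolynomial (Fin d ⊕ Fin d) ℂ :=
  X (Sum.inl j) * pderiv (Sum.inr k) p - X (Sum.inl k) * pderiv (Sum.inr j) p

lemma IsBihom.rot (hp : IsBihom p (m + 1) n) (j k : Fin d) : IsBihom (rot j k p) m (n + 1) := by
  have h : ∀ j k : Fin d, IsBihom (X (Sum.inr j) * pderiv (Sum.inl k) p) m (n + 1) := by
    intro j k
    have := (isBihom_X_inr j).mul (hp.pderiv_inl k)
    convert this using 1 <;> ring
  exact (h j k).sub (h k j)

lemma IsBihom.rotBar (hp : IsBihom p m (n + 1)) (j k : Fin d) :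
    IsBihom (rotBar j k p) (m + 1) n := by
  have h : ∀ j k : Fin d, IsBihom (X (Sum.inl j) * pderiv (Sum.inr k) p) (m + 1) n := by
    intro j k
    have := (isBihom_X_inl j).mul (hp.pderiv_inr k)
    convert this using 1 <;> ring
  exact (h j k).sub (h k j)

lemma IsBihom.rot_eq_zero (hp : IsBihom p 0 n) (j k : Fin d) :
    SpecialHermite.rot j k p = 0 := by
  simp [SpecialHermite.rot, hp.pderiv_inl_eq_zero]

lemma IsBihom.rotBar_eq_zero (hp : IsBihom p m 0) (j k : Fin d) :
    SpecialHermite.rotBar j k p = 0 := by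
  simp [SpecialHermite.rotBar, hp.pderiv_inr_eq_zero]

/-- Passing the Laplacian through conj z_j ∂_k leaves the correction 4 ∂_j ∂_k, which is symmetric
in j, k and disappears on antisymmetrising. Rotations therefore preserve harmonicity. -/
lemma polyLaplacian_rot (j k : Fin d) (p : MvPolynomial (Fin d ⊕ Fin d) ℂ) :
    polyLaplacian (rot j k p) = rot j k (polyLaplacian p) := by
  have h : ∀ j k : Fin d, polyLaplacian (X (Sum.inr j) * pderiv (Sum.inl k) p) =
      X (Sum.inr j) * pderiv (Sum.inl k) (polyLaplacian p) +
        C 4 * pderiv (Sum.inl j) (pderiv (Sum.inl k) p) := by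
    intro j k
    have : C 4 * pderiv (Sum.inl j) (pderiv (Sum.inl k) p) =
        ∑ i, if i = j then C 4 * pderiv (Sum.inl i) (pderiv (Sum.inl k) p) else 0 := by simp
    rw [this]
    simp only [polyLaplacian, map_sum, Finset.mul_sum]
    rw [← Finset.sum_add_distrib]
    refine Finset.sum_congr rfl fun i _ => ?_
    simp only [pderiv_mul, map_add, pderiv_X, Pi.single_apply]
    rw [pderiv_comm (Sum.inr i) (Sum.inl k),
      pderiv_comm (Sum.inl i) (Sum.inl k) (pderiv (Sum.inr i) p)]
    by_cases hi : i = j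
    · subst hi; simp; ring
    · have : j ≠ i := fun h => hi h.symm
      simp [hi, this]; ring
  simp only [rot, polyLaplacian_sub, h, pderiv_comm (Sum.inl j) (Sum.inl k)]
  ring

lemma polyLaplacian_rotBar (j k : Fin d) (p : MvPolynomial (Fin d ⊕ Fin d) ℂ) :
    polyLaplacian (rotBar j k p) = rotBar j k (polyLaplacian p) := by
  have h : ∀ j k : Fin d, polyLaplacian (X (Sum.inl j) * pderiv (Sum.inr k) p) =
      X (Sum.inl j) * pderiv (Sum.inr k) (polyLaplacian p) +
        C 4 * pderiv (Sum.inr j) (pderiv (Sum.inr k) p) := by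
    intro j k
    have : C 4 * pderiv (Sum.inr j) (pderiv (Sum.inr k) p) =
        ∑ i, if i = j then C 4 * pderiv (Sum.inr i) (pderiv (Sum.inr k) p) else 0 := by simp
    rw [this]
    simp only [polyLaplacian, map_sum, Finset.mul_sum]
    rw [← Finset.sum_add_distrib]
    refine Finset.sum_congr rfl fun i _ => ?_
    simp only [pderiv_mul, map_add, pderiv_X, Pi.single_apply]
    rw [pderiv_comm (Sum.inr k) (Sum.inl i), pderiv_comm (Sum.inr k) (Sum.inr i)]
    by_cases hi : i = j
    · subst hi; simp; ring
    · have : j ≠ i := fun h => hi h.symm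
      simp [hi, this]; ring
  simp only [rotBar, polyLaplacian_sub, h, pderiv_comm (Sum.inr j) (Sum.inr k)]
  ring

/-- This is the Casimir computation. The second-order terms of the double sum are either |z|² times
a Laplacian or a product of the two Euler operators, the latter acting as mn; the first-order terms
are Euler operators in z. On harmonic polynomials only the eigenvalue survives. -/
lemma sum_rotBar_rot (hp : IsBihom p m n) :
    C 2 * ∑ j, ∑ k, rotBar j k (rot j k p) = normSqPoly d * polyLaplacian p -
      C (4 * m * (n + d - 1) : ℂ) * p := by
  -- One half of the composition; the other half comes from exchanging j and k. The Kronecker term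
  -- makes `A j j` vanish, as the rotation with equal indices does.
  let A : Fin d → Fin d → MvPolynomial (Fin d ⊕ Fin d) ℂ := fun j k =>
    (if j = k then X (Sum.inl j) * pderiv (Sum.inl j) p else 0) +
      X (Sum.inl j) * X (Sum.inr j) * pderiv (Sum.inl k) (pderiv (Sum.inr k) p) -
      X (Sum.inl j) * pderiv (Sum.inl j) p -
      X (Sum.inl j) * X (Sum.inr k) * pderiv (Sum.inl j) (pderiv (Sum.inr k) p)
  have hA : ∀ j k, rotBar j k (rot j k p) = A j k + A k j := by
    intro j k
    rcases eq_or_ne j k with rfl | h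
    · simp [A, rot, rotBar]
    · simp only [A, rot, rotBar, map_sub, pderiv_mul, pderiv_X, Pi.single_apply, h, h.symm,
        if_false, Sum.inl.injEq, Sum.inr.injEq, reduceCtorEq, if_true,
        pderiv_comm (Sum.inr j) (Sum.inl j), pderiv_comm (Sum.inr k) (Sum.inl k),
        pderiv_comm (Sum.inr j) (Sum.inl k), pderiv_comm (Sum.inr k) (Sum.inl j)]
      ring
  simp only [hA, Finset.sum_add_distrib]
  rw [Finset.sum_comm (f := fun j k => A k j)]
  have h1 : ∑ j, ∑ k, X (Sum.inl j) * X (Sum.inr k) *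
      pderiv (Sum.inl j) (pderiv (Sum.inr k) p) = C (m * n : ℂ) * p := by
    have : ∀ j, ∑ k, X (Sum.inl j) * X (Sum.inr k) * pderiv (Sum.inl j) (pderiv (Sum.inr k) p) =
        X (Sum.inl j) * pderiv (Sum.inl j) (∑ k, X (Sum.inr k) * pderiv (Sum.inr k) p) := by
      intro j
      rw [map_sum, Finset.mul_sum]
      refine Finset.sum_congr rfl fun k _ => ?_
      simp only [pderiv_mul, pderiv_X, Pi.single_apply, reduceCtorEq, if_false]
      ring
    simp only [this, hp.euler_inr]
    have h2 : ∀ j, pderiv (Sum.inl j) ((n : MvPolynomial (Fin d ⊕ Fin d) ℂ) * p) =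
        n * pderiv (Sum.inl j) p := by intro j; simp
    simp only [h2, mul_left_comm _ (n : MvPolynomial (Fin d ⊕ Fin d) ℂ), ← Finset.mul_sum,
      hp.euler_inl]
    simp only [map_mul, map_natCast]; ring
  have h3 : ∑ j, ∑ k, C 4 * (X (Sum.inl j) * X (Sum.inr j) *
      pderiv (Sum.inl k) (pderiv (Sum.inr k) p)) = normSqPoly d * polyLaplacian p := by
    simp only [normSqPoly, polyLaplacian, Finset.sum_mul_sum]
    refine Finset.sum_congr rfl fun j _ => Finset.sum_congr rfl fun k _ => ?_
    ring
  have h4 : ∑ j, ∑ k, A j k = (m : MvPolynomial (Fin d ⊕ Fin d) ℂ) * p +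
      ∑ j, ∑ k, X (Sum.inl j) * X (Sum.inr j) * pderiv (Sum.inl k) (pderiv (Sum.inr k) p) -
      (d : MvPolynomial (Fin d ⊕ Fin d) ℂ) *
        ((m : MvPolynomial (Fin d ⊕ Fin d) ℂ) * p) - C (m * n : ℂ) * p := by
    simp only [A, Finset.sum_sub_distrib, Finset.sum_add_distrib, h1, Finset.sum_ite_eq,
      Finset.mem_univ, if_true, hp.euler_inl, Finset.sum_const, Finset.card_univ, Fintype.card_fin,
      nsmul_eq_mul, ← Finset.mul_sum]
  rw [h4, ← h3]
  simp only [← Finset.mul_sum, map_mul, map_sub, map_add, map_natCast, map_one]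
  have c4 : (C 4 : MvPolynomial (Fin d ⊕ Fin d) ℂ) = 4 := rfl
  have c2 : (C 2 : MvPolynomial (Fin d ⊕ Fin d) ℂ) = 2 := rfl
  rw [c4, c2]
  ring

/-- The same computation with z and conj z exchanged. -/
lemma sum_rot_rotBar (hp : IsBihom p m n) :
    C 2 * ∑ j, ∑ k, rot j k (rotBar j k p) = normSqPoly d * polyLaplacian p -
      C (4 * n * (m + d - 1) : ℂ) * p := by
  let A : Fin d → Fin d → MvPolynomial (Fin d ⊕ Fin d) ℂ := fun j k =>
    (if j = k then X (Sum.inr j) * pderiv (Sum.inr j) p else 0) +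
      X (Sum.inr j) * X (Sum.inl j) * pderiv (Sum.inr k) (pderiv (Sum.inl k) p) -
      X (Sum.inr j) * pderiv (Sum.inr j) p -
      X (Sum.inr j) * X (Sum.inl k) * pderiv (Sum.inr j) (pderiv (Sum.inl k) p)
  have hA : ∀ j k, rot j k (rotBar j k p) = A j k + A k j := by
    intro j k
    rcases eq_or_ne j k with rfl | h
    · simp [A, rot, rotBar]
    · simp only [A, rot, rotBar, map_sub, pderiv_mul, pderiv_X, Pi.single_apply, h, h.symm,
        if_false, Sum.inl.injEq, Sum.inr.injEq, reduceCtorEq, if_true,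
        pderiv_comm (Sum.inl j) (Sum.inr j), pderiv_comm (Sum.inl k) (Sum.inr k),
        pderiv_comm (Sum.inl j) (Sum.inr k), pderiv_comm (Sum.inl k) (Sum.inr j)]
      ring
  simp only [hA, Finset.sum_add_distrib]
  rw [Finset.sum_comm (f := fun j k => A k j)]
  have h1 : ∑ j, ∑ k, X (Sum.inr j) * X (Sum.inl k) *
      pderiv (Sum.inr j) (pderiv (Sum.inl k) p) = C (n * m : ℂ) * p := by
    have : ∀ j, ∑ k, X (Sum.inr j) * X (Sum.inl k) * pderiv (Sum.inr j) (pderiv (Sum.inl k) p) =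
        X (Sum.inr j) * pderiv (Sum.inr j) (∑ k, X (Sum.inl k) * pderiv (Sum.inl k) p) := by
      intro j
      rw [map_sum, Finset.mul_sum]
      refine Finset.sum_congr rfl fun k _ => ?_
      simp only [pderiv_mul, pderiv_X, Pi.single_apply, reduceCtorEq, if_false]
      ring
    simp only [this, hp.euler_inl]
    have h2 : ∀ j, pderiv (Sum.inr j) ((m : MvPolynomial (Fin d ⊕ Fin d) ℂ) * p) =
        m * pderiv (Sum.inr j) p := by intro j; simp
    simp only [h2, mul_left_comm _ (m : MvPolynomial (Fin d ⊕ Fin d) ℂ), ← Finset.mul_sum,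
      hp.euler_inr]
    simp only [map_mul, map_natCast]; ring
  have h3 : ∑ j, ∑ k, C 4 * (X (Sum.inr j) * X (Sum.inl j) *
      pderiv (Sum.inr k) (pderiv (Sum.inl k) p)) = normSqPoly d * polyLaplacian p := by
    simp only [normSqPoly, polyLaplacian, Finset.sum_mul_sum]
    refine Finset.sum_congr rfl fun j _ => Finset.sum_congr rfl fun k _ => ?_
    rw [pderiv_comm (Sum.inl k)]
    ring
  have h4 : ∑ j, ∑ k, A j k = (n : MvPolynomial (Fin d ⊕ Fin d) ℂ) * p +
      ∑ j, ∑ k, X (Sum.inr j) * X (Sum.inl j) * pderiv (Sum.inr k) (pderiv (Sum.inl k) p) -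
      (d : MvPolynomial (Fin d ⊕ Fin d) ℂ) *
        ((n : MvPolynomial (Fin d ⊕ Fin d) ℂ) * p) - C (n * m : ℂ) * p := by
    simp only [A, Finset.sum_sub_distrib, Finset.sum_add_distrib, h1, Finset.sum_ite_eq,
      Finset.mem_univ, if_true, hp.euler_inr, Finset.sum_const, Finset.card_univ, Fintype.card_fin,
      nsmul_eq_mul, ← Finset.mul_sum]
  rw [h4, ← h3]
  simp only [← Finset.mul_sum, map_mul, map_sub, map_add, map_natCast, map_one]
  have c4 : (C 4 : MvPolynomial (Fin d ⊕ Fin d) ℂ) = 4 := rfl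
  have c2 : (C 2 : MvPolynomial (Fin d ⊕ Fin d) ℂ) = 2 := rfl
  rw [c4, c2]
  ring

end Bihomogeneous

end SpecialHermite

namespace SpecialHermite

variable {d : ℕ}

/-! ### Polar coordinates -/

section Polar

instance : IsFiniteMeasure (sphMeasure d) := by unfold sphMeasure; infer_instance

/-- The radial part `r^{2d-1} dr` of Lebesgue measure on `ℂ^d`. -/
noncomputable def radialMeasure (d : ℕ) : Measure ℝ :=
  (volume.restrict (Ioi (0 : ℝ))).withDensity fun r => ENNReal.ofReal (r ^ (2 * d - 1))

instance : SFinite (radialMeasure d) := by unfold radialMeasure; infer_instance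

lemma finrank_Cn : Module.finrank ℝ (Cn d) = 2 * d := by
  have := Module.finrank_mul_finrank ℝ ℂ (Cn d)
  simp [Complex.finrank_real_complex] at this
  omega

/-- The density r^{2d-1} is strictly positive on the half-line, so both measures have the same null
sets. -/
lemma ae_radialMeasure_iff {p : ℝ → Prop} :
    (∀ᵐ r ∂radialMeasure d, p r) ↔ ∀ᵐ r ∂volume.restrict (Ioi (0 : ℝ)), p r := by
  unfold radialMeasure
  rw [ae_withDensity_iff (by fun_prop)]
  constructor
  · intro h
    filter_upwards [h, ae_restrict_mem measurableSet_Ioi] with r hr hr0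
    exact hr (by simpa using pow_pos hr0 _)
  · intro h
    filter_upwards [h] with r hr _ using hr

lemma measurable_polar : Measurable (fun q : Sph d × ℝ => q.2 • (q.1 : Cn d)) := by
  fun_prop

lemma norm_smul_sphere {r : ℝ} (hr : 0 < r) (ζ : Sph d) : ‖r • (ζ : Cn d)‖ = r := by
  have h1 : ‖(ζ : Cn d)‖ = 1 := by simp
  rw [norm_smul, h1, mul_one, Real.norm_of_nonneg hr.le]

section

variable {E : Type*} [NormedAddCommGroup E] [NormedSpace ℝ E]

lemma integrable_radialMeasure_iff {u : ℝ → E} :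
    Integrable u (radialMeasure d) ↔
      IntegrableOn (fun r : ℝ => r ^ (2 * d - 1) • u r) (Ioi (0 : ℝ)) := by
  unfold radialMeasure
  rw [integrable_withDensity_iff_integrable_smul' (by fun_prop) (by simp), IntegrableOn]
  refine integrable_congr ?_
  filter_upwards [ae_restrict_mem measurableSet_Ioi] with r hr
  rw [ENNReal.toReal_ofReal (pow_nonneg (le_of_lt hr) _)]

lemma integral_radialMeasure (u : ℝ → E) :
    ∫ r, u r ∂radialMeasure d = ∫ r in Ioi (0 : ℝ), r ^ (2 * d - 1) • u r := by
  unfold radialMeasure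
  rw [integral_withDensity_eq_integral_toReal_smul₀ (by fun_prop) (by simp)]
  refine integral_congr_ae ?_
  filter_upwards [ae_restrict_mem measurableSet_Ioi] with r hr
  rw [ENNReal.toReal_ofReal (pow_nonneg (le_of_lt hr) _)]

end

variable [NeZero d]

/-- Polar coordinates preserve measure. -/
lemma measurePreserving_polar :
    MeasurePreserving (fun q : Sph d × ℝ => q.2 • (q.1 : Cn d))
      ((sphMeasure d).prod (radialMeasure d)) volume := by
  have hd : 0 < d := Nat.pos_of_ne_zero (NeZero.ne d)
  refine ⟨measurable_polar, ?_⟩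
  have h1 := (volume : Measure (Cn d)).measurePreserving_homeomorphUnitSphereProd
  have h2 : MeasurePreserving (homeomorphUnitSphereProd (Cn d)).toMeasurableEquiv
    (volume.comap (Subtype.val : ({0}ᶜ : Set (Cn d)) → Cn d))
    ((sphMeasure d).prod (Measure.volumeIoiPow (Module.finrank ℝ (Cn d) - 1))) := h1
  have h3 := h2.symm
  rw [finrank_Cn] at h3
  have h4 : Measure.map (Subtype.val : Ioi (0 : ℝ) → ℝ) (Measure.volumeIoiPow (2 * d - 1)) =
      radialMeasure d := by
    ext s hs
    rw [Measure.map_apply measurable_subtype_coe hs, Measure.volumeIoiPow, radialMeasure,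
      withDensity_apply _ (measurable_subtype_coe hs), withDensity_apply _ hs,
      setLIntegral_subtype measurableSet_Ioi _ fun a : ℝ ↦ .ofReal (a ^ (2 * d - 1)),
      Measure.restrict_restrict hs]
    congr 2
    rw [Subtype.image_preimage_coe, inter_comm]
  have h5 : Measure.map (Prod.map id (Subtype.val : Ioi (0 : ℝ) → ℝ))
      ((sphMeasure d).prod (Measure.volumeIoiPow (2 * d - 1))) =
      (sphMeasure d).prod (radialMeasure d) := by
    rw [← h4, ← Measure.map_prod_map _ _ measurable_id measurable_subtype_coe, Measure.map_id]
  have : Nontrivial (Cn d) := by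
    have : Nonempty (Fin d) := ⟨⟨0, hd⟩⟩
    infer_instance
  rw [← h5, Measure.map_map measurable_polar (by fun_prop)]
  have h6 : (fun q : Sph d × ℝ => q.2 • (q.1 : Cn d)) ∘
      (Prod.map id (Subtype.val : Ioi (0 : ℝ) → ℝ)) =
      (Subtype.val : ({0}ᶜ : Set (Cn d)) → Cn d) ∘
        (homeomorphUnitSphereProd (Cn d)).toMeasurableEquiv.symm := by
    funext q
    simp [homeomorphUnitSphereProd]
  -- Polar coordinates reach only the punctured space; the missing origin is a null set.
  rw [h6, ← Measure.map_map measurable_subtype_coe (MeasurableEquiv.measurable _), h3.map_eq,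
    map_comap_subtype_coe (by measurability), Measure.restrict_eq_self_of_ae_mem]
  rw [ae_iff]; simp

variable {E : Type*} [NormedAddCommGroup E] {Ψ : Cn d → E}

lemma integrable_polar (h : Integrable Ψ) :
    Integrable (fun q : Sph d × ℝ => Ψ (q.2 • (q.1 : Cn d)))
      ((sphMeasure d).prod (radialMeasure d)) :=
  measurePreserving_polar.integrable_comp_of_integrable h

lemma ae_sphere_integrable_of_integrable (h : Integrable Ψ) :
    ∀ᵐ r ∂volume.restrict (Ioi (0 : ℝ)),
      Integrable (fun ζ : Sph d => Ψ (r • (ζ : Cn d))) (sphMeasure d) := by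
  rw [← ae_radialMeasure_iff (d := d)]
  exact (integrable_polar h).prod_left_ae

variable [NormedSpace ℝ E]

lemma integrableOn_polar (h : Integrable Ψ) :
    IntegrableOn (fun r : ℝ => r ^ (2 * d - 1) • ∫ ζ, Ψ (r • (ζ : Cn d)) ∂sphMeasure d)
      (Ioi (0 : ℝ)) := by
  rw [← integrable_radialMeasure_iff]
  exact (integrable_polar h).integral_prod_right

lemma integral_polar (h : Integrable Ψ) :
    ∫ z, Ψ z = ∫ r in Ioi (0 : ℝ),
      r ^ (2 * d - 1) • ∫ ζ, Ψ (r • (ζ : Cn d)) ∂sphMeasure d := by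
  rw [← integral_radialMeasure, ← measurePreserving_polar.map_eq,
    integral_map measurable_polar.aemeasurable
      (by rw [measurePreserving_polar.map_eq]; exact h.aestronglyMeasurable),
    integral_prod_symm _ (integrable_polar h)]

/-- Fubini applies to the truncation of Ψ to each ball of integer radius. There are countably many
exceptional sets of radii, and each sphere lies in one of the balls. -/
lemma ae_sphere_integrable (h : LocallyIntegrable Ψ) :
    ∀ᵐ r ∂volume.restrict (Ioi (0 : ℝ)),
      Integrable (fun ζ : Sph d => Ψ (r • (ζ : Cn d))) (sphMeasure d) := by
  have hk : ∀ k : ℕ, ∀ᵐ r ∂volume.restrict (Ioi (0 : ℝ)), Integrable (fun ζ : Sph d =>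
      (Metric.closedBall (0 : Cn d) k).indicator Ψ (r • (ζ : Cn d))) (sphMeasure d) := fun k =>
    ae_sphere_integrable_of_integrable ((integrable_indicator_iff measurableSet_closedBall).2
      (h.integrableOn_isCompact (isCompact_closedBall _ _)))
  rw [← ae_all_iff] at hk
  filter_upwards [hk, ae_restrict_mem measurableSet_Ioi] with r hr hr0
  obtain ⟨k, hk⟩ := exists_nat_ge r
  refine (hr k).congr (Filter.Eventually.of_forall fun ζ => ?_)
  simp only
  rw [indicator_of_mem]
  rw [Metric.mem_closedBall, dist_zero_right, norm_smul_sphere hr0]; exact hk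

lemma locallyIntegrableOn_sphere_integral (h : LocallyIntegrable Ψ) :
    LocallyIntegrableOn (fun r : ℝ => ∫ ζ, Ψ (r • (ζ : Cn d)) ∂sphMeasure d) (Ioi (0 : ℝ)) := by
  have h1 : LocallyIntegrableOn (fun r : ℝ => r ^ (2 * d - 1) •
      ∫ ζ, Ψ (r • (ζ : Cn d)) ∂sphMeasure d) (Ioi (0 : ℝ)) := by
    intro x hx
    have h2 := integrableOn_polar ((integrable_indicator_iff measurableSet_closedBall).2
      (h.integrableOn_isCompact (isCompact_closedBall (0 : Cn d) (x + 1))))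
    refine ⟨Ioi 0 ∩ Iio (x + 1), Filter.inter_mem self_mem_nhdsWithin
      (mem_nhdsWithin_of_mem_nhds (Iio_mem_nhds (by linarith))), ?_⟩
    refine (h2.mono_set inter_subset_left).congr_fun (fun r hr => ?_) (by measurability)
    simp only
    congr 1
    refine integral_congr_ae (Filter.Eventually.of_forall fun ζ => ?_)
    simp only
    rw [indicator_of_mem]
    rw [Metric.mem_closedBall, dist_zero_right, norm_smul_sphere hr.1]; exact hr.2.le
  -- Away from the origin the Jacobian r^{2d-1} has a continuous inverse, so it can be divided out
  -- without losing local integrability.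
  have h2 := LocallyIntegrableOn.continuousOn_smul isOpen_Ioi.isLocallyClosed h1
    (g := fun r : ℝ => (r ^ (2 * d - 1))⁻¹)
    (ContinuousOn.inv₀ (by fun_prop) fun r hr => (pow_pos hr _).ne')
  intro x hx
  obtain ⟨s, hs, hs'⟩ := h2 x hx
  refine ⟨s ∩ Ioi 0, Filter.inter_mem hs self_mem_nhdsWithin, ?_⟩
  have h3 := hs'.mono_set (inter_subset_left (t := Ioi 0))
  rw [IntegrableOn] at h3 ⊢
  refine h3.congr ?_
  have h4 : ∀ᵐ r ∂volume.restrict (s ∩ Ioi 0), r ∈ Ioi (0 : ℝ) :=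
    ae_restrict_of_ae_restrict_of_subset inter_subset_right (ae_restrict_mem measurableSet_Ioi)
  filter_upwards [h4] with r hr
  rw [smul_smul, inv_mul_cancel₀ (pow_pos hr _).ne', one_smul]

end Polar

/-! ### Radial cutoffs -/

section Radial

variable {φ : ℝ → ℂ}

/-- The norm is not smooth at the origin; keeping the support of φ inside (0, ∞) makes z ↦ φ(|z|)
vanish identically near that point. -/
lemma eventually_radial_eq_zero (hφ : tsupport φ ⊆ Ioi 0) :
    ∀ᶠ z in nhds (0 : Cn d), φ ‖z‖ = 0 := by
  have h0 : (0 : ℝ) ∉ tsupport φ := fun h => lt_irrefl (0 : ℝ) (hφ h)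
  have h1 : ∀ᶠ r in nhds (0 : ℝ), φ r = 0 := notMem_tsupport_iff_eventuallyEq.1 h0
  have h2 : Filter.Tendsto (fun z : Cn d => ‖z‖) (nhds 0) (nhds 0) := by
    simpa using (continuous_norm (E := Cn d)).tendsto 0
  exact h2.eventually h1

lemma contDiff_radial (h : ContDiff ℝ ∞ φ) (hφ : tsupport φ ⊆ Ioi 0) :
    ContDiff ℝ ∞ (fun z : Cn d => φ ‖z‖) := by
  rw [contDiff_iff_contDiffAt]
  intro z
  rcases eq_or_ne z 0 with rfl | hz
  · exact (contDiffAt_const (c := (0 : ℂ))).congr_of_eventuallyEq (eventually_radial_eq_zero hφ)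
  · exact h.contDiffAt.comp z (contDiffAt_norm ℝ hz)

lemma hasCompactSupport_radial (h : HasCompactSupport φ) :
    HasCompactSupport (fun z : Cn d => φ ‖z‖) := by
  obtain ⟨R, hR⟩ := h.isCompact.isBounded.subset_closedBall 0
  refine HasCompactSupport.intro (isCompact_closedBall (0 : Cn d) R) fun z hz => ?_
  by_contra hne
  have := hR (subset_tsupport _ hne)
  simp at this hz
  linarith

lemma fderiv_radial (h : ContDiff ℝ ∞ φ) {z : Cn d} (hz : z ≠ 0) (e : Cn d) :
    fderiv ℝ (fun z : Cn d => φ ‖z‖) z e = ((‖z‖⁻¹ * inner ℝ z e : ℝ) : ℂ) * deriv φ ‖z‖ := by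
  have hn : HasFDerivAt (fun z : Cn d => ‖z‖) (‖z‖⁻¹ • innerSL ℝ z) z := by
    have h1 := (hasStrictFDerivAt_norm_sq z).hasFDerivAt
    have h2 := h1.sqrt (by positivity)
    simp only [Real.sqrt_sq (norm_nonneg _)] at h2
    have h4 : (1 / (2 * ‖z‖)) • 2 • innerSL ℝ z = ‖z‖⁻¹ • innerSL ℝ z := by
      ext e
      simp
      field_simp
    rwa [h4] at h2
  have h3 : HasDerivAt φ (deriv φ ‖z‖) ‖z‖ := (h.differentiable (by simp) _).hasDerivAt
  have h5 : HasFDerivAt (fun z : Cn d => φ ‖z‖) _ z := h3.hasFDerivAt.comp z hn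
  rw [h5.fderiv]
  simp [mul_assoc]

lemma dz_radial (h : ContDiff ℝ ∞ φ) {z : Cn d} (hz : z ≠ 0) (j : Fin d) :
    dz j (fun z : Cn d => φ ‖z‖) z = conj (z j) / (2 * ‖z‖) * deriv φ ‖z‖ := by
  rw [dz, fderiv_radial h hz, fderiv_radial h hz]
  have h1 : inner ℝ z (EuclideanSpace.single j (1 : ℂ)) = (z j).re := by
    simp [PiLp.inner_apply, apply_ite]
  have h2 : inner ℝ z (EuclideanSpace.single j Complex.I) = (z j).im := by
    simp [PiLp.inner_apply, apply_ite]
  rw [h1, h2]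
  have h3 : conj (z j) = (z j).re - Complex.I * (z j).im := by
    apply Complex.ext <;> simp
  rw [h3]
  push_cast
  have : (‖z‖ : ℂ) ≠ 0 := by simpa using hz
  field_simp

lemma dzbar_radial (h : ContDiff ℝ ∞ φ) {z : Cn d} (hz : z ≠ 0) (j : Fin d) :
    dzbar j (fun z : Cn d => φ ‖z‖) z = z j / (2 * ‖z‖) * deriv φ ‖z‖ := by
  rw [dzbar, fderiv_radial h hz, fderiv_radial h hz]
  have h1 : inner ℝ z (EuclideanSpace.single j (1 : ℂ)) = (z j).re := by
    simp [PiLp.inner_apply, apply_ite]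
  have h2 : inner ℝ z (EuclideanSpace.single j Complex.I) = (z j).im := by
    simp [PiLp.inner_apply, apply_ite]
  rw [h1, h2]
  have h3 : z j = (z j).re + Complex.I * (z j).im := by
    apply Complex.ext <;> simp
  nth_rw 3 [h3]
  push_cast
  have : (‖z‖ : ℂ) ≠ 0 := by simpa using hz
  field_simp

/-- A locally integrable function with vanishing integral against all radial test functions has
vanishing integral over almost all spheres. -/
lemma ae_sphere_integral_eq_zero [NeZero d] {Ψ : Cn d → ℂ} (hΨ : LocallyIntegrable Ψ)
    (h : ∀ φ : ℝ → ℂ, ContDiff ℝ ∞ φ → HasCompactSupport φ → tsupport φ ⊆ Ioi 0 →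
      ∫ z, φ ‖z‖ * Ψ z = 0) :
    ∀ᵐ r ∂volume.restrict (Ioi (0 : ℝ)), ∫ ζ, Ψ (r • (ζ : Cn d)) ∂sphMeasure d = 0 := by
  have h1 := LocallyIntegrableOn.continuousOn_smul isOpen_Ioi.isLocallyClosed
    (locallyIntegrableOn_sphere_integral hΨ) (g := fun r : ℝ => r ^ (2 * d - 1)) (by fun_prop)
  -- In polar coordinates the hypothesis says that r^{2d-1} times the spherical integral annihilates
  -- every test function on the half-line.
  have h2 := isOpen_Ioi.ae_eq_zero_of_integral_contDiff_smul_eq_zero h1 (fun g hg hgc hgs => by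
    have hφs : ContDiff ℝ ∞ (fun r => (g r : ℂ)) := Complex.ofRealCLM.contDiff.comp hg
    have hsupp : tsupport (fun r => (g r : ℂ)) = tsupport g := by
      unfold tsupport; congr 1; ext x; simp
    have hφc : HasCompactSupport (fun r => (g r : ℂ)) := by
      unfold HasCompactSupport; rw [hsupp]; exact hgc
    have h3 := h _ hφs hφc (by rw [hsupp]; exact hgs)
    have h4 := hΨ.integrable_smul_left_of_hasCompactSupport
      (contDiff_radial (d := d) hφs (by rw [hsupp]; exact hgs)).continuous
      (hasCompactSupport_radial hφc)
    simp only [smul_eq_mul] at h4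
    rw [integral_polar h4] at h3
    rw [← h3, ← integral_indicator measurableSet_Ioi]
    refine integral_congr_ae (Filter.Eventually.of_forall fun r => ?_)
    simp only
    by_cases hr : r ∈ Ioi (0 : ℝ)
    · rw [indicator_of_mem hr]
      simp only [norm_smul_sphere hr]
      rw [integral_const_mul, smul_comm]
      simp
    · rw [indicator_of_notMem hr]
      have : g r = 0 := by
        by_contra hne; exact hr (hgs (subset_tsupport _ hne))
      simp [this])
  rw [ae_restrict_iff' measurableSet_Ioi]
  filter_upwards [h2] with r hr hr0
  have := hr hr0
  rwa [smul_eq_zero_iff_right (pow_pos hr0 _).ne'] at this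

end Radial

end SpecialHermite

namespace SpecialHermite

variable {d : ℕ}

/-! ### Weak Wirtinger derivatives -/

/-- The distributional Wirtinger derivatives of `G` are the locally integrable functions
`g j = ∂G/∂z_j` and `h j = ∂G/∂(conj z_j)`. -/
structure IsWirtinger (G : Cn d → ℂ) (g h : Fin d → Cn d → ℂ) : Prop where
  locInt : LocallyIntegrable G
  locInt_dz : ∀ j, LocallyIntegrable (g j)
  locInt_dzbar : ∀ j, LocallyIntegrable (h j)
  integral_dz : ∀ φ : Cn d → ℂ, ContDiff ℝ ∞ φ → HasCompactSupport φ → ∀ j,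
    ∫ z, g j z * φ z = -∫ z, G z * dz j φ z
  integral_dzbar : ∀ φ : Cn d → ℂ, ContDiff ℝ ∞ φ → HasCompactSupport φ → ∀ j,
    ∫ z, h j z * φ z = -∫ z, G z * dzbar j φ z

lemma integrable_mul_test {G φ : Cn d → ℂ} (hG : LocallyIntegrable G)
    (hφ : Continuous φ) (hc : HasCompactSupport φ) : Integrable fun z => G z * φ z :=
  hG.integrable_smul_right_of_hasCompactSupport hφ hc

/-- The zeroth-order parts of Z_j and Zbar_j are multiplications by smooth functions and preserve
local integrability. Subtracting them leaves plain weak derivatives, to which integration by parts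
along arbitrary smooth vector fields applies. -/
lemma IsZ.isWirtinger {G : Cn d → ℂ} {S Sbar : Fin d → Cn d → ℂ} (hG : LocallyIntegrable G)
    (hS : ∀ j, IsZ j G (S j)) (hSbar : ∀ j, IsZbar j G (Sbar j)) :
    IsWirtinger G (fun j z => S j z - 1 / 4 * conj (z j) * G z)
      (fun j z => Sbar j z + 1 / 4 * z j * G z) where
  locInt := hG
  locInt_dz j := (hS j).1.sub (hG.continuous_mul (by fun_prop))
  locInt_dzbar j := (hSbar j).1.add (hG.continuous_mul (by fun_prop))
  integral_dz φ hφ hc j := by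
    have h1 := (hS j).2 φ hφ hc
    have i1 := integrable_mul_test (hS j).1 hφ.continuous hc
    have i2 := integrable_mul_test (hG.continuous_mul (g := fun z => 1 / 4 * conj (z j))
      (by fun_prop)) hφ.continuous hc
    have i3 := integrable_mul_test hG (contDiff_dz j hφ).continuous (hasCompactSupport_dz j hc)
    have h2 : ∫ z, G z * (-dz j φ z + 1 / 4 * conj (z j) * φ z) =
        -(∫ z, G z * dz j φ z) + ∫ z, 1 / 4 * conj (z j) * G z * φ z := by
      have i4 : Integrable fun z => -(G z * dz j φ z) := i3.neg
      rw [← integral_neg, ← integral_add i4 i2]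
      congr 1; funext z; ring
    simp only [sub_mul]
    rw [integral_sub i1 i2, h1, h2]; ring
  integral_dzbar φ hφ hc j := by
    have h1 := (hSbar j).2 φ hφ hc
    have i1 := integrable_mul_test (hSbar j).1 hφ.continuous hc
    have i2 := integrable_mul_test (hG.continuous_mul (g := fun z => 1 / 4 * z j)
      (by fun_prop)) hφ.continuous hc
    have i3 := integrable_mul_test hG (contDiff_dzbar j hφ).continuous
      (hasCompactSupport_dzbar j hc)
    have h2 : ∫ z, G z * (-dzbar j φ z - 1 / 4 * z j * φ z) =
        -(∫ z, G z * dzbar j φ z) - ∫ z, 1 / 4 * z j * G z * φ z := by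
      have i4 : Integrable fun z => -(G z * dzbar j φ z) := i3.neg
      rw [← integral_neg, ← integral_sub i4 i2]
      congr 1; funext z; ring
    simp only [add_mul]
    rw [integral_add i1 i2, h1, h2]; ring

lemma integral_mul_fderiv_test {u φ : Cn d → ℂ} (hu : ContDiff ℝ ∞ u) (hφ : ContDiff ℝ ∞ φ)
    (hc : HasCompactSupport φ) (e : Cn d) :
    ∫ z, fderiv ℝ u z e * φ z = -∫ z, u z * fderiv ℝ φ z e := by
  have hu' : Continuous fun z => fderiv ℝ u z e :=
    (hu.continuous_fderiv (by simp)).clm_apply continuous_const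
  have hφ' : Continuous fun z => fderiv ℝ φ z e :=
    (hφ.continuous_fderiv (by simp)).clm_apply continuous_const
  have hc' : HasCompactSupport fun z => fderiv ℝ φ z e := hc.fderiv_apply (𝕜 := ℝ) e
  rw [integral_mul_fderiv_eq_neg_fderiv_mul_of_integrable
    (integrable_mul_test hu'.locallyIntegrable hφ.continuous hc)
    (integrable_mul_test hu.continuous.locallyIntegrable hφ' hc')
    (integrable_mul_test hu.continuous.locallyIntegrable hφ.continuous hc)
    (fun z _ => hu.differentiable (by simp) z) (fun z _ => hφ.differentiable (by simp) z), neg_neg]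

/-- Lets the results for weak derivatives be used for polynomials as well, where they yield the
adjointness relations between rotation fields, and for the heat kernel. -/
lemma isWirtinger_of_contDiff {u : Cn d → ℂ} (hu : ContDiff ℝ ∞ u) :
    IsWirtinger u (fun j => dz j u) (fun j => dzbar j u) where
  locInt := hu.continuous.locallyIntegrable
  locInt_dz j := (contDiff_dz j hu).continuous.locallyIntegrable
  locInt_dzbar j := (contDiff_dzbar j hu).continuous.locallyIntegrable
  integral_dz φ hφ hc j := by
    have hu' : ∀ e : Cn d, Continuous fun z => fderiv ℝ u z e := fun e =>
      (hu.continuous_fderiv (by simp)).clm_apply continuous_const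
    have hφ' : ∀ e : Cn d, Continuous fun z => fderiv ℝ φ z e := fun e =>
      (hφ.continuous_fderiv (by simp)).clm_apply continuous_const
    have hc' : ∀ e : Cn d, HasCompactSupport fun z => fderiv ℝ φ z e := fun e =>
      hc.fderiv_apply (𝕜 := ℝ) e
    have i1 := fun e => (integrable_mul_test (hu' e).locallyIntegrable hφ.continuous hc)
    have i2 := fun e => (integrable_mul_test hu.continuous.locallyIntegrable (hφ' e) (hc' e))
    have e1 : ∀ z, dz j u z * φ z = 1 / 2 * (fderiv ℝ u z (EuclideanSpace.single j 1) * φ z) -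
        Complex.I / 2 * (fderiv ℝ u z (EuclideanSpace.single j Complex.I) * φ z) := fun z => by
      rw [dz]; ring
    have e2 : ∀ z, u z * dz j φ z = 1 / 2 * (u z * fderiv ℝ φ z (EuclideanSpace.single j 1)) -
        Complex.I / 2 * (u z * fderiv ℝ φ z (EuclideanSpace.single j Complex.I)) := fun z => by
      rw [dz]; ring
    simp only [e1, e2]
    rw [integral_sub ((i1 _).const_mul _) ((i1 _).const_mul _),
      integral_sub ((i2 _).const_mul _) ((i2 _).const_mul _)]
    simp only [integral_const_mul, integral_mul_fderiv_test hu hφ hc]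
    ring
  integral_dzbar φ hφ hc j := by
    have hu' : ∀ e : Cn d, Continuous fun z => fderiv ℝ u z e := fun e =>
      (hu.continuous_fderiv (by simp)).clm_apply continuous_const
    have hφ' : ∀ e : Cn d, Continuous fun z => fderiv ℝ φ z e := fun e =>
      (hφ.continuous_fderiv (by simp)).clm_apply continuous_const
    have hc' : ∀ e : Cn d, HasCompactSupport fun z => fderiv ℝ φ z e := fun e =>
      hc.fderiv_apply (𝕜 := ℝ) e
    have i1 := fun e => (integrable_mul_test (hu' e).locallyIntegrable hφ.continuous hc)
    have i2 := fun e => (integrable_mul_test hu.continuous.locallyIntegrable (hφ' e) (hc' e))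
    have e1 : ∀ z, dzbar j u z * φ z = 1 / 2 * (fderiv ℝ u z (EuclideanSpace.single j 1) * φ z) +
        Complex.I / 2 * (fderiv ℝ u z (EuclideanSpace.single j Complex.I) * φ z) := fun z => by
      rw [dzbar]; ring
    have e2 : ∀ z, u z * dzbar j φ z = 1 / 2 * (u z * fderiv ℝ φ z (EuclideanSpace.single j 1)) +
        Complex.I / 2 * (u z * fderiv ℝ φ z (EuclideanSpace.single j Complex.I)) := fun z => by
      rw [dzbar]; ring
    simp only [e1, e2]
    rw [integral_add ((i1 _).const_mul _) ((i1 _).const_mul _),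
      integral_add ((i2 _).const_mul _) ((i2 _).const_mul _)]
    simp only [integral_const_mul, integral_mul_fderiv_test hu hφ hc]
    ring

/-! ### Integration by parts along vector fields, on space and on spheres -/

section VectorField

variable {G : Cn d → ℂ} {g h a b : Fin d → Cn d → ℂ}

/-- Integration by parts along the vector field `∑ a_j ∂_j + b_j ∂bar_j`. -/
lemma IsWirtinger.integral_field (hG : IsWirtinger G g h) (ha : ∀ j, ContDiff ℝ ∞ (a j))
    (hb : ∀ j, ContDiff ℝ ∞ (b j)) {ψ : Cn d → ℂ} (hψ : ContDiff ℝ ∞ ψ)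
    (hc : HasCompactSupport ψ) :
    ∫ z, (∑ j, (a j z * g j z + b j z * h j z)) * ψ z =
      -∫ z, G z * ∑ j, (dz j (fun z => a j z * ψ z) z + dzbar j (fun z => b j z * ψ z) z) := by
  have ca : ∀ j, ContDiff ℝ ∞ fun z => a j z * ψ z := fun j => (ha j).mul hψ
  have cb : ∀ j, ContDiff ℝ ∞ fun z => b j z * ψ z := fun j => (hb j).mul hψ
  have sa : ∀ j, HasCompactSupport fun z => a j z * ψ z := fun j => hc.mul_left
  have sb : ∀ j, HasCompactSupport fun z => b j z * ψ z := fun j => hc.mul_left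
  have i1 := fun j => integrable_mul_test (hG.locInt_dz j) (ca j).continuous (sa j)
  have i2 := fun j => integrable_mul_test (hG.locInt_dzbar j) (cb j).continuous (sb j)
  have i3 := fun j => integrable_mul_test hG.locInt (contDiff_dz j (ca j)).continuous
    (hasCompactSupport_dz j (sa j))
  have i4 := fun j => integrable_mul_test hG.locInt (contDiff_dzbar j (cb j)).continuous
    (hasCompactSupport_dzbar j (sb j))
  have e1 : ∀ z, (∑ j, (a j z * g j z + b j z * h j z)) * ψ z =
      ∑ j, (g j z * (a j z * ψ z) + h j z * (b j z * ψ z)) := fun z => by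
    rw [Finset.sum_mul]; exact Finset.sum_congr rfl fun j _ => by ring
  have i12 : ∀ j, Integrable fun z => g j z * (a j z * ψ z) + h j z * (b j z * ψ z) :=
    fun j => (i1 j).add (i2 j)
  have i34 : ∀ j, Integrable fun z => G z * dz j (fun z => a j z * ψ z) z +
      G z * dzbar j (fun z => b j z * ψ z) z := fun j => (i3 j).add (i4 j)
  simp only [e1, Finset.mul_sum, mul_add]
  rw [integral_finsetSum _ fun j _ => i12 j, integral_finsetSum _ fun j _ => i34 j, ← Finset.sum_neg_distrib]
  refine Finset.sum_congr rfl fun j _ => ?_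
  rw [integral_add (i1 j) (i2 j), integral_add (i3 j) (i4 j), hG.integral_dz _ (ca j) (sa j),
    hG.integral_dzbar _ (cb j) (sb j)]
  ring

lemma ae_ne_zero [NeZero d] : ∀ᵐ z : Cn d, z ≠ 0 := by
  have : Nonempty (Fin d) := ⟨⟨0, Nat.pos_of_ne_zero (NeZero.ne d)⟩⟩
  rw [ae_iff]; simp

/-- Integration by parts over almost every sphere along a divergence free tangential vector
field. -/
lemma IsWirtinger.ae_sphere_integral_tangential [NeZero d] (hG : IsWirtinger G g h)
    (ha : ∀ j, ContDiff ℝ ∞ (a j)) (hb : ∀ j, ContDiff ℝ ∞ (b j))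
    (hdiv : ∀ z, ∑ j, (dz j (a j) z + dzbar j (b j) z) = 0)
    (htan : ∀ z : Cn d, ∑ j, (a j z * conj (z j) + b j z * z j) = 0)
    {Q : Cn d → ℂ} (hQ : ContDiff ℝ ∞ Q) :
    ∀ᵐ r ∂volume.restrict (Ioi (0 : ℝ)),
      ∫ ζ : Sph d, (∑ j, (a j (r • (ζ : Cn d)) * g j (r • (ζ : Cn d)) +
          b j (r • (ζ : Cn d)) * h j (r • (ζ : Cn d)))) * Q (r • (ζ : Cn d)) ∂sphMeasure d =
        -∫ ζ : Sph d, G (r • (ζ : Cn d)) * ∑ j, (a j (r • (ζ : Cn d)) * dz j Q (r • (ζ : Cn d)) +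
          b j (r • (ζ : Cn d)) * dzbar j Q (r • (ζ : Cn d))) ∂sphMeasure d := by
  have l1 : LocallyIntegrable fun z => (∑ j, (a j z * g j z + b j z * h j z)) * Q z := by
    refine LocallyIntegrable.mul_continuous hQ.continuous ?_
    have : ∀ j ∈ Finset.univ, LocallyIntegrable (fun z => a j z * g j z + b j z * h j z) :=
      fun j _ => ((hG.locInt_dz j).continuous_mul (ha j).continuous).add
        ((hG.locInt_dzbar j).continuous_mul (hb j).continuous)
    simpa [Finset.sum_apply] using locallyIntegrable_finsetSum _ this
  have cV : Continuous fun z => ∑ j, (a j z * dz j Q z + b j z * dzbar j Q z) :=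
    continuous_finsetSum _ fun j _ => ((ha j).continuous.mul (contDiff_dz j hQ).continuous).add
      ((hb j).continuous.mul (contDiff_dzbar j hQ).continuous)
  have l2 : LocallyIntegrable fun z => G z * ∑ j, (a j z * dz j Q z + b j z * dzbar j Q z) :=
    hG.locInt.mul_continuous cV
  -- Integrating by parts against φ(|z|)Q(z) with arbitrary radial φ localises the identity to
  -- almost every sphere.
  have key := ae_sphere_integral_eq_zero (l1.add l2) fun φ hφ hφc hφs => by
    have cφ := contDiff_radial (d := d) hφ hφs
    have sφ := hasCompactSupport_radial (d := d) hφc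
    have h1 := hG.integral_field ha hb (cφ.mul hQ) sφ.mul_right
    have i1 := integrable_mul_test l1 cφ.continuous sφ
    have i2 := integrable_mul_test l2 cφ.continuous sφ
    have h2 : ∫ z, φ ‖z‖ * ((∑ j, (a j z * g j z + b j z * h j z)) * Q z +
        G z * ∑ j, (a j z * dz j Q z + b j z * dzbar j Q z)) =
        (∫ z, (∑ j, (a j z * g j z + b j z * h j z)) * Q z * φ ‖z‖) +
        ∫ z, G z * (∑ j, (a j z * dz j Q z + b j z * dzbar j Q z)) * φ ‖z‖ := by
      rw [← integral_add i1 i2]; congr 1; funext z; ring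
    have h3 : ∫ z, (∑ j, (a j z * g j z + b j z * h j z)) * Q z * φ ‖z‖ =
        ∫ z, (∑ j, (a j z * g j z + b j z * h j z)) * (φ ‖z‖ * Q z) := by
      congr 1; funext z; ring
    simp only [Pi.add_apply]
    rw [h2, h3, h1, neg_add_eq_zero]
    refine integral_congr_ae ?_
    filter_upwards [ae_ne_zero] with z hz
    have dφ := cφ.differentiable (by simp) z
    have dQ := hQ.differentiable (by simp) z
    have da := fun j => (ha j).differentiable (by simp) z
    have db := fun j => (hb j).differentiable (by simp) z
    -- The product rule gives the field applied to Q, the divergence of the field, and the field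
    -- applied to φ(|z|). The last is proportional to the radial component, so tangency and zero
    -- divergence leave only the first.
    have e1 : ∀ j, dz j (fun z => a j z * (φ ‖z‖ * Q z)) z +
        dzbar j (fun z => b j z * (φ ‖z‖ * Q z)) z =
        φ ‖z‖ * (a j z * dz j Q z + b j z * dzbar j Q z) +
        φ ‖z‖ * Q z * (dz j (a j) z + dzbar j (b j) z) +
        Q z * deriv φ ‖z‖ / (2 * ‖z‖) * (a j z * conj (z j) + b j z * z j) := fun j => by
      rw [dz_mul j (da j) (dφ.fun_mul dQ), dz_mul j dφ dQ, dz_radial hφ hz,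
        dzbar_mul j (db j) (dφ.fun_mul dQ), dzbar_mul j dφ dQ, dzbar_radial hφ hz]
      ring
    simp only [e1]
    rw [Finset.sum_add_distrib, Finset.sum_add_distrib, ← Finset.mul_sum, ← Finset.mul_sum,
      ← Finset.mul_sum, hdiv, htan]
    ring
  filter_upwards [key, ae_sphere_integrable l1, ae_sphere_integrable l2] with r hr i1 i2
  simp only [Pi.add_apply] at hr
  rw [integral_add i1 i2] at hr
  exact eq_neg_of_add_eq_zero_left hr

lemma locallyIntegrableOn_Ioi_of_eqOn {u v : ℝ → ℂ} (hu : LocallyIntegrableOn u (Ioi 0))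
    {w : ℝ → ℂ} (hw : ContinuousOn w (Ioi 0)) (h : ∀ r > 0, v r = w r * u r) :
    LocallyIntegrableOn v (Ioi 0) := by
  have h2 := hu.continuousOn_mul hw isOpen_Ioi.isLocallyClosed
  intro x hx
  obtain ⟨s, hs, hs'⟩ := h2 x hx
  refine ⟨s ∩ Ioi 0, Filter.inter_mem hs self_mem_nhdsWithin, ?_⟩
  have h3 := hs'.mono_set (inter_subset_left (t := Ioi 0))
  rw [IntegrableOn] at h3 ⊢
  refine h3.congr ?_
  have h4 : ∀ᵐ r ∂volume.restrict (s ∩ Ioi 0), r ∈ Ioi (0 : ℝ) :=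
    ae_restrict_of_ae_restrict_of_subset inter_subset_right (ae_restrict_mem measurableSet_Ioi)
  filter_upwards [h4] with r hr using (h r hr).symm

/-- Spherical coefficients of a function with weak derivatives are weakly differentiable. -/
lemma IsWirtinger.isWeakDeriv [NeZero d] (hG : IsWirtinger G g h) {Q : Cn d → ℂ}
    (hQ : ContDiff ℝ ∞ Q) (N : ℕ)
    (hhom : ∀ r : ℝ, 0 < r → ∀ z : Cn d, Q (r • z) = (r : ℂ) ^ N * Q z)
    (heuler : ∀ z : Cn d, ∑ j, (z j * dz j Q z + conj (z j) * dzbar j Q z) = N * Q z) :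
    IsWeakDeriv (fun r => ∫ ζ : Sph d, G (r • (ζ : Cn d)) * Q ζ ∂sphMeasure d)
      (fun r => (r : ℂ)⁻¹ * ∫ ζ : Sph d, (∑ j, ((r • (ζ : Cn d)) j * g j (r • (ζ : Cn d)) +
        conj ((r • (ζ : Cn d)) j) * h j (r • (ζ : Cn d)))) * Q ζ ∂sphMeasure d) := by
  have l1 : LocallyIntegrable fun z => (∑ j, (z j * g j z + conj (z j) * h j z)) * Q z := by
    refine LocallyIntegrable.mul_continuous hQ.continuous ?_
    have : ∀ j ∈ Finset.univ, LocallyIntegrable (fun z => z j * g j z + conj (z j) * h j z) :=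
      fun j _ => ((hG.locInt_dz j).continuous_mul (by fun_prop)).add
        ((hG.locInt_dzbar j).continuous_mul (by fun_prop))
    simpa [Finset.sum_apply] using locallyIntegrable_finsetSum _ this
  have l2 : LocallyIntegrable fun z => G z * Q z := hG.locInt.mul_continuous hQ.continuous
  have p1 : ∀ r : ℝ, 0 < r → ∫ ζ : Sph d, (∑ j, ((r • (ζ : Cn d)) j * g j (r • (ζ : Cn d)) +
        conj ((r • (ζ : Cn d)) j) * h j (r • (ζ : Cn d)))) * Q (r • (ζ : Cn d)) ∂sphMeasure d =
      (r : ℂ) ^ N * ∫ ζ : Sph d, (∑ j, ((r • (ζ : Cn d)) j * g j (r • (ζ : Cn d)) +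
        conj ((r • (ζ : Cn d)) j) * h j (r • (ζ : Cn d)))) * Q ζ ∂sphMeasure d := by
    intro r hr
    rw [← integral_const_mul]; congr 1; funext ζ; rw [hhom r hr]; ring
  have p2 : ∀ r : ℝ, 0 < r → ∫ ζ : Sph d, G (r • (ζ : Cn d)) * Q (r • (ζ : Cn d)) ∂sphMeasure d =
      (r : ℂ) ^ N * ∫ ζ : Sph d, G (r • (ζ : Cn d)) * Q ζ ∂sphMeasure d := by
    intro r hr
    rw [← integral_const_mul]; congr 1; funext ζ; rw [hhom r hr]; ring
  have hne : ∀ r : ℝ, 0 < r → (r : ℂ) ≠ 0 := fun r hr => by exact_mod_cast hr.ne'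
  refine ⟨?_, ?_, ?_⟩
  · refine locallyIntegrableOn_Ioi_of_eqOn (locallyIntegrableOn_sphere_integral l2)
      (w := fun r => ((r : ℂ) ^ N)⁻¹) (ContinuousOn.inv₀ (by fun_prop)
        fun r hr => pow_ne_zero _ (hne r hr)) fun r hr => ?_
    rw [p2 r hr, inv_mul_cancel_left₀ (pow_ne_zero _ (hne r hr))]
  · refine locallyIntegrableOn_Ioi_of_eqOn (locallyIntegrableOn_sphere_integral l1)
      (w := fun r => (r : ℂ)⁻¹ * ((r : ℂ) ^ N)⁻¹) (ContinuousOn.mul (ContinuousOn.inv₀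
        (by fun_prop) fun r hr => hne r hr) (ContinuousOn.inv₀ (by fun_prop)
        fun r hr => pow_ne_zero _ (hne r hr))) fun r hr => ?_
    simp only
    rw [p1 r hr, mul_assoc, inv_mul_cancel_left₀ (pow_ne_zero _ (hne r hr))]
  · intro φ hφ hφc hφs
    -- The Euler field has divergence 2d and acts on Q by N. Testing with η = φ/r^M makes Mη + rη'
    -- equal to r^{1-M}φ', so that only φ' is left.
    set M := N + 2 * d with hM
    let η : ℝ → ℂ := fun r => φ r / (r : ℂ) ^ M
    have ηs' : tsupport η ⊆ tsupport φ := closure_mono fun x hx => by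
      simp only [η, Function.mem_support, ne_eq, div_eq_zero_iff, not_or] at hx ⊢
      exact hx.1
    have ηs : tsupport η ⊆ Ioi 0 := ηs'.trans hφs
    have ηc : HasCompactSupport η := hφc.mono' (subset_closure.trans ηs')
    -- Dividing by a power of r does no harm at 0, since η vanishes in a neighbourhood of it.
    have ηd : ContDiff ℝ ∞ η := by
      rw [contDiff_iff_contDiffAt]
      intro r
      by_cases hr : r = 0
      · subst hr
        have h0 : (0 : ℝ) ∉ tsupport η := fun h => lt_irrefl (0 : ℝ) (ηs h)
        exact (contDiffAt_const (c := (0 : ℂ))).congr_of_eventuallyEq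
          (notMem_tsupport_iff_eventuallyEq.1 h0)
      · have h1 : ContDiff ℝ ∞ fun r : ℝ => (r : ℂ) ^ M := Complex.ofRealCLM.contDiff.pow M
        simp only [η, div_eq_mul_inv]
        exact hφ.contDiffAt.mul (h1.contDiffAt.inv (pow_ne_zero _ (by exact_mod_cast hr)))
    have ηd' : ∀ r : ℝ, 0 < r → (M : ℂ) * η r + r * deriv η r = r * deriv φ r / (r : ℂ) ^ M := by
      intro r hr
      have h1 : HasDerivAt φ (deriv φ r) r := (hφ.differentiable (by simp) _).hasDerivAt
      have h2 : HasDerivAt (fun r : ℝ => (r : ℂ) ^ M) (M * (r : ℂ) ^ (M - 1) * 1) r :=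
        (Complex.ofRealCLM.hasDerivAt (x := r)).pow M
      have h3 := (h1.div h2 (pow_ne_zero _ (hne r hr))).deriv
      have h4 : deriv η r = _ := h3
      rw [h4]
      have hMp : M = (M - 1) + 1 := by
        have := NeZero.pos d
        omega
      simp only [η]
      have hr0 := hne r hr
      generalize M - 1 = K at hMp
      rw [hMp]
      field_simp
      ring
    have cη := contDiff_radial (d := d) ηd ηs
    have sη := hasCompactSupport_radial (d := d) ηc
    have h1 := hG.integral_field (a := fun j z => z j) (b := fun j z => conj (z j))
      (fun j => contDiff_coord j) (fun j => contDiff_conj_coord j) (cη.mul hQ) sη.mul_right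
    have h2 : ∫ z, G z * ∑ j, (dz j (fun z => z j * (η ‖z‖ * Q z)) z +
        dzbar j (fun z => conj (z j) * (η ‖z‖ * Q z)) z) =
        ∫ z, G z * Q z * (‖z‖ * deriv φ ‖z‖ / (‖z‖ : ℂ) ^ M) := by
      refine integral_congr_ae ?_
      filter_upwards [ae_ne_zero] with z hz
      have dη := cη.differentiable (by simp) z
      have dQ := hQ.differentiable (by simp) z
      have e1 : ∀ j, dz j (fun z => z j * (η ‖z‖ * Q z)) z +
          dzbar j (fun z => conj (z j) * (η ‖z‖ * Q z)) z =
          2 * (η ‖z‖ * Q z) + η ‖z‖ * (z j * dz j Q z + conj (z j) * dzbar j Q z) +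
          Q z * deriv η ‖z‖ / ‖z‖ * (z j * conj (z j)) := fun j => by
        rw [dz_mul j (hasFDerivAt_coord j z).differentiableAt (dη.fun_mul dQ), dz_mul j dη dQ,
          dz_radial ηd hz, dzbar_mul j (hasFDerivAt_conj_coord j z).differentiableAt (dη.fun_mul dQ),
          dzbar_mul j dη dQ, dzbar_radial ηd hz, dz_coord, dzbar_conj_coord]
        simp only [if_true]
        ring
      have e2 : ∑ j, z j * conj (z j) = (‖z‖ : ℂ) ^ 2 := by
        have := evalPoly_normSqPoly z
        simpa [normSqPoly] using this
      have hz0 : (‖z‖ : ℂ) ≠ 0 := hne _ (norm_pos_iff.2 hz)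
      simp only [e1]
      have e3 := heuler z
      beta_reduce at e2 e3
      rw [← ηd' _ (norm_pos_iff.2 hz), Finset.sum_add_distrib, Finset.sum_add_distrib,
        Finset.sum_const, ← Finset.mul_sum, e3, ← Finset.mul_sum, e2, hM]
      simp only [Finset.card_univ, Fintype.card_fin, nsmul_eq_mul]
      push_cast
      field_simp
      ring
    have i1 := integrable_mul_test l1 cη.continuous sη
    have h3 : ∀ z, (∑ j, (z j * g j z + conj (z j) * h j z)) * (η ‖z‖ * Q z) =
        (∑ j, (z j * g j z + conj (z j) * h j z)) * Q z * η ‖z‖ := fun z => by ring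
    have i2 : Integrable fun z => G z * Q z * (‖z‖ * deriv φ ‖z‖ / (‖z‖ : ℂ) ^ M) := by
      let θ : ℝ → ℂ := fun r => (M : ℂ) * η r + r * deriv η r
      have θs : HasCompactSupport θ := (HasCompactSupport.mul_left ηc).add
        (HasCompactSupport.mul_left ηc.deriv)
      have θc : Continuous θ := by
        have := ηd.continuous_deriv (by simp)
        have := ηd.continuous
        fun_prop
      have := integrable_mul_test l2 (φ := fun z => θ ‖z‖) (by fun_prop) (by
        obtain ⟨R, hR⟩ := θs.isCompact.isBounded.subset_closedBall 0
        refine HasCompactSupport.intro (isCompact_closedBall (0 : Cn d) R) fun z hz => ?_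
        by_contra hne
        have := hR (subset_tsupport _ hne)
        simp at this hz
        linarith)
      refine this.congr ?_
      filter_upwards [ae_ne_zero] with z hz
      rw [← ηd' _ (norm_pos_iff.2 hz)]
    rw [h2] at h1
    simp only [h3] at h1
    rw [integral_polar i1, integral_polar i2] at h1
    -- The Jacobian r^{2d-1}, the homogeneity r^N of Q and the factor r of the Euler field cancel
    -- the division by r^M exactly.
    have hpow : ∀ r : ℝ, 0 < r → (r : ℂ) ^ (2 * d - 1) * (r : ℂ) ^ N * r / (r : ℂ) ^ M = 1 := by
      intro r hr
      have : M = (2 * d - 1) + N + 1 := by have := NeZero.pos d; omega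
      rw [this, pow_add, pow_add, pow_one]
      have := hne r hr
      field_simp
    rw [eq_neg_iff_add_eq_zero, add_comm, ← eq_neg_iff_add_eq_zero] at h1
    convert h1 using 1
    · refine setIntegral_congr_fun measurableSet_Ioi fun r hr => ?_
      simp only [norm_smul_sphere hr]
      rw [integral_mul_const, p2 r hr, Complex.real_smul]
      push_cast
      linear_combination (-(∫ ζ : Sph d, G (r • (ζ : Cn d)) * Q ζ ∂sphMeasure d) * deriv φ r) *
        hpow r hr
    · congr 1
      refine setIntegral_congr_fun measurableSet_Ioi fun r hr => ?_
      simp only [norm_smul_sphere hr, η]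
      rw [integral_mul_const, p1 r hr, Complex.real_smul]
      push_cast
      have h4 : (r : ℂ)⁻¹ * r = 1 := inv_mul_cancel₀ (hne r hr)
      generalize (∫ ζ : Sph d, (∑ j, ((r • (ζ : Cn d)) j * g j (r • (ζ : Cn d)) +
        conj ((r • (ζ : Cn d)) j) * h j (r • (ζ : Cn d)))) * Q ζ ∂sphMeasure d) = A
      linear_combination (-((r : ℂ)⁻¹ * A * φ r)) * hpow r hr +
        ((r : ℂ) ^ (2 * d - 1) * (r : ℂ) ^ N * A * φ r / (r : ℂ) ^ M) * h4

end VectorField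

end SpecialHermite

namespace SpecialHermite

variable {d : ℕ}

/-! ### Rotations and integration by parts on spheres -/

section Rotations

/-- Coefficients of the vector field `conj z_j ∂_k - conj z_k ∂_j`. -/
noncomputable def rotCoeff (j k i : Fin d) (z : Cn d) : ℂ :=
  (if i = k then conj (z j) else 0) - (if i = j then conj (z k) else 0)

/-- Coefficients of the vector field `z_j ∂bar_k - z_k ∂bar_j`. -/
noncomputable def rotBarCoeff (j k i : Fin d) (z : Cn d) : ℂ :=
  (if i = k then z j else 0) - (if i = j then z k else 0)

lemma contDiff_rotCoeff (j k i : Fin d) : ContDiff ℝ ∞ (rotCoeff j k i) := by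
  unfold rotCoeff
  refine ContDiff.sub ?_ ?_ <;> split_ifs
  exacts [contDiff_conj_coord j, contDiff_const, contDiff_conj_coord k, contDiff_const]

lemma contDiff_rotBarCoeff (j k i : Fin d) : ContDiff ℝ ∞ (rotBarCoeff j k i) := by
  unfold rotBarCoeff
  refine ContDiff.sub ?_ ?_ <;> split_ifs
  exacts [contDiff_coord j, contDiff_const, contDiff_coord k, contDiff_const]

lemma dz_rotCoeff (j k i : Fin d) (z : Cn d) : dz i (rotCoeff j k i) z = 0 := by
  have h2 : rotCoeff j k i = evalPoly
      ((if i = k then MvPolynomial.X (Sum.inr j) else 0) -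
        (if i = j then MvPolynomial.X (Sum.inr k) else 0)) := by
    funext z
    simp only [rotCoeff, evalPoly_sub]
    split_ifs <;> simp <;> simp [evalPoly]
  rw [h2, dz_evalPoly]
  simp only [map_sub, evalPoly_sub]
  split_ifs <;> simp [evalPoly, MvPolynomial.pderiv_X]

lemma dzbar_rotBarCoeff (j k i : Fin d) (z : Cn d) : dzbar i (rotBarCoeff j k i) z = 0 := by
  have h2 : rotBarCoeff j k i = evalPoly
      ((if i = k then MvPolynomial.X (Sum.inl j) else 0) -
        (if i = j then MvPolynomial.X (Sum.inl k) else 0)) := by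
    funext z
    simp only [rotBarCoeff, evalPoly_sub]
    split_ifs <;> simp <;> simp [evalPoly]
  rw [h2, dzbar_evalPoly]
  simp only [map_sub, evalPoly_sub]
  split_ifs <;> simp [evalPoly, MvPolynomial.pderiv_X]

lemma sum_rotCoeff_mul (j k : Fin d) (z : Cn d) (c : Fin d → ℂ) :
    ∑ i, rotCoeff j k i z * c i = conj (z j) * c k - conj (z k) * c j := by
  simp [rotCoeff, sub_mul, Finset.sum_sub_distrib]

lemma sum_rotBarCoeff_mul (j k : Fin d) (z : Cn d) (c : Fin d → ℂ) :
    ∑ i, rotBarCoeff j k i z * c i = z j * c k - z k * c j := by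
  simp [rotBarCoeff, sub_mul, Finset.sum_sub_distrib]

variable [NeZero d]

section Weak

variable {G : Cn d → ℂ} {g h : Fin d → Cn d → ℂ} {Q : Cn d → ℂ}

/-- The field has conjugate coordinates as coefficients of ∂_i, hence no divergence. Its radial
component is conj z_j conj z_k - conj z_k conj z_j = 0. -/
lemma IsWirtinger.ae_sphere_integral_rot (hG : IsWirtinger G g h)
    (hQ : ContDiff ℝ ∞ Q) (j k : Fin d) :
    ∀ᵐ r ∂volume.restrict (Ioi (0 : ℝ)),
      ∫ ζ : Sph d, (conj ((r • (ζ : Cn d)) j) * g k (r • (ζ : Cn d)) -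
          conj ((r • (ζ : Cn d)) k) * g j (r • (ζ : Cn d))) * Q (r • (ζ : Cn d)) ∂sphMeasure d =
        -∫ ζ : Sph d, G (r • (ζ : Cn d)) * (conj ((r • (ζ : Cn d)) j) * dz k Q (r • (ζ : Cn d)) -
          conj ((r • (ζ : Cn d)) k) * dz j Q (r • (ζ : Cn d))) ∂sphMeasure d := by
  have := hG.ae_sphere_integral_tangential (a := rotCoeff j k) (b := fun _ _ => 0)
    (contDiff_rotCoeff j k) (fun _ => contDiff_const)
    (fun z => by simp [dz_rotCoeff, dzbar_const])
    (fun z => by simp [sum_rotCoeff_mul, mul_comm]) hQ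
  simpa [sum_rotCoeff_mul] using this

lemma IsWirtinger.ae_sphere_integral_rotBar (hG : IsWirtinger G g h)
    (hQ : ContDiff ℝ ∞ Q) (j k : Fin d) :
    ∀ᵐ r ∂volume.restrict (Ioi (0 : ℝ)),
      ∫ ζ : Sph d, ((r • (ζ : Cn d)) j * h k (r • (ζ : Cn d)) -
          (r • (ζ : Cn d)) k * h j (r • (ζ : Cn d))) * Q (r • (ζ : Cn d)) ∂sphMeasure d =
        -∫ ζ : Sph d, G (r • (ζ : Cn d)) * ((r • (ζ : Cn d)) j * dzbar k Q (r • (ζ : Cn d)) -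
          (r • (ζ : Cn d)) k * dzbar j Q (r • (ζ : Cn d))) ∂sphMeasure d := by
  have := hG.ae_sphere_integral_tangential (a := fun _ _ => 0) (b := rotBarCoeff j k)
    (fun _ => contDiff_const) (contDiff_rotBarCoeff j k)
    (fun z => by simp [dzbar_rotBarCoeff, dz_const])
    (fun z => by simp [sum_rotBarCoeff_mul, mul_comm]) hQ
  simpa [sum_rotBarCoeff_mul] using this

/-- The field z_j ∂_j - conj z_j ∂bar_j generates, up to a factor i, the rotations z ↦ e^{iθ}z. Its
divergence is d - d = 0 and its two radial contributions cancel. -/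
lemma IsWirtinger.ae_sphere_integral_angular (hG : IsWirtinger G g h)
    (hQ : ContDiff ℝ ∞ Q) :
    ∀ᵐ r ∂volume.restrict (Ioi (0 : ℝ)),
      ∫ ζ : Sph d, (∑ j, ((r • (ζ : Cn d)) j * g j (r • (ζ : Cn d)) -
          conj ((r • (ζ : Cn d)) j) * h j (r • (ζ : Cn d)))) * Q (r • (ζ : Cn d)) ∂sphMeasure d =
        -∫ ζ : Sph d, G (r • (ζ : Cn d)) * ∑ j, ((r • (ζ : Cn d)) j * dz j Q (r • (ζ : Cn d)) -
          conj ((r • (ζ : Cn d)) j) * dzbar j Q (r • (ζ : Cn d))) ∂sphMeasure d := by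
  have := hG.ae_sphere_integral_tangential (a := fun j z => z j) (b := fun j z => -conj (z j))
    (fun j => contDiff_coord j) (fun j => (contDiff_conj_coord j).neg)
    (fun z => by
      refine Finset.sum_eq_zero fun j _ => ?_
      have h1 : (fun z : Cn d => -conj (z j)) = fun z : Cn d => (-1 : ℂ) * conj (z j) := by
        funext z; ring
      rw [h1, dzbar_mul j (differentiableAt_const _) (hasFDerivAt_conj_coord j z).differentiableAt,
        dz_coord, dzbar_conj_coord, dzbar_const]
      simp)
    (fun z => Finset.sum_eq_zero fun j _ => by ring) hQ
  simpa [sub_eq_add_neg] using this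

end Weak

lemma continuous_sphere_integral {u : Cn d → ℂ} (hu : Continuous u) :
    Continuous fun r : ℝ => ∫ ζ : Sph d, u (r • (ζ : Cn d)) ∂sphMeasure d := by
  apply continuous_parametric_integral_of_continuous (μ := sphMeasure d) (s := univ) (f := fun (r : ℝ) (ζ : Sph d) =>
    u (r • (ζ : Cn d))) (by fun_prop) isCompact_univ |>.congr
  intro r; simp

/-- An identity between sphere integrals of continuous functions that holds for almost all radii
holds on the unit sphere. -/
lemma sphere_integral_eq_of_ae {u v : Cn d → ℂ} (hu : Continuous u) (hv : Continuous v)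
    (h : ∀ᵐ r ∂volume.restrict (Ioi (0 : ℝ)), ∫ ζ : Sph d, u (r • (ζ : Cn d)) ∂sphMeasure d =
      ∫ ζ : Sph d, v (r • (ζ : Cn d)) ∂sphMeasure d) :
    ∫ ζ : Sph d, u ζ ∂sphMeasure d = ∫ ζ : Sph d, v ζ ∂sphMeasure d := by
  -- Two functions continuous in r that agree for almost every r > 0 agree everywhere there, in
  -- particular at r = 1.
  have := Measure.eqOn_open_of_ae_eq h isOpen_Ioi (continuous_sphere_integral hu).continuousOn
    (continuous_sphere_integral hv).continuousOn (mem_Ioi.2 one_pos)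
  simpa using this

end Rotations

/-! ### The inner product on polynomials -/

section SphereInner

open MvPolynomial

/-- `∫ p conj q` over the unit sphere. -/
noncomputable def sphInner (p q : MvPolynomial (Fin d ⊕ Fin d) ℂ) : ℂ :=
  ∫ ζ : Sph d, evalPoly p (ζ : Cn d) * conj (evalPoly q (ζ : Cn d)) ∂sphMeasure d

lemma continuous_evalPoly (p : MvPolynomial (Fin d ⊕ Fin d) ℂ) : Continuous (evalPoly p) :=
  (contDiff_evalPoly p (n := 0)).continuous

lemma contDiff_conj_evalPoly (p : MvPolynomial (Fin d ⊕ Fin d) ℂ) :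
    ContDiff ℝ ∞ (fun z => conj (evalPoly p z)) :=
  Complex.conjCLE.contDiff.comp (contDiff_evalPoly p)

lemma dz_conj_evalPoly (p : MvPolynomial (Fin d ⊕ Fin d) ℂ) (j : Fin d) (z : Cn d) :
    dz j (fun z => conj (evalPoly p z)) z = conj (evalPoly (pderiv (Sum.inr j) p) z) := by
  rw [dz_conj j (differentiableAt_evalPoly p z), dzbar_evalPoly]

lemma dzbar_conj_evalPoly (p : MvPolynomial (Fin d ⊕ Fin d) ℂ) (j : Fin d) (z : Cn d) :
    dzbar j (fun z => conj (evalPoly p z)) z = conj (evalPoly (pderiv (Sum.inl j) p) z) := by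
  rw [dzbar_conj j (differentiableAt_evalPoly p z), dz_evalPoly]

/-- Integrability of continuous functions on the sphere. -/
lemma integrable_sphere {u : Sph d → ℂ} (hu : Continuous u) : Integrable u (sphMeasure d) :=
  hu.integrable_of_hasCompactSupport (HasCompactSupport.of_compactSpace u)

variable {p q : MvPolynomial (Fin d ⊕ Fin d) ℂ} {m n m' n' : ℕ}

lemma integrable_sphInner (p q : MvPolynomial (Fin d ⊕ Fin d) ℂ) :
    Integrable (fun ζ : Sph d => evalPoly p (ζ : Cn d) * conj (evalPoly q (ζ : Cn d)))
      (sphMeasure d) := by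
  have h1 := continuous_evalPoly p
  have h2 := continuous_evalPoly q
  exact integrable_sphere (by fun_prop)

lemma sphInner_sum_left {ι : Type*} (s : Finset ι) (f : ι → MvPolynomial (Fin d ⊕ Fin d) ℂ) :
    sphInner (∑ i ∈ s, f i) q = ∑ i ∈ s, sphInner (f i) q := by
  simp only [sphInner, evalPoly_sum, Finset.sum_mul]
  exact integral_finsetSum _ fun i _ => integrable_sphInner _ _

lemma sphInner_C_mul_left (c : ℂ) : sphInner (C c * p) q = c * sphInner p q := by
  simp only [sphInner, evalPoly_mul, evalPoly_C, mul_assoc]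
  exact integral_const_mul _ _

lemma conj_sphInner : conj (sphInner p q) = sphInner q p := by
  rw [sphInner, sphInner, ← integral_conj]
  congr 1; funext ζ; simp [mul_comm]

variable [NeZero d]

/-- Integration by parts along a divergence free tangential field produces the sign; moving the
field inside the conjugate of q turns the holomorphic derivatives into antiholomorphic ones. -/
lemma sphInner_rot (j k : Fin d) : sphInner (rot j k p) q = -sphInner p (rotBar j k q) := by
  have h := (isWirtinger_of_contDiff (contDiff_evalPoly p)).ae_sphere_integral_rot
    (contDiff_conj_evalPoly q) j k
  rw [sphInner, sphInner, ← integral_neg]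
  have c1 := fun p : MvPolynomial (Fin d ⊕ Fin d) ℂ => continuous_evalPoly p
  refine sphere_integral_eq_of_ae (u := fun z => evalPoly (rot j k p) z * conj (evalPoly q z))
    (v := fun z => -(evalPoly p z * conj (evalPoly (rotBar j k q) z))) (by fun_prop)
    (by fun_prop) ?_
  filter_upwards [h] with r hr
  simp only [dz_conj_evalPoly, dz_evalPoly] at hr
  rw [integral_neg]
  simpa [rot, rotBar] using hr

lemma sphInner_rotBar (j k : Fin d) : sphInner (rotBar j k p) q = -sphInner p (rot j k q) := by
  rw [← conj_sphInner, ← conj_sphInner (p := rot j k q), sphInner_rot]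
  simp

/-- The generator of z ↦ e^{iθ}z is symmetric for this inner product and has eigenvalue m - n on
bidegree (m, n). Eigenfunctions with distinct eigenvalues are orthogonal; harmonicity plays no role.
-/
lemma sphInner_eq_zero_of_weight (hp : IsBihom p m n) (hq : IsBihom q m' n')
    (h : (m : ℤ) - n ≠ m' - n') : sphInner p q = 0 := by
  have h0 := (isWirtinger_of_contDiff (contDiff_evalPoly p)).ae_sphere_integral_angular
    (contDiff_conj_evalPoly q)
  have e1 : ∀ (p : MvPolynomial (Fin d ⊕ Fin d) ℂ) (m n : ℕ), IsBihom p m n → ∀ z : Cn d,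
      ∑ j, (z j * evalPoly (pderiv (Sum.inl j) p) z -
        conj (z j) * evalPoly (pderiv (Sum.inr j) p) z) = (m - n) * evalPoly p z := by
    intro p m n hp z
    have h1 := congrArg (fun p => evalPoly p z) hp.euler_inl
    have h2 := congrArg (fun p => evalPoly p z) hp.euler_inr
    simp only [evalPoly_sum, evalPoly_mul, evalPoly_X_inl, evalPoly_X_inr] at h1 h2
    have h3 : ∀ k : ℕ, evalPoly (k : MvPolynomial (Fin d ⊕ Fin d) ℂ) z = k := fun k => by
      simp [evalPoly]
    rw [Finset.sum_sub_distrib, h1, h2, h3, h3]; ring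
  have c1 := fun p : MvPolynomial (Fin d ⊕ Fin d) ℂ => continuous_evalPoly p
  have key : ∫ ζ : Sph d, (m - n : ℂ) * (evalPoly p (ζ : Cn d) * conj (evalPoly q (ζ : Cn d)))
      ∂sphMeasure d = ∫ ζ : Sph d, (m' - n' : ℂ) *
        (evalPoly p (ζ : Cn d) * conj (evalPoly q (ζ : Cn d))) ∂sphMeasure d := by
    refine sphere_integral_eq_of_ae (u := fun z => (m - n : ℂ) *
      (evalPoly p z * conj (evalPoly q z))) (v := fun z => (m' - n' : ℂ) *
      (evalPoly p z * conj (evalPoly q z))) (by fun_prop) (by fun_prop) ?_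
    filter_upwards [h0] with r hr
    simp only [dz_conj_evalPoly, dz_evalPoly, dzbar_conj_evalPoly, dzbar_evalPoly,
      e1 p m n hp] at hr
    have e2 : ∀ z : Cn d, ∑ j, (z j * conj (evalPoly (pderiv (Sum.inr j) q) z) -
        conj (z j) * conj (evalPoly (pderiv (Sum.inl j) q) z)) =
        -((m' - n') * conj (evalPoly q z)) := by
      intro z
      have := congrArg conj (e1 q m' n' hq z)
      rw [map_sum] at this
      have h3 : ∑ j, (z j * conj (evalPoly (pderiv (Sum.inr j) q) z) -
        conj (z j) * conj (evalPoly (pderiv (Sum.inl j) q) z)) =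
        -∑ j, conj (z j * evalPoly (pderiv (Sum.inl j) q) z -
        conj (z j) * evalPoly (pderiv (Sum.inr j) q) z) := by
        rw [← Finset.sum_neg_distrib]
        refine Finset.sum_congr rfl fun j _ => ?_
        simp
      rw [h3, this]; simp
    simp only [e2] at hr
    rw [← integral_neg] at hr
    convert hr using 2 <;> funext ζ <;> ring
  rw [integral_const_mul, integral_const_mul] at key
  have h1 : ((m : ℂ) - n - (m' - n')) * sphInner p q = 0 := by
    rw [sub_mul, sub_eq_zero]; exact key
  refine (mul_eq_zero.1 h1).resolve_left fun h2 => h ?_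
  have : ((m : ℂ) - n) = m' - n' := sub_eq_zero.1 h2
  exact_mod_cast this

/-- Harmonic bihomogeneous polynomials. -/
def IsHarm (p : MvPolynomial (Fin d ⊕ Fin d) ℂ) (m n : ℕ) : Prop :=
  IsBihom p m n ∧ ∀ z, evalPoly (polyLaplacian p) z = 0

/-- Adjointness moves one rotation across and leaves the Casimir operator on p. Its |z|²Δ part drops
out by harmonicity, so the constant is the eigenvalue. -/
lemma sum_sphInner_rot_rot (hp : IsHarm p m n) :
    ∑ j, ∑ k, sphInner (rot j k p) (rot j k q) = 2 * m * (n + d - 1) * sphInner p q := by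
  have h1 : ∀ j k, sphInner (rot j k p) (rot j k q) = -sphInner (rotBar j k (rot j k p)) q := by
    intro j k; rw [sphInner_rotBar, neg_neg]
  simp only [h1, Finset.sum_neg_distrib, ← sphInner_sum_left]
  have h2 : sphInner (C 2 * ∑ j, ∑ k, rotBar j k (rot j k p)) q =
      sphInner (C (-(4 * m * (n + d - 1)) : ℂ) * p) q := by
    rw [sum_rotBar_rot hp.1]
    simp [sphInner, hp.2]
  rw [sphInner_C_mul_left, sphInner_C_mul_left] at h2
  linear_combination (-1 / 2 : ℂ) * h2

lemma sum_sphInner_rotBar_rotBar (hp : IsHarm p m n) :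
    ∑ j, ∑ k, sphInner (rotBar j k p) (rotBar j k q) = 2 * n * (m + d - 1) * sphInner p q := by
  have h1 : ∀ j k, sphInner (rotBar j k p) (rotBar j k q) = -sphInner (rot j k (rotBar j k p)) q := by
    intro j k; rw [sphInner_rot, neg_neg]
  simp only [h1, Finset.sum_neg_distrib, ← sphInner_sum_left]
  have h2 : sphInner (C 2 * ∑ j, ∑ k, rot j k (rotBar j k p)) q =
      sphInner (C (-(4 * n * (m + d - 1)) : ℂ) * p) q := by
    rw [sum_rot_rotBar hp.1]
    simp [sphInner, hp.2]
  rw [sphInner_C_mul_left, sphInner_C_mul_left] at h2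
  linear_combination (-1 / 2 : ℂ) * h2

/-- Solid harmonics of different bidegrees are orthogonal on the sphere. -/
lemma sphInner_eq_zero (hp : IsHarm p m n) (hq : IsHarm q m' n') (h : (m, n) ≠ (m', n')) :
    sphInner p q = 0 := by
  by_cases hw : (m : ℤ) - n = m' - n'
  swap
  · exact sphInner_eq_zero_of_weight hp.1 hq.1 hw
  -- When m - n = m' - n', the Casimir operator separates the bidegrees. Evaluating the same
  -- quadratic expression from the side of p and from that of q compares the two eigenvalues.
  have h1 := sum_sphInner_rot_rot (q := q) hp
  have h2 := congrArg conj (sum_sphInner_rot_rot (q := p) hq)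
  simp only [map_sum, conj_sphInner, map_mul, map_add, map_sub, map_ofNat, map_one,
    map_natCast] at h2
  rw [h1, ← sub_eq_zero, ← sub_mul] at h2
  refine (mul_eq_zero.1 h2).resolve_left fun h3 => ?_
  have hd := NeZero.pos d
  have h4 : (m : ℤ) * (n + d - 1) = m' * (n' + d - 1) := by
    have : (m : ℂ) * (n + d - 1) = m' * (n' + d - 1) := by linear_combination (1 / 2 : ℂ) * h3
    exact_mod_cast this
  -- Along a line of constant m - n, the eigenvalue m(n + d - 1) is strictly increasing in m since d
  -- ≥ 1, so equal eigenvalues force equal bidegrees.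
  rcases lt_trichotomy m m' with hm | hm | hm
  · have hn : (n' : ℤ) = n + (m' - m) := by linarith
    have hm' : (m : ℤ) < m' := by exact_mod_cast hm
    have hd' : (1 : ℤ) ≤ d := by exact_mod_cast hd
    have : (0 : ℤ) ≤ n := by positivity
    have : (0 : ℤ) ≤ m := by positivity
    nlinarith
  · apply h
    have : n = n' := by omega
    rw [hm, this]
  · have hn : (n : ℤ) = n' + (m - m') := by linarith
    have hm' : (m' : ℤ) < m := by exact_mod_cast hm
    have hd' : (1 : ℤ) ≤ d := by exact_mod_cast hd
    have : (0 : ℤ) ≤ n' := by positivity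
    have : (0 : ℤ) ≤ m' := by positivity
    nlinarith

end SphereInner

end SpecialHermite

namespace SpecialHermite

variable {d : ℕ}

/-! ### Completeness of the spherical harmonics -/

section Completeness

open MvPolynomial

variable {p q : MvPolynomial (Fin d ⊕ Fin d) ℂ} {m n : ℕ}

lemma mem_sphericalHarmonics_iff {u : Sph d → ℂ} :
    u ∈ sphericalHarmonics d m n ↔ ∃ p, IsHarm p m n ∧ u = fun ζ : Sph d => evalPoly p (ζ : Cn d) := by
  constructor
  · rintro ⟨P, ⟨⟨p, hp1, hp2, rfl⟩, hΔ⟩, rfl⟩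
    refine ⟨p, ⟨⟨hp1, hp2⟩, fun z => ?_⟩, rfl⟩
    rw [← laplacian_evalPoly]; exact hΔ z
  · rintro ⟨p, ⟨⟨hp1, hp2⟩, hΔ⟩, rfl⟩
    refine ⟨evalPoly p, ⟨⟨p, hp1, hp2, rfl⟩, fun z => ?_⟩, rfl⟩
    rw [laplacian_evalPoly]; exact hΔ z

lemma norm_sphere (ζ : Sph d) : ‖(ζ : Cn d)‖ = 1 := by simp

/-- The restriction of a polynomial to the sphere. -/
noncomputable def polyMap (p : MvPolynomial (Fin d ⊕ Fin d) ℂ) : C(Sph d, ℂ) :=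
  ⟨fun ζ => evalPoly p ζ, (continuous_evalPoly p).comp continuous_subtype_val⟩

@[simp] lemma polyMap_apply (p : MvPolynomial (Fin d ⊕ Fin d) ℂ) (ζ : Sph d) :
    polyMap p ζ = evalPoly p ζ := rfl

lemma polyMap_add : polyMap (p + q) = polyMap p + polyMap q := by ext ζ; simp

/-- If Δ^{k+1}p = 0, then q = Δ^k p is harmonic, and subtracting a suitable multiple of |z|^{2k}q
from p leaves a polynomial killed by Δ^k. On the unit sphere |z|^{2k}q coincides with q, so the
induction on k writes p as a sum of spherical harmonics. -/
lemma polyMap_mem_of_iterate [NeZero d] {W : Submodule ℂ C(Sph d, ℂ)}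
    (hW : ∀ m n (p : MvPolynomial (Fin d ⊕ Fin d) ℂ), IsHarm p m n → polyMap p ∈ W) (k : ℕ) :
    ∀ (p : MvPolynomial (Fin d ⊕ Fin d) ℂ) (m n : ℕ), IsBihom p m n →
      polyLaplacian^[k] p = 0 → polyMap p ∈ W := by
  induction k with
  | zero =>
    intro p m n _ h
    have : p = 0 := h
    have h0 : polyMap (0 : MvPolynomial (Fin d ⊕ Fin d) ℂ) = 0 := by ext ζ; simp [evalPoly]
    rw [this, h0]; exact W.zero_mem
  | succ k ih =>
    intro p m n hp h
    rcases hp.iterate_polyLaplacian k with h0 | ⟨hkm, hkn, hq⟩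
    · exact ih p m n hp h0
    set q := polyLaplacian^[k] p with hqdef
    have hΔq : polyLaplacian q = 0 := by
      rw [hqdef, ← Function.iterate_succ_apply' (f := polyLaplacian)]; exact h
    obtain ⟨c, hc, hcq⟩ := exists_iterate_polyLaplacian_normSqPoly_pow_mul (NeZero.pos d) hq hΔq k
    have hc' : (c : ℂ) ≠ 0 := by exact_mod_cast hc.ne'
    have hr : IsBihom (C (c : ℂ)⁻¹ * (normSqPoly d ^ k * q)) m n := by
      have := (hq.normSqPoly_pow_mul k).C_mul (c : ℂ)⁻¹
      rwa [Nat.add_sub_cancel' hkm, Nat.add_sub_cancel' hkn] at this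
    have h1 := ih _ m n (hp.sub hr) (by
      rw [iterate_polyLaplacian_sub, iterate_polyLaplacian_C_mul, hcq, ← mul_assoc, ← map_mul,
        inv_mul_cancel₀ hc', map_one, one_mul, ← hqdef, sub_self])
    have h2 : polyMap (C (c : ℂ)⁻¹ * (normSqPoly d ^ k * q)) = (c : ℂ)⁻¹ • polyMap q := by
      ext ζ
      have h3 := evalPoly_normSqPoly (ζ : Cn d)
      rw [norm_sphere] at h3
      have h4 : evalPoly (normSqPoly d ^ k) (ζ : Cn d) = 1 := by
        have : evalPoly (normSqPoly d ^ k) (ζ : Cn d) = evalPoly (normSqPoly d) (ζ : Cn d) ^ k := by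
          simp [evalPoly]
        rw [this, h3]; simp
      simp [h4]
    have h3 : polyMap p = polyMap (p - C (c : ℂ)⁻¹ * (normSqPoly d ^ k * q)) +
        (c : ℂ)⁻¹ • polyMap q := by
      rw [← h2, ← polyMap_add, sub_add_cancel]
    rw [h3]
    exact W.add_mem h1 (W.smul_mem _ (hW _ _ q ⟨hq, fun z => by rw [hΔq]; simp [evalPoly]⟩))

lemma polyMap_mem [NeZero d] {W : Submodule ℂ C(Sph d, ℂ)}
    (hW : ∀ m n (p : MvPolynomial (Fin d ⊕ Fin d) ℂ), IsHarm p m n → polyMap p ∈ W)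
    (p : MvPolynomial (Fin d ⊕ Fin d) ℂ) : polyMap p ∈ W := by
  induction p using MvPolynomial.induction_on' with
  | monomial a b =>
    obtain ⟨m, n, h1⟩ : ∃ m n, IsBihom (monomial a b : MvPolynomial (Fin d ⊕ Fin d) ℂ) m n :=
      ⟨_, _, isWeightedHomogeneous_monomial _ a b rfl, isWeightedHomogeneous_monomial _ a b rfl⟩
    -- A polynomial of degree m in z cannot survive more than m Laplacians.
    refine polyMap_mem_of_iterate hW (m + 1) _ _ _ h1 ?_
    exact (h1.iterate_polyLaplacian _).resolve_right fun h => by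
      have := h.1; omega
  | add p q hp hq => rw [polyMap_add]; exact W.add_mem hp hq

/-- The polynomial whose values are the conjugates of those of `p`. -/
noncomputable def conjPoly (p : MvPolynomial (Fin d ⊕ Fin d) ℂ) :
    MvPolynomial (Fin d ⊕ Fin d) ℂ := rename Sum.swap (map (starRingEnd ℂ) p)

lemma evalPoly_conjPoly (p : MvPolynomial (Fin d ⊕ Fin d) ℂ) (z : Cn d) :
    evalPoly (conjPoly p) z = conj (evalPoly p z) := by
  induction p using MvPolynomial.induction_on with
  | C a => simp [conjPoly, evalPoly]
  | add p q hp hq =>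
    have : conjPoly (p + q) = conjPoly p + conjPoly q := by simp [conjPoly]
    rw [this, evalPoly_add, hp, hq]; simp
  | mul_X p i hp =>
    have : conjPoly (p * X i) = conjPoly p * X i.swap := by simp [conjPoly]
    rw [this, evalPoly_mul, hp]
    rcases i with i | i <;> simp

/-- The star algebra of restrictions of polynomials to the sphere. -/
noncomputable def polyStarSubalgebra (d : ℕ) : StarSubalgebra ℂ C(Sph d, ℂ) where
  carrier := Set.range (polyMap (d := d))
  mul_mem' := by
    rintro _ _ ⟨p, rfl⟩ ⟨q, rfl⟩
    exact ⟨p * q, by ext ζ; simp⟩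
  add_mem' := by
    rintro _ _ ⟨p, rfl⟩ ⟨q, rfl⟩
    exact ⟨p + q, by ext ζ; simp⟩
  algebraMap_mem' r := ⟨C r, by ext ζ; simp⟩
  star_mem' := by
    rintro _ ⟨p, rfl⟩
    exact ⟨conjPoly p, by ext ζ; simp [evalPoly_conjPoly]⟩

lemma polyStarSubalgebra_separatesPoints : (polyStarSubalgebra d).SeparatesPoints := by
  intro x y hxy
  have : ∃ j, (x : Cn d) j ≠ (y : Cn d) j := by
    by_contra! h
    exact hxy (Subtype.ext (PiLp.ext h))
  obtain ⟨j, hj⟩ := this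
  exact ⟨_, ⟨polyMap (X (Sum.inl j)), ⟨_, rfl⟩, rfl⟩, by simpa using hj⟩

/-- Polynomials in z and conj z form a point-separating star algebra, dense by Stone–Weierstrass,
and every restriction of a polynomial to the sphere is a sum of harmonic ones. -/
lemma topologicalClosure_eq_top [NeZero d] {W : Submodule ℂ C(Sph d, ℂ)}
    (hW : ∀ m n (p : MvPolynomial (Fin d ⊕ Fin d) ℂ), IsHarm p m n → polyMap p ∈ W) :
    W.topologicalClosure = ⊤ := by
  have h1 := ContinuousMap.starSubalgebra_topologicalClosure_eq_top_of_separatesPoints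
    (polyStarSubalgebra d) polyStarSubalgebra_separatesPoints
  have h2 : (polyStarSubalgebra d : Set C(Sph d, ℂ)) ⊆ W := by
    rintro _ ⟨p, rfl⟩
    exact polyMap_mem hW p
  rw [eq_top_iff]
  intro u _
  have h3 : u ∈ (polyStarSubalgebra d).topologicalClosure := by rw [h1]; trivial
  exact closure_mono h2 h3

end Completeness

/-! ### Parseval's identity -/

section Parseval

open MvPolynomial

variable [NeZero d] {Y : (m n : ℕ) → Fin (harmDim d m n) → Sph d → ℂ}

lemma IsHarmonicBasis.exists_poly (hY : IsHarmonicBasis d Y) (m n : ℕ) (j) :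
    ∃ p, IsHarm p m n ∧ Y m n j = fun ζ : Sph d => evalPoly p (ζ : Cn d) := by
  rw [← mem_sphericalHarmonics_iff, ← (hY m n).1]
  exact Submodule.subset_span ⟨j, rfl⟩

/-- A polynomial representing the basis element `Y m n j`. -/
noncomputable def IsHarmonicBasis.poly (hY : IsHarmonicBasis d Y) (m n : ℕ)
    (j : Fin (harmDim d m n)) : MvPolynomial (Fin d ⊕ Fin d) ℂ := (hY.exists_poly m n j).choose

lemma IsHarmonicBasis.isHarm_poly (hY : IsHarmonicBasis d Y) (m n : ℕ) (j) :
    IsHarm (hY.poly m n j) m n := (hY.exists_poly m n j).choose_spec.1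

lemma IsHarmonicBasis.eq_poly (hY : IsHarmonicBasis d Y) (m n : ℕ) (j) (ζ : Sph d) :
    Y m n j ζ = evalPoly (hY.poly m n j) ζ :=
  congrFun (hY.exists_poly m n j).choose_spec.2 ζ

lemma IsHarmonicBasis.sphInner_poly (hY : IsHarmonicBasis d Y) (m n : ℕ) (j k) :
    sphInner (hY.poly m n j) (hY.poly m n k) = if j = k then 1 else 0 := by
  rw [← (hY m n).2 j k, sphInner]
  simp only [hY.eq_poly]

/-- Expansion of a spherical harmonic in the basis. -/
lemma IsHarmonicBasis.expand (hY : IsHarmonicBasis d Y) {m n : ℕ}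
    {p : MvPolynomial (Fin d ⊕ Fin d) ℂ} (hp : IsHarm p m n) (ζ : Sph d) :
    evalPoly p ζ = ∑ k, sphInner p (hY.poly m n k) * evalPoly (hY.poly m n k) ζ := by
  have h1 : (fun ζ : Sph d => evalPoly p (ζ : Cn d)) ∈ Submodule.span ℂ (Set.range (Y m n)) := by
    rw [(hY m n).1, mem_sphericalHarmonics_iff]; exact ⟨p, hp, rfl⟩
  obtain ⟨c, hc⟩ := (Submodule.mem_span_range_iff_exists_fun ℂ).1 h1
  have h2 : ∀ ζ : Sph d, evalPoly p ζ = ∑ k, c k * evalPoly (hY.poly m n k) ζ := by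
    intro ζ
    rw [← congrFun hc ζ]
    simp [Finset.sum_apply, hY.eq_poly]
  have h3 : ∀ k, sphInner p (hY.poly m n k) = c k := by
    intro k
    have : sphInner p (hY.poly m n k) =
        sphInner (∑ l, C (c l) * hY.poly m n l) (hY.poly m n k) := by
      simp only [sphInner]
      refine integral_congr_ae (Filter.Eventually.of_forall fun ζ => ?_)
      simp [h2]
    rw [this, sphInner_sum_left]
    simp [sphInner_C_mul_left, hY.sphInner_poly]
  rw [h2]; simp [h3]

/-- Bessel's equality in the finite dimensional space `H_{m,n}`. -/
lemma IsHarmonicBasis.sum_norm_sq_sphInner (hY : IsHarmonicBasis d Y) {m n : ℕ}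
    {p : MvPolynomial (Fin d ⊕ Fin d) ℂ} (hp : IsHarm p m n) :
    ((∑ k, ‖sphInner p (hY.poly m n k)‖ ^ 2 : ℝ) : ℂ) = sphInner p p := by
  have h1 : sphInner p p =
      sphInner (∑ l, C (sphInner p (hY.poly m n l)) * hY.poly m n l) p := by
    simp only [sphInner]
    refine integral_congr_ae (Filter.Eventually.of_forall fun ζ => ?_)
    simp only
    rw [hY.expand hp ζ]; simp [sphInner]
  rw [h1, sphInner_sum_left]
  push_cast
  refine Finset.sum_congr rfl fun k _ => ?_
  rw [sphInner_C_mul_left, ← conj_sphInner (p := p), Complex.mul_conj, Complex.normSq_eq_norm_sq]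
  push_cast; rfl

/-- The index set of the basis of spherical harmonics. -/
abbrev HarmIdx (d : ℕ) : Type := (q : ℕ × ℕ) × Fin (harmDim d q.1 q.2)

/-- The basis of spherical harmonics in `L²`. -/
noncomputable def IsHarmonicBasis.lp (hY : IsHarmonicBasis d Y) (i : HarmIdx d) :
    Lp ℂ 2 (sphMeasure d) :=
  ContinuousMap.toLp 2 (sphMeasure d) ℂ (polyMap (hY.poly i.1.1 i.1.2 i.2))

lemma IsHarmonicBasis.orthonormal_lp (hY : IsHarmonicBasis d Y) : Orthonormal ℂ hY.lp := by
  rw [orthonormal_iff_ite]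
  rintro ⟨⟨m, n⟩, j⟩ ⟨⟨m', n'⟩, k⟩
  -- The Hilbert space inner product is conjugate linear in its first argument, so the arguments of
  -- `sphInner` appear exchanged.
  have h1 : inner ℂ (hY.lp ⟨(m, n), j⟩) (hY.lp ⟨(m', n'), k⟩) =
      sphInner (hY.poly m' n' k) (hY.poly m n j) := by
    rw [IsHarmonicBasis.lp, IsHarmonicBasis.lp, ContinuousMap.inner_toLp, sphInner]
    simp
  rw [h1]
  by_cases h : (m, n) = (m', n')
  · obtain ⟨rfl, rfl⟩ := Prod.mk.inj h
    rw [hY.sphInner_poly]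
    simp [eq_comm]
  · rw [sphInner_eq_zero (hY.isHarm_poly _ _ _) (hY.isHarm_poly _ _ _) (fun h' => h h'.symm),
      if_neg]
    intro h'
    exact h (congrArg Sigma.fst h')

/-- Density passes from uniform convergence to L² because continuous functions are dense in L² of
the sphere. -/
lemma IsHarmonicBasis.span_lp (hY : IsHarmonicBasis d Y) :
    (Submodule.span ℂ (Set.range hY.lp)).topologicalClosure = ⊤ := by
  have h1 := (ContinuousMap.toLp_denseRange (p := 2) ℂ (sphMeasure d) ℂ
    (by simp)).topologicalClosure_map_submodule
    (topologicalClosure_eq_top (W := Submodule.span ℂ (Set.range fun i : HarmIdx d =>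
      polyMap (hY.poly i.1.1 i.1.2 i.2))) fun m n p hp => by
      have : polyMap p = ∑ k, sphInner p (hY.poly m n k) • polyMap (hY.poly m n k) := by
        ext ζ
        simpa using hY.expand hp ζ
      rw [this]
      exact Submodule.sum_mem _ fun k _ => Submodule.smul_mem _ _
        (Submodule.subset_span ⟨⟨(m, n), k⟩, rfl⟩))
  rw [Submodule.map_span, ← Set.range_comp] at h1
  exact h1

/-- Parseval's identity for the expansion in spherical harmonics. -/
lemma IsHarmonicBasis.hasSum_norm_sq (hY : IsHarmonicBasis d Y) {u : Sph d → ℂ}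
    (hu : MemLp u 2 (sphMeasure d)) :
    HasSum (fun q : ℕ × ℕ => ∑ k : Fin (harmDim d q.1 q.2),
        ‖∫ ζ, u ζ * conj (evalPoly (hY.poly q.1 q.2 k) (ζ : Cn d)) ∂sphMeasure d‖ ^ 2)
      (∫ ζ, ‖u ζ‖ ^ 2 ∂sphMeasure d) := by
  let b := HilbertBasis.mk hY.orthonormal_lp hY.span_lp.ge
  have hb : ∀ i, b i = hY.lp i := fun i => by simp [b]
  have h1 := b.hasSum_inner_mul_inner hu.toLp hu.toLp
  have h2 : ∀ i : HarmIdx d, inner ℂ (hY.lp i) hu.toLp =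
      ∫ ζ, u ζ * conj (evalPoly (hY.poly i.1.1 i.1.2 i.2) (ζ : Cn d)) ∂sphMeasure d := by
    intro i
    rw [L2.inner_def]
    refine integral_congr_ae ?_
    filter_upwards [hu.coeFn_toLp, ContinuousMap.coeFn_toLp (p := 2) (sphMeasure d) (𝕜 := ℂ)
      (polyMap (hY.poly i.1.1 i.1.2 i.2))] with ζ h3 h4
    rw [h3, IsHarmonicBasis.lp, h4]
    simp
  have h3 : ∀ i : HarmIdx d, inner ℂ hu.toLp (b i) * inner ℂ (b i) hu.toLp =
      ((‖∫ ζ, u ζ * conj (evalPoly (hY.poly i.1.1 i.1.2 i.2) (ζ : Cn d)) ∂sphMeasure d‖ ^ 2 : ℝ) :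
        ℂ) := by
    intro i
    rw [hb, ← h2, ← inner_conj_symm, mul_comm, Complex.mul_conj, Complex.normSq_eq_norm_sq]
  have h4 : inner ℂ hu.toLp hu.toLp = ((∫ ζ, ‖u ζ‖ ^ 2 ∂sphMeasure d : ℝ) : ℂ) := by
    rw [L2.inner_def, ← integral_complex_ofReal]
    refine integral_congr_ae ?_
    filter_upwards [hu.coeFn_toLp] with ζ h5
    rw [h5, inner_self_eq_norm_sq_to_K]; simp
  simp only [h3, h4] at h1
  have h5 := Complex.hasSum_ofReal.1 h1
  -- The sum over all basis elements is grouped into the finite blocks belonging to one bidegree.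
  exact h5.sigma fun q => hasSum_fintype _

end Parseval

end SpecialHermite

namespace SpecialHermite

variable {d : ℕ}

/-! ### The angular part of the decomposition on a single sphere -/

section SingleSphere

open MvPolynomial

variable {p q : MvPolynomial (Fin d ⊕ Fin d) ℂ} {m n : ℕ}

lemma IsHarm.rot (hp : IsHarm p (m + 1) n) (j k : Fin d) :
    IsHarm (rot j k p) m (n + 1) := by
  refine ⟨hp.1.rot j k, fun z => ?_⟩
  have h0 : evalPoly (polyLaplacian p) = fun _ : Cn d => (0 : ℂ) := funext hp.2
  rw [polyLaplacian_rot, SpecialHermite.rot, evalPoly_sub, evalPoly_mul, evalPoly_mul,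
    ← dz_evalPoly, ← dz_evalPoly, h0, dz_const, dz_const]
  simp

lemma IsHarm.rotBar (hp : IsHarm p m (n + 1)) (j k : Fin d) :
    IsHarm (rotBar j k p) (m + 1) n := by
  refine ⟨hp.1.rotBar j k, fun z => ?_⟩
  have h0 : evalPoly (polyLaplacian p) = fun _ : Cn d => (0 : ℂ) := funext hp.2
  rw [polyLaplacian_rotBar, SpecialHermite.rotBar, evalPoly_sub, evalPoly_mul, evalPoly_mul,
    ← dzbar_evalPoly, ← dzbar_evalPoly, h0, dzbar_const, dzbar_const]
  simp

lemma IsHarm.add (hp : IsHarm p m n) (hq : IsHarm q m n) : IsHarm (p + q) m n :=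
  ⟨hp.1.add hq.1, fun z => by rw [polyLaplacian_add, evalPoly_add, hp.2, hq.2, add_zero]⟩

lemma IsHarm.C_mul (c : ℂ) (hp : IsHarm p m n) : IsHarm (C c * p) m n :=
  ⟨hp.1.C_mul c, fun z => by rw [polyLaplacian_C_mul, evalPoly_mul, hp.2, mul_zero]⟩

lemma isHarm_zero : IsHarm (0 : MvPolynomial (Fin d ⊕ Fin d) ℂ) m n :=
  ⟨isBihom_zero, fun z => by rw [polyLaplacian_zero]; simp [evalPoly]⟩

lemma IsHarm.sum {ι : Type*} {s : Finset ι} {f : ι → MvPolynomial (Fin d ⊕ Fin d) ℂ}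
    (h : ∀ i ∈ s, IsHarm (f i) m n) : IsHarm (∑ i ∈ s, f i) m n := by
  classical
  induction s using Finset.induction_on with
  | empty => simpa using isHarm_zero
  | insert a s ha ih =>
    rw [Finset.sum_insert ha]
    exact (h a (by simp)).add (ih fun i hi => h i (by simp [hi]))

lemma rot_sum {ι : Type*} (s : Finset ι) (f : ι → MvPolynomial (Fin d ⊕ Fin d) ℂ) (c : ι → ℂ)
    (j k : Fin d) : rot j k (∑ i ∈ s, C (c i) * f i) = ∑ i ∈ s, C (c i) * rot j k (f i) := by
  simp only [rot, map_sum, pderiv_C_mul, Finset.mul_sum]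
  rw [← Finset.sum_sub_distrib]
  exact Finset.sum_congr rfl fun i _ => by ring

lemma rotBar_sum {ι : Type*} (s : Finset ι) (f : ι → MvPolynomial (Fin d ⊕ Fin d) ℂ) (c : ι → ℂ)
    (j k : Fin d) :
    rotBar j k (∑ i ∈ s, C (c i) * f i) = ∑ i ∈ s, C (c i) * rotBar j k (f i) := by
  simp only [rotBar, map_sum, pderiv_C_mul, Finset.mul_sum]
  rw [← Finset.sum_sub_distrib]
  exact Finset.sum_congr rfl fun i _ => by ring

/-- `∫ g conj p` over the unit sphere. -/
noncomputable def sphCoeff (g : Sph d → ℂ) (p : MvPolynomial (Fin d ⊕ Fin d) ℂ) : ℂ :=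
  ∫ ζ : Sph d, g ζ * conj (evalPoly p (ζ : Cn d)) ∂sphMeasure d

lemma integrable_mul_continuous_sphere {g w : Sph d → ℂ} (hg : Integrable g (sphMeasure d))
    (hw : Continuous w) : Integrable (fun ζ => g ζ * w ζ) (sphMeasure d) := by
  obtain ⟨C, hC⟩ := isCompact_univ.exists_bound_of_continuousOn hw.continuousOn
  exact hg.mul_bdd hw.aestronglyMeasurable (Filter.Eventually.of_forall fun ζ => hC ζ trivial)

lemma memLp_mul_continuous_sphere {g w : Sph d → ℂ} (hg : MemLp g 2 (sphMeasure d))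
    (hw : Continuous w) : MemLp (fun ζ => w ζ * g ζ) 2 (sphMeasure d) := by
  obtain ⟨C, hC⟩ := isCompact_univ.exists_bound_of_continuousOn hw.continuousOn
  refine MemLp.of_le_mul (c := C) hg (hw.aestronglyMeasurable.mul hg.aestronglyMeasurable)
    (Filter.Eventually.of_forall fun ζ => ?_)
  rw [norm_mul]
  gcongr
  exact hC ζ trivial

lemma continuous_conj_evalPoly_sphere (p : MvPolynomial (Fin d ⊕ Fin d) ℂ) :
    Continuous fun ζ : Sph d => conj (evalPoly p (ζ : Cn d)) := by
  have := continuous_evalPoly p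
  fun_prop

variable [NeZero d] {Y : (m n : ℕ) → Fin (harmDim d m n) → Sph d → ℂ} {g : Sph d → ℂ}

/-- The coefficient of a spherical harmonic in terms of the basis. -/
lemma IsHarmonicBasis.sphCoeff_eq (hY : IsHarmonicBasis d Y) (hg : Integrable g (sphMeasure d))
    (hp : IsHarm p m n) :
    sphCoeff g p = ∑ i, conj (sphInner p (hY.poly m n i)) * sphCoeff g (hY.poly m n i) := by
  simp only [sphCoeff]
  have h1 : ∀ ζ : Sph d, g ζ * conj (evalPoly p (ζ : Cn d)) =
      ∑ i, conj (sphInner p (hY.poly m n i)) *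
        (g ζ * conj (evalPoly (hY.poly m n i) (ζ : Cn d))) := by
    intro ζ
    rw [hY.expand hp ζ, map_sum, Finset.mul_sum]
    exact Finset.sum_congr rfl fun i _ => by rw [map_mul]; ring
  simp only [h1]
  rw [integral_finsetSum _ fun i _ => (integrable_mul_continuous_sphere hg
    (continuous_conj_evalPoly_sphere _)).const_mul _]
  simp only [integral_const_mul]

/-- The projection of `g` to `H_{m,n}`. -/
noncomputable def IsHarmonicBasis.proj (hY : IsHarmonicBasis d Y) (g : Sph d → ℂ) (m n : ℕ) :
    MvPolynomial (Fin d ⊕ Fin d) ℂ := ∑ i, C (sphCoeff g (hY.poly m n i)) * hY.poly m n i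

lemma IsHarmonicBasis.isHarm_proj (hY : IsHarmonicBasis d Y) (g : Sph d → ℂ) (m n : ℕ) :
    IsHarm (hY.proj g m n) m n := IsHarm.sum fun i _ => (hY.isHarm_poly m n i).C_mul _

lemma IsHarmonicBasis.sphInner_proj (hY : IsHarmonicBasis d Y) (g : Sph d → ℂ) (m n : ℕ) :
    sphInner (hY.proj g m n) (hY.proj g m n) =
      ((∑ i, ‖sphCoeff g (hY.poly m n i)‖ ^ 2 : ℝ) : ℂ) := by
  rw [← hY.sum_norm_sq_sphInner (hY.isHarm_proj g m n)]
  simp [IsHarmonicBasis.proj, sphInner_sum_left, sphInner_C_mul_left, hY.sphInner_poly]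

/-- The rotated harmonic lies in H_{m+1,n}, so its coefficient sees only the projection of g to that
space. By adjointness it is, up to sign, a coefficient of the rotated projection in H_{m,n+1};
Bessel's equality there and the Casimir eigenvalue give the constant. -/
lemma IsHarmonicBasis.sum_rotBar (hY : IsHarmonicBasis d Y) (hg : Integrable g (sphMeasure d))
    (m n : ℕ) :
    ∑ j, ∑ k, ∑ l, ‖sphCoeff g (rotBar j k (hY.poly m (n + 1) l))‖ ^ 2 =
      2 * (m + 1 : ℝ) * (n + d - 1) * ∑ i, ‖sphCoeff g (hY.poly (m + 1) n i)‖ ^ 2 := by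
  have h1 : ∀ j k l, sphCoeff g (rotBar j k (hY.poly m (n + 1) l)) =
      -sphInner (rot j k (hY.proj g (m + 1) n)) (hY.poly m (n + 1) l) := by
    intro j k l
    rw [hY.sphCoeff_eq hg ((hY.isHarm_poly m (n + 1) l).rotBar j k), IsHarmonicBasis.proj,
      rot_sum, sphInner_sum_left, ← Finset.sum_neg_distrib]
    refine Finset.sum_congr rfl fun i _ => ?_
    rw [sphInner_rotBar, sphInner_C_mul_left, map_neg, conj_sphInner]; ring
  have h2 := sum_sphInner_rot_rot (q := hY.proj g (m + 1) n) (hY.isHarm_proj g (m + 1) n)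
  rw [hY.sphInner_proj] at h2
  simp only [← hY.sum_norm_sq_sphInner ((hY.isHarm_proj g (m + 1) n).rot _ _)] at h2
  simp only [h1, norm_neg]
  have : (((∑ j, ∑ k, ∑ l, ‖sphInner (rot j k (hY.proj g (m + 1) n))
      (hY.poly m (n + 1) l)‖ ^ 2 : ℝ)) : ℂ) = ((2 * (m + 1 : ℝ) * (n + d - 1) *
        ∑ i, ‖sphCoeff g (hY.poly (m + 1) n i)‖ ^ 2 : ℝ) : ℂ) := by
    push_cast at h2 ⊢
    exact h2
  exact_mod_cast this

lemma IsHarmonicBasis.sum_rot (hY : IsHarmonicBasis d Y) (hg : Integrable g (sphMeasure d))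
    (m n : ℕ) :
    ∑ j, ∑ k, ∑ l, ‖sphCoeff g (rot j k (hY.poly (m + 1) n l))‖ ^ 2 =
      2 * (n + 1 : ℝ) * (m + d - 1) * ∑ i, ‖sphCoeff g (hY.poly m (n + 1) i)‖ ^ 2 := by
  have h1 : ∀ j k l, sphCoeff g (rot j k (hY.poly (m + 1) n l)) =
      -sphInner (rotBar j k (hY.proj g m (n + 1))) (hY.poly (m + 1) n l) := by
    intro j k l
    rw [hY.sphCoeff_eq hg ((hY.isHarm_poly (m + 1) n l).rot j k), IsHarmonicBasis.proj,
      rotBar_sum, sphInner_sum_left, ← Finset.sum_neg_distrib]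
    refine Finset.sum_congr rfl fun i _ => ?_
    rw [sphInner_rot, sphInner_C_mul_left, map_neg, conj_sphInner]; ring
  have h2 := sum_sphInner_rotBar_rotBar (q := hY.proj g m (n + 1)) (hY.isHarm_proj g m (n + 1))
  rw [hY.sphInner_proj] at h2
  simp only [← hY.sum_norm_sq_sphInner ((hY.isHarm_proj g m (n + 1)).rotBar _ _)] at h2
  simp only [h1, norm_neg]
  have : (((∑ j, ∑ k, ∑ l, ‖sphInner (rotBar j k (hY.proj g m (n + 1)))
      (hY.poly (m + 1) n l)‖ ^ 2 : ℝ)) : ℂ) = ((2 * (n + 1 : ℝ) * (m + d - 1) *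
        ∑ i, ‖sphCoeff g (hY.poly m (n + 1) i)‖ ^ 2 : ℝ) : ℂ) := by
    push_cast at h2 ⊢
    exact h2
  exact_mod_cast this

/-- Rotations shift the bidegree from (m, n+1) to (m+1, n). The two families are matched along this
shift, and the boundary terms that have no partner vanish. -/
lemma hasSum_reindex {a b : ℕ × ℕ → ℝ} {s : ℝ} (ha : ∀ m, a (m, 0) = 0) (hb : ∀ n, b (0, n) = 0)
    (h : ∀ m n, a (m, n + 1) = b (m + 1, n)) : HasSum a s ↔ HasSum b s := by
  let e : ℕ × ℕ → ℕ × ℕ := fun q => (q.1, q.2 + 1)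
  let e' : ℕ × ℕ → ℕ × ℕ := fun q => (q.1 + 1, q.2)
  have he : Function.Injective e := by
    rintro ⟨x, y⟩ ⟨x', y'⟩ h; simp [e] at h; simp [h]
  have he' : Function.Injective e' := by
    rintro ⟨x, y⟩ ⟨x', y'⟩ h; simp [e'] at h; simp [h]
  have hab : a ∘ e = b ∘ e' := funext fun q => h q.1 q.2
  have h1 : HasSum (a ∘ e) s ↔ HasSum a s := he.hasSum_iff (by
    rintro ⟨x, y⟩ hx
    rcases y with _ | y
    · exact ha x
    · exact absurd ⟨(x, y), rfl⟩ hx)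
  have h2 : HasSum (b ∘ e') s ↔ HasSum b s := he'.hasSum_iff (by
    rintro ⟨x, y⟩ hx
    rcases x with _ | x
    · exact hb y
    · exact absurd ⟨(x, y), rfl⟩ hx)
  rw [← h1, ← h2, hab]

lemma sphCoeff_zero : sphCoeff g (0 : MvPolynomial (Fin d ⊕ Fin d) ℂ) = 0 := by
  simp [sphCoeff, evalPoly]

/-- The rotation derivatives `conj z_j S_k - conj z_k S_j` contribute the eigenvalue
`m (n + d - 1)`. -/
lemma IsHarmonicBasis.hasSum_rot (hY : IsHarmonicBasis d Y) (hg : Integrable g (sphMeasure d))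
    {s : Fin d → Sph d → ℂ} (hs : ∀ j, MemLp (s j) 2 (sphMeasure d)) {r : ℝ}
    (h : ∀ j k m n l, ∫ ζ : Sph d, (conj ((ζ : Cn d) j) * s k ζ - conj ((ζ : Cn d) k) * s j ζ) *
      conj (evalPoly (hY.poly m n l) (ζ : Cn d)) ∂sphMeasure d =
        -((r : ℂ)⁻¹ * sphCoeff g (rotBar j k (hY.poly m n l)))) :
    HasSum (fun q : ℕ × ℕ => 2 * (q.1 : ℝ) * (q.2 + d - 1) / r ^ 2 *
        ∑ i, ‖sphCoeff g (hY.poly q.1 q.2 i)‖ ^ 2)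
      (∑ j, ∑ k, ∫ ζ : Sph d, ‖conj ((ζ : Cn d) j) * s k ζ - conj ((ζ : Cn d) k) * s j ζ‖ ^ 2
        ∂sphMeasure d) := by
  have hU : ∀ j k, MemLp (fun ζ : Sph d => conj ((ζ : Cn d) j) * s k ζ -
      conj ((ζ : Cn d) k) * s j ζ) 2 (sphMeasure d) := fun j k =>
    (memLp_mul_continuous_sphere (hs k) (by fun_prop)).sub
      (memLp_mul_continuous_sphere (hs j) (by fun_prop))
  have h1 := hasSum_sum (s := Finset.univ) fun j _ => hasSum_sum (s := Finset.univ) fun k _ =>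
    hY.hasSum_norm_sq (hU j k)
  -- Parseval expands in the bidegree of the rotated function, while the claim is indexed by that of
  -- g. At n = 0 the rotated basis element is zero, and at m = 0 the eigenvalue is.
  refine (hasSum_reindex ?_ ?_ ?_).1 h1
  · intro m
    refine Finset.sum_eq_zero fun j _ => Finset.sum_eq_zero fun k _ =>
      Finset.sum_eq_zero fun l _ => ?_
    simp only
    rw [h, (hY.isHarm_poly m 0 l).1.rotBar_eq_zero, sphCoeff_zero]; simp
  · intro n; simp
  · intro m n
    simp only [h]
    have h2 := hY.sum_rotBar hg m n
    simp only [norm_neg, norm_mul, mul_pow, ← Finset.mul_sum, h2]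
    rw [norm_inv, Complex.norm_real, Real.norm_eq_abs, inv_pow, sq_abs]
    push_cast
    ring

/-- The rotation derivatives `z_j S_k - z_k S_j` contribute the eigenvalue `n (m + d - 1)`. -/
lemma IsHarmonicBasis.hasSum_rotBar (hY : IsHarmonicBasis d Y) (hg : Integrable g (sphMeasure d))
    {s : Fin d → Sph d → ℂ} (hs : ∀ j, MemLp (s j) 2 (sphMeasure d)) {r : ℝ}
    (h : ∀ j k m n l, ∫ ζ : Sph d, ((ζ : Cn d) j * s k ζ - (ζ : Cn d) k * s j ζ) *
      conj (evalPoly (hY.poly m n l) (ζ : Cn d)) ∂sphMeasure d =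
        -((r : ℂ)⁻¹ * sphCoeff g (rot j k (hY.poly m n l)))) :
    HasSum (fun q : ℕ × ℕ => 2 * (q.2 : ℝ) * (q.1 + d - 1) / r ^ 2 *
        ∑ i, ‖sphCoeff g (hY.poly q.1 q.2 i)‖ ^ 2)
      (∑ j, ∑ k, ∫ ζ : Sph d, ‖(ζ : Cn d) j * s k ζ - (ζ : Cn d) k * s j ζ‖ ^ 2
        ∂sphMeasure d) := by
  have hU : ∀ j k, MemLp (fun ζ : Sph d => (ζ : Cn d) j * s k ζ -
      (ζ : Cn d) k * s j ζ) 2 (sphMeasure d) := fun j k =>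
    (memLp_mul_continuous_sphere (hs k) (by fun_prop)).sub
      (memLp_mul_continuous_sphere (hs j) (by fun_prop))
  have h1 := hasSum_sum (s := Finset.univ) fun j _ => hasSum_sum (s := Finset.univ) fun k _ =>
    hY.hasSum_norm_sq (hU j k)
  refine (hasSum_reindex ?_ ?_ ?_).2 h1
  · intro m; simp
  · intro n
    refine Finset.sum_eq_zero fun j _ => Finset.sum_eq_zero fun k _ =>
      Finset.sum_eq_zero fun l _ => ?_
    simp only
    rw [h, (hY.isHarm_poly 0 n l).1.rot_eq_zero, sphCoeff_zero]; simp
  · intro m n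
    simp only [h]
    have h2 := hY.sum_rot hg m n
    simp only [norm_neg, norm_mul, mul_pow, ← Finset.mul_sum, h2]
    rw [norm_inv, Complex.norm_real, Real.norm_eq_abs, inv_pow, sq_abs]
    push_cast
    ring

end SingleSphere

end SpecialHermite

namespace SpecialHermite

variable {d : ℕ}

/-! ### The decomposition on a single sphere -/

lemma IsBihom.evalPoly_smul {p : MvPolynomial (Fin d ⊕ Fin d) ℂ} {m n : ℕ} (hp : IsBihom p m n)
    (r : ℝ) (z : Cn d) : evalPoly p (r • z) = (r : ℂ) ^ (m + n) * evalPoly p z := by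
  simp only [evalPoly, MvPolynomial.eval_eq', Finset.mul_sum]
  refine Finset.sum_congr rfl fun s hs => ?_
  have hs' := MvPolynomial.mem_support_iff.1 hs
  have h1 := hp.1 hs'
  have h2 := hp.2 hs'
  simp [Finsupp.weight_apply, Finsupp.sum_fintype, Fintype.sum_sum_type] at h1 h2
  simp only [Fintype.prod_sum_type, Sum.elim_inl, Sum.elim_inr, PiLp.smul_apply, mul_pow, map_mul,
    Complex.real_smul, Finset.prod_mul_distrib, Finset.prod_pow_eq_pow_sum, h1, h2,
    Complex.conj_ofReal, pow_add]
  ring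

/-- Lagrange's identity for |a| = 1. Expanding the double sum produces 2|a|²|s|² - 2|∑ a_j s_j|². -/
lemma sum_norm_sq_mul_sub (a s : Fin d → ℂ) (ha : ∑ j, ‖a j‖ ^ 2 = 1) :
    ∑ j, ‖s j‖ ^ 2 = ‖∑ j, a j * s j‖ ^ 2 +
      1 / 2 * ∑ j, ∑ k, ‖conj (a j) * s k - conj (a k) * s j‖ ^ 2 := by
  have hc : ∀ z : ℂ, ((‖z‖ ^ 2 : ℝ) : ℂ) = z * conj z := fun z => by
    rw [Complex.mul_conj, Complex.normSq_eq_norm_sq]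
  have hA : ∑ j, a j * conj (a j) = 1 := by
    have := congrArg (fun x : ℝ => (x : ℂ)) ha
    simpa [hc] using this
  have : (((∑ j, ‖s j‖ ^ 2 : ℝ)) : ℂ) = ((‖∑ j, a j * s j‖ ^ 2 +
      1 / 2 * ∑ j, ∑ k, ‖conj (a j) * s k - conj (a k) * s j‖ ^ 2 : ℝ) : ℂ) := by
    rw [Complex.ofReal_add, Complex.ofReal_mul, hc]
    rw [Complex.ofReal_sum, Complex.ofReal_sum]
    simp only [Complex.ofReal_sum, hc, map_sum, map_sub, map_mul, Complex.conj_conj]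
    have e : ∀ j k, (conj (a j) * s k - conj (a k) * s j) *
        (a j * conj (s k) - a k * conj (s j)) =
        a j * conj (a j) * (s k * conj (s k)) + a k * conj (a k) * (s j * conj (s j)) -
        (a k * s k) * (conj (a j) * conj (s j)) - (a j * s j) * (conj (a k) * conj (s k)) := by
      intro j k; ring
    simp only [e, Finset.sum_sub_distrib, Finset.sum_add_distrib, ← Finset.mul_sum,
      ← Finset.sum_mul, hA]
    push_cast
    ring
  exact_mod_cast this

lemma norm_sq_add_norm_sq (a b : ℂ) :
    ‖a‖ ^ 2 + ‖b‖ ^ 2 = 1 / 2 * ‖a + b‖ ^ 2 + 1 / 2 * ‖a - b‖ ^ 2 := by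
  have := parallelogram_law_with_norm ℝ a b
  nlinarith

lemma sum_norm_sq_sphere (ζ : Sph d) : ∑ j, ‖(ζ : Cn d) j‖ ^ 2 = 1 := by
  rw [← EuclideanSpace.norm_sq_eq, norm_sphere, one_pow]

/-- Lagrange's identity applied to s with direction ζ and to t with direction conj ζ isolates two
radial components; the parallelogram law replaces these by their sum and difference, the radial and
the angular derivative. -/
lemma norm_sq_sphere_decomp (ζ : Sph d) (s t : Fin d → ℂ) :
    (∑ j, ‖s j‖ ^ 2) + ∑ j, ‖t j‖ ^ 2 =
      1 / 2 * ‖∑ j, ((ζ : Cn d) j * s j + conj ((ζ : Cn d) j) * t j)‖ ^ 2 +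
      1 / 2 * ‖∑ j, ((ζ : Cn d) j * s j - conj ((ζ : Cn d) j) * t j)‖ ^ 2 +
      1 / 2 * (∑ j, ∑ k, ‖conj ((ζ : Cn d) j) * s k - conj ((ζ : Cn d) k) * s j‖ ^ 2) +
      1 / 2 * ∑ j, ∑ k, ‖(ζ : Cn d) j * t k - (ζ : Cn d) k * t j‖ ^ 2 := by
  have h1 := sum_norm_sq_mul_sub (fun j => (ζ : Cn d) j) s (sum_norm_sq_sphere ζ)
  have h2 := sum_norm_sq_mul_sub (fun j => conj ((ζ : Cn d) j)) t
    (by simpa using sum_norm_sq_sphere ζ)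
  simp only [Complex.conj_conj] at h2
  have h3 := norm_sq_add_norm_sq (∑ j, (ζ : Cn d) j * s j) (∑ j, conj ((ζ : Cn d) j) * t j)
  rw [Finset.sum_add_distrib, Finset.sum_sub_distrib, h1, h2]
  linarith

lemma integral_norm_sq_decomp {s t : Fin d → Sph d → ℂ}
    (hs : ∀ j, MemLp (s j) 2 (sphMeasure d)) (ht : ∀ j, MemLp (t j) 2 (sphMeasure d)) :
    ∫ ζ, ((∑ j, ‖s j ζ‖ ^ 2) + ∑ j, ‖t j ζ‖ ^ 2) ∂sphMeasure d =
      1 / 2 * (∫ ζ : Sph d, ‖∑ j, ((ζ : Cn d) j * s j ζ + conj ((ζ : Cn d) j) * t j ζ)‖ ^ 2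
        ∂sphMeasure d) +
      1 / 2 * (∫ ζ : Sph d, ‖∑ j, ((ζ : Cn d) j * s j ζ - conj ((ζ : Cn d) j) * t j ζ)‖ ^ 2
        ∂sphMeasure d) +
      1 / 2 * (∑ j, ∑ k, ∫ ζ : Sph d,
        ‖conj ((ζ : Cn d) j) * s k ζ - conj ((ζ : Cn d) k) * s j ζ‖ ^ 2 ∂sphMeasure d) +
      1 / 2 * ∑ j, ∑ k, ∫ ζ : Sph d,
        ‖(ζ : Cn d) j * t k ζ - (ζ : Cn d) k * t j ζ‖ ^ 2 ∂sphMeasure d := by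
  have hsq : ∀ {u : Sph d → ℂ}, MemLp u 2 (sphMeasure d) →
      Integrable (fun ζ => ‖u ζ‖ ^ 2) (sphMeasure d) := fun hu => hu.integrable_norm_pow (by simp)
  have m1 : ∀ j, MemLp (fun ζ : Sph d => (ζ : Cn d) j * s j ζ) 2 (sphMeasure d) := fun j =>
    memLp_mul_continuous_sphere (hs j) (by fun_prop)
  have m2 : ∀ j, MemLp (fun ζ : Sph d => conj ((ζ : Cn d) j) * t j ζ) 2 (sphMeasure d) := fun j =>
    memLp_mul_continuous_sphere (ht j) (by fun_prop)
  have i1 := hsq (memLp_finsetSum' Finset.univ fun j _ => (m1 j).add (m2 j))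
  have i2 := hsq (memLp_finsetSum' Finset.univ fun j _ => (m1 j).sub (m2 j))
  have i3 : ∀ j k, Integrable (fun ζ : Sph d =>
      ‖conj ((ζ : Cn d) j) * s k ζ - conj ((ζ : Cn d) k) * s j ζ‖ ^ 2) (sphMeasure d) := fun j k =>
    hsq ((memLp_mul_continuous_sphere (hs k) (by fun_prop)).sub
      (memLp_mul_continuous_sphere (hs j) (by fun_prop)))
  have i4 : ∀ j k, Integrable (fun ζ : Sph d =>
      ‖(ζ : Cn d) j * t k ζ - (ζ : Cn d) k * t j ζ‖ ^ 2) (sphMeasure d) := fun j k =>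
    hsq ((memLp_mul_continuous_sphere (ht k) (by fun_prop)).sub
      (memLp_mul_continuous_sphere (ht j) (by fun_prop)))
  simp only [Finset.sum_apply, Pi.add_apply, Pi.sub_apply] at i1 i2
  have i3' := integrable_finsetSum Finset.univ fun j _ =>
    integrable_finsetSum Finset.univ fun k _ => i3 j k
  have i4' := integrable_finsetSum Finset.univ fun j _ =>
    integrable_finsetSum Finset.univ fun k _ => i4 j k
  simp only [fun ζ : Sph d => norm_sq_sphere_decomp ζ (fun j => s j ζ) (fun j => t j ζ)]
  have key : ∀ {a b c e : Sph d → ℝ}, Integrable a (sphMeasure d) → Integrable b (sphMeasure d) →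
      Integrable c (sphMeasure d) → Integrable e (sphMeasure d) →
      ∫ ζ, (1 / 2 * a ζ + 1 / 2 * b ζ + 1 / 2 * c ζ + 1 / 2 * e ζ) ∂sphMeasure d =
        1 / 2 * (∫ ζ, a ζ ∂sphMeasure d) + 1 / 2 * (∫ ζ, b ζ ∂sphMeasure d) +
        1 / 2 * (∫ ζ, c ζ ∂sphMeasure d) + 1 / 2 * ∫ ζ, e ζ ∂sphMeasure d := by
    intro a b c e ha hb hc he
    rw [integral_add, integral_add, integral_add]
    · simp only [integral_const_mul]
    all_goals fun_prop
  rw [key i1 i2 i3' i4', integral_finsetSum _ fun j _ => integrable_finsetSum Finset.univ fun k _ => i3 j k,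
    integral_finsetSum _ fun j _ => integrable_finsetSum Finset.univ fun k _ => i4 j k]
  simp only [fun j => integral_finsetSum Finset.univ fun k _ => i3 j k,
    fun j => integral_finsetSum Finset.univ fun k _ => i4 j k]

end SpecialHermite

/-! ### Angular weights, summability of the five series, and the single-sphere decomposition -/

namespace SpecialHermite

variable {d : ℕ}

/-- The weight of `|F_{m,n}^j(r)|²` in the decomposition, the radial derivative left aside. -/
noncomputable def angWeight (d : ℕ) (r : ℝ) (q : ℕ × ℕ) : ℝ :=
  1 / 2 * (((q.1 : ℝ) - q.2) / r + r / 2) ^ 2 +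
    1 / 2 * (2 * (q.1 : ℝ) * (q.2 + d - 1) / r ^ 2) + 1 / 2 * (2 * (q.2 : ℝ) * (q.1 + d - 1) / r ^ 2)

/-- In the square, (m-n)²/2 joins the Casimir contribution 2mn to give (m+n)²/2, and the cross term
is (m-n)/2. The remaining r²/8 is what the first two series contribute besides the radial
derivative. -/
lemma angWeight_eq {r : ℝ} (hr : 0 < r) (q : ℕ × ℕ) :
    angWeight d r q = 1 / r ^ 2 * lam d q.1 q.2 + 1 / r ^ 2 * lam d q.2 q.1 +
      ((q.1 : ℝ) - q.2) / 2 + r ^ 2 / 8 := by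
  rw [angWeight, lam, lam]
  field_simp
  ring

/-- With N = m + n, the right side is at least 8N² + 8r²(m-n). Since 2r² ≤ N the second term is no
less than -4N², and 4N² ≥ (1+N)² for N ≥ 1. -/
lemma one_add_sq_le_angWeight [NeZero d] {r : ℝ} (hr : 0 < r) (q : ℕ × ℕ)
    (h1 : 1 ≤ (q.1 : ℝ) + q.2) (h2 : 2 * r ^ 2 ≤ (q.1 : ℝ) + q.2) :
    (1 + ((q.1 : ℝ) + q.2)) ^ 2 ≤ 16 * r ^ 2 * angWeight d r q := by
  have hd : (1 : ℝ) ≤ d := by exact_mod_cast Nat.one_le_iff_ne_zero.2 (NeZero.ne d)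
  have ha : (0 : ℝ) ≤ q.1 := by positivity
  have hb : (0 : ℝ) ≤ q.2 := by positivity
  have : 16 * r ^ 2 * angWeight d r q = 8 * ((q.1 : ℝ) + q.2) ^ 2 +
      16 * (d - 1) * ((q.1 : ℝ) + q.2) + 8 * r ^ 2 * ((q.1 : ℝ) - q.2) + 2 * (r ^ 2) ^ 2 := by
    rw [angWeight]; field_simp; ring
  rw [this]
  generalize (q.1 : ℝ) = a at *
  generalize (q.2 : ℝ) = b at *
  have h3 : 0 ≤ ((d : ℝ) - 1) * (a + b) := mul_nonneg (by linarith) (by linarith)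
  have h4 : -(r ^ 2 * (a + b)) ≤ r ^ 2 * (a - b) := by nlinarith [sq_nonneg r]
  have h5 : 2 * (r ^ 2 * (a + b)) ≤ (a + b) ^ 2 := by nlinarith
  nlinarith [sq_nonneg (r ^ 2)]

/-- The weight dominates (1+m+n)² up to a factor outside a finite square of indices. This quadratic
control is what allows the combined series to be split into separately convergent ones. -/
lemma summable_one_add_sq_mul [NeZero d] {r : ℝ} (hr : 0 < r) {b : ℕ × ℕ → ℝ} (hb : ∀ q, 0 ≤ b q)
    (h : Summable fun q => angWeight d r q * b q) :
    Summable fun q : ℕ × ℕ => (1 + ((q.1 : ℝ) + q.2)) ^ 2 * b q := by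
  refine Summable.of_norm_bounded_eventually (h.mul_left (16 * r ^ 2)) ?_
  obtain ⟨M, hM⟩ := exists_nat_ge (max 1 (2 * r ^ 2))
  have hfin : {q : ℕ × ℕ | q.1 < M ∧ q.2 < M}.Finite :=
    ((Set.finite_Iio M).prod (Set.finite_Iio M)).subset fun q hq => ⟨hq.1, hq.2⟩
  filter_upwards [hfin.compl_mem_cofinite] with q hq
  have hMq : (M : ℝ) ≤ q.1 + q.2 := by
    have : M ≤ q.1 + q.2 := by
      by_contra hlt
      exact hq ⟨by omega, by omega⟩
    exact_mod_cast this
  rw [Real.norm_of_nonneg (mul_nonneg (sq_nonneg _) (hb q)), ← mul_assoc]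
  exact mul_le_mul_of_nonneg_right (one_add_sq_le_angWeight hr q
    ((le_max_left _ _).trans (hM.trans hMq)) ((le_max_right _ _).trans (hM.trans hMq))) (hb q)

lemma summable_mul_of_abs_le {b c : ℕ × ℕ → ℝ} (hb : ∀ q, 0 ≤ b q)
    (h : Summable fun q : ℕ × ℕ => (1 + ((q.1 : ℝ) + q.2)) ^ 2 * b q) {K : ℝ}
    (hc : ∀ q, |c q| ≤ K * (1 + ((q.1 : ℝ) + q.2)) ^ 2) : Summable fun q => c q * b q := by
  refine Summable.of_norm_bounded (h.mul_left K) fun q => ?_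
  rw [norm_mul, Real.norm_eq_abs, Real.norm_of_nonneg (hb q), ← mul_assoc]
  exact mul_le_mul_of_nonneg_right (hc q) (hb q)

lemma abs_lam_le (m n : ℕ) : |lam d m n| ≤ (d + 1) * (1 + ((m : ℝ) + n)) ^ 2 := by
  have hm : (0 : ℝ) ≤ m := by positivity
  have hn : (0 : ℝ) ≤ n := by positivity
  have hd : (0 : ℝ) ≤ d := by positivity
  rw [lam, abs_le]
  constructor <;> nlinarith [mul_nonneg hd hm, mul_nonneg hd hn, mul_nonneg hm hn,
    mul_nonneg (mul_nonneg hd hm) hn, mul_nonneg hd (sq_nonneg ((m : ℝ) + n)),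
    sq_nonneg ((m : ℝ) + n)]

section Terms

variable {F D : (m n : ℕ) → Fin (harmDim d m n) → ℝ → ℂ} {r : ℝ}

/-- The parallelogram law: the cross terms between D and (r/2)F have opposite signs in the two
series. -/
lemma term1_add_term2 (q : ℕ × ℕ) : term1 F D r q + term2 F D r q =
    1 / 2 * (∑ j, ‖D q.1 q.2 j r‖ ^ 2) + r ^ 2 / 8 * ∑ j, ‖F q.1 q.2 j r‖ ^ 2 := by
  simp only [term1, term2, Finset.mul_sum, ← Finset.sum_add_distrib]
  refine Finset.sum_congr rfl fun j _ => ?_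
  have := parallelogram_law_with_norm ℝ (D q.1 q.2 j r) ((r / 2 : ℂ) * F q.1 q.2 j r)
  rw [norm_mul, norm_mul, mul_pow, mul_pow]
  have h1 : ‖(1 / 2 : ℂ)‖ = 1 / 2 := by norm_num
  have h2 : ‖(r / 2 : ℂ) * F q.1 q.2 j r‖ ^ 2 = r ^ 2 / 4 * ‖F q.1 q.2 j r‖ ^ 2 := by
    rw [norm_mul, mul_pow, norm_div, Complex.norm_real, div_pow, Real.norm_eq_abs, sq_abs]
    norm_num
  rw [h1]
  nlinarith

lemma term1_nonneg (q : ℕ × ℕ) : 0 ≤ term1 F D r q := Finset.sum_nonneg fun _ _ => sq_nonneg _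

lemma term2_nonneg (q : ℕ × ℕ) : 0 ≤ term2 F D r q := Finset.sum_nonneg fun _ _ => sq_nonneg _

/-- Passage from the decomposition with the weight `angWeight` to the five series. -/
lemma summable_terms [NeZero d] (hr : 0 < r) {I0 I1 : ℝ}
    (h0 : HasSum (fun q : ℕ × ℕ => ∑ j, ‖D q.1 q.2 j r‖ ^ 2) I0)
    (h1 : HasSum (fun q : ℕ × ℕ => angWeight d r q * ∑ j, ‖F q.1 q.2 j r‖ ^ 2) I1) :
    Summable (term1 F D r) ∧ Summable (term2 F D r) ∧ Summable (term3 F r) ∧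
      Summable (term4 F r) ∧ Summable (term5 F r) ∧
      1 / 2 * I0 + I1 = (∑' q, term1 F D r q) + (∑' q, term2 F D r q) + (∑' q, term3 F r q) +
        (∑' q, term4 F r q) + ∑' q, term5 F r q := by
  set b : ℕ × ℕ → ℝ := fun q => ∑ j, ‖F q.1 q.2 j r‖ ^ 2 with hbdef
  have hb : ∀ q, 0 ≤ b q := fun q => Finset.sum_nonneg fun _ _ => sq_nonneg _
  -- Only the sum with the total weight is known to converge; the quadratic bound dominates each
  -- individual coefficient, including the signed one of the fifth series.
  have hs := summable_one_add_sq_mul hr hb h1.summable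
  have hN : ∀ q : ℕ × ℕ, (0 : ℝ) ≤ (q.1 : ℝ) + q.2 := fun q => by positivity
  have sb : Summable fun q => (r ^ 2 / 8) * b q := summable_mul_of_abs_le hb hs (K := r ^ 2 / 8)
    fun q => by
      rw [abs_of_nonneg (by positivity)]
      exact le_mul_of_one_le_right (by positivity) (by nlinarith [hN q])
  have s12 : Summable fun q => term1 F D r q + term2 F D r q := by
    simp only [term1_add_term2]
    exact (h0.summable.mul_left _).add sb
  have s1 : Summable (term1 F D r) := Summable.of_nonneg_of_le term1_nonneg
    (fun q => le_add_of_nonneg_right (term2_nonneg q)) s12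
  have s2 : Summable (term2 F D r) := Summable.of_nonneg_of_le term2_nonneg
    (fun q => le_add_of_nonneg_left (term1_nonneg q)) s12
  have e3 : ∀ q, term3 F r q = (1 / r ^ 2 * lam d q.1 q.2) * b q := fun q => by
    rw [term3, ← Finset.mul_sum]
  have e4 : ∀ q, term4 F r q = (1 / r ^ 2 * lam d q.2 q.1) * b q := fun q => by
    rw [term4, ← Finset.mul_sum]
  have e5 : ∀ q, term5 F r q = (((q.1 : ℝ) - q.2) / 2) * b q := fun q => by
    rw [term5, ← Finset.mul_sum]
  have hl : ∀ m n : ℕ, |1 / r ^ 2 * lam d m n| ≤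
      (1 / r ^ 2 * (d + 1)) * (1 + ((m : ℝ) + n)) ^ 2 := fun m n => by
    rw [abs_mul, abs_of_nonneg (by positivity), mul_assoc]
    exact mul_le_mul_of_nonneg_left (abs_lam_le m n) (by positivity)
  have s3 : Summable (term3 F r) := by
    rw [funext e3]; exact summable_mul_of_abs_le hb hs fun q => hl _ _
  have s4 : Summable (term4 F r) := by
    rw [funext e4]
    refine summable_mul_of_abs_le hb hs (K := 1 / r ^ 2 * (d + 1)) fun q => ?_
    rw [add_comm (q.1 : ℝ)]
    exact hl _ _
  have s5 : Summable (term5 F r) := by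
    rw [funext e5]
    refine summable_mul_of_abs_le hb hs (K := 1) fun q => ?_
    have h1 : (0 : ℝ) ≤ q.1 := by positivity
    have h2 : (0 : ℝ) ≤ q.2 := by positivity
    rw [abs_le]; constructor <;> nlinarith
  refine ⟨s1, s2, s3, s4, s5, ?_⟩
  rw [← s1.tsum_add s2, ← s12.tsum_add s3, ← (s12.add s3).tsum_add s4,
    ← ((s12.add s3).add s4).tsum_add s5]
  refine ((h0.mul_left (1 / 2)).add h1).tsum_eq.symm.trans (tsum_congr fun q => ?_)
  rw [term1_add_term2, e3, e4, e5, angWeight_eq hr]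
  ring

end Terms

variable [NeZero d] {Y : (m n : ℕ) → Fin (harmDim d m n) → Sph d → ℂ}

/-- The decomposition of `∑ |s_j|² + ∑ |t_j|²` on a sphere of radius `r`. -/
lemma IsHarmonicBasis.sphere_decomp (hY : IsHarmonicBasis d Y)
    {F D : (m n : ℕ) → Fin (harmDim d m n) → ℝ → ℂ} {r : ℝ} (hr : 0 < r) {g : Sph d → ℂ}
    (hg : Integrable g (sphMeasure d)) {s t : Fin d → Sph d → ℂ}
    (hs : ∀ j, MemLp (s j) 2 (sphMeasure d)) (ht : ∀ j, MemLp (t j) 2 (sphMeasure d))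
    (hF : ∀ m n l, F m n l r = sphCoeff g (hY.poly m n l))
    (hD : ∀ m n l, D m n l r = sphCoeff
      (fun ζ => ∑ j, ((ζ : Cn d) j * s j ζ + conj ((ζ : Cn d) j) * t j ζ)) (hY.poly m n l))
    (hang : ∀ m n l, sphCoeff
      (fun ζ => ∑ j, ((ζ : Cn d) j * s j ζ - conj ((ζ : Cn d) j) * t j ζ)) (hY.poly m n l) =
        ((((m : ℝ) - n) / r + r / 2 : ℝ) : ℂ) * sphCoeff g (hY.poly m n l))
    (hrot : ∀ j k m n l, ∫ ζ : Sph d, (conj ((ζ : Cn d) j) * s k ζ - conj ((ζ : Cn d) k) * s j ζ) *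
      conj (evalPoly (hY.poly m n l) (ζ : Cn d)) ∂sphMeasure d =
        -((r : ℂ)⁻¹ * sphCoeff g (rotBar j k (hY.poly m n l))))
    (hrotBar : ∀ j k m n l, ∫ ζ : Sph d, ((ζ : Cn d) j * t k ζ - (ζ : Cn d) k * t j ζ) *
      conj (evalPoly (hY.poly m n l) (ζ : Cn d)) ∂sphMeasure d =
        -((r : ℂ)⁻¹ * sphCoeff g (rot j k (hY.poly m n l)))) :
    Summable (term1 F D r) ∧ Summable (term2 F D r) ∧ Summable (term3 F r) ∧
      Summable (term4 F r) ∧ Summable (term5 F r) ∧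
      ∫ ζ, ((∑ j, ‖s j ζ‖ ^ 2) + ∑ j, ‖t j ζ‖ ^ 2) ∂sphMeasure d =
        (∑' q, term1 F D r q) + (∑' q, term2 F D r q) + (∑' q, term3 F r q) +
          (∑' q, term4 F r q) + ∑' q, term5 F r q := by
  have m1 : ∀ j, MemLp (fun ζ : Sph d => (ζ : Cn d) j * s j ζ) 2 (sphMeasure d) := fun j =>
    memLp_mul_continuous_sphere (hs j) (by fun_prop)
  have m2 : ∀ j, MemLp (fun ζ : Sph d => conj ((ζ : Cn d) j) * t j ζ) 2 (sphMeasure d) := fun j =>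
    memLp_mul_continuous_sphere (ht j) (by fun_prop)
  have i1 := memLp_finsetSum' Finset.univ fun j _ => (m1 j).add (m2 j)
  have i2 := memLp_finsetSum' Finset.univ fun j _ => (m1 j).sub (m2 j)
  have H0 := hY.hasSum_norm_sq i1
  have H1 := hY.hasSum_norm_sq i2
  simp only [Finset.sum_apply, Pi.add_apply, Pi.sub_apply] at H0 H1
  have H2 := hY.hasSum_rot hg hs hrot
  have H3 := hY.hasSum_rotBar hg ht hrotBar
  simp only [← hF] at H2 H3
  have h0' : (fun q : ℕ × ℕ => ∑ j, ‖D q.1 q.2 j r‖ ^ 2) = fun q : ℕ × ℕ =>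
      ∑ k, ‖∫ ζ : Sph d, (∑ j, ((ζ : Cn d) j * s j ζ + conj ((ζ : Cn d) j) * t j ζ)) *
        conj (evalPoly (hY.poly q.1 q.2 k) (ζ : Cn d)) ∂sphMeasure d‖ ^ 2 := by
    funext q
    simp only [hD, sphCoeff]
  rw [← h0'] at H0
  -- The angular derivative and the two families of rotations together carry exactly `angWeight`;
  -- the radial derivative `H0` is kept apart.
  have h1 := ((H1.mul_left (1 / 2)).add (H2.mul_left (1 / 2))).add (H3.mul_left (1 / 2))
  have h1' : (fun q : ℕ × ℕ => angWeight d r q * ∑ j, ‖F q.1 q.2 j r‖ ^ 2) = fun q : ℕ × ℕ =>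
      1 / 2 * (∑ k, ‖∫ ζ : Sph d, (∑ j, ((ζ : Cn d) j * s j ζ - conj ((ζ : Cn d) j) * t j ζ)) *
        conj (evalPoly (hY.poly q.1 q.2 k) (ζ : Cn d)) ∂sphMeasure d‖ ^ 2) +
      1 / 2 * (2 * (q.1 : ℝ) * (q.2 + d - 1) / r ^ 2 * ∑ j, ‖F q.1 q.2 j r‖ ^ 2) +
      1 / 2 * (2 * (q.2 : ℝ) * (q.1 + d - 1) / r ^ 2 * ∑ j, ‖F q.1 q.2 j r‖ ^ 2) := by
    funext q
    have : ∀ k, ‖∫ ζ : Sph d, (∑ j, ((ζ : Cn d) j * s j ζ - conj ((ζ : Cn d) j) * t j ζ)) *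
        conj (evalPoly (hY.poly q.1 q.2 k) (ζ : Cn d)) ∂sphMeasure d‖ ^ 2 =
        (((q.1 : ℝ) - q.2) / r + r / 2) ^ 2 * ‖F q.1 q.2 k r‖ ^ 2 := by
      intro k
      have h := hang q.1 q.2 k
      rw [sphCoeff] at h
      rw [h, norm_mul, Complex.norm_real, mul_pow, Real.norm_eq_abs, sq_abs, hF]
    simp only [this, ← Finset.mul_sum, angWeight]
    ring
  rw [← h1'] at h1
  have := summable_terms hr H0 h1
  refine ⟨this.1, this.2.1, this.2.2.1, this.2.2.2.1, this.2.2.2.2.1, ?_⟩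
  rw [integral_norm_sq_decomp hs ht, ← this.2.2.2.2.2]
  ring

end SpecialHermite

namespace SpecialHermite

variable {d : ℕ}

/-! ### The decomposition on almost every sphere -/

section Homogeneity

variable {p : MvPolynomial (Fin d ⊕ Fin d) ℂ} {m n : ℕ}

/-- A rotation trades one degree in z for one in conj z, so the total degree is kept. For m = 0
there is no degree to trade, but then the rotated polynomial is zero. -/
lemma IsBihom.evalPoly_rot_smul (hp : IsBihom p m n) (j k : Fin d) (r : ℝ) (z : Cn d) :
    evalPoly (SpecialHermite.rot j k p) (r • z) =
      (r : ℂ) ^ (m + n) * evalPoly (SpecialHermite.rot j k p) z := by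
  rcases m with _ | m
  · rw [hp.rot_eq_zero]; simp [evalPoly]
  · rw [(hp.rot j k).evalPoly_smul, show m + (n + 1) = m + 1 + n by ring]

lemma IsBihom.evalPoly_rotBar_smul (hp : IsBihom p m n) (j k : Fin d) (r : ℝ) (z : Cn d) :
    evalPoly (SpecialHermite.rotBar j k p) (r • z) =
      (r : ℂ) ^ (m + n) * evalPoly (SpecialHermite.rotBar j k p) z := by
  rcases n with _ | n
  · rw [hp.rotBar_eq_zero]; simp [evalPoly]
  · rw [(hp.rotBar j k).evalPoly_smul, show m + 1 + n = m + (n + 1) by ring]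

lemma IsBihom.sum_mul_dz_conj_evalPoly (hp : IsBihom p m n) (z : Cn d) :
    ∑ j, z j * dz j (fun z => conj (evalPoly p z)) z = n * conj (evalPoly p z) := by
  have h := congrArg (fun q => conj (evalPoly q z)) hp.euler_inr
  simp only [evalPoly, map_sum, map_mul, MvPolynomial.eval_X, Sum.elim_inr, map_natCast,
    Complex.conj_conj] at h
  simp only [dz_conj_evalPoly]
  exact h

lemma IsBihom.sum_mul_dzbar_conj_evalPoly (hp : IsBihom p m n) (z : Cn d) :
    ∑ j, conj (z j) * dzbar j (fun z => conj (evalPoly p z)) z = m * conj (evalPoly p z) := by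
  have h := congrArg (fun q => conj (evalPoly q z)) hp.euler_inl
  simp only [evalPoly, map_sum, map_mul, MvPolynomial.eval_X, Sum.elim_inl, map_natCast] at h
  simp only [dzbar_conj_evalPoly]
  exact h

end Homogeneity

variable [NeZero d] {G : Cn d → ℂ} {S Sbar : Fin d → Cn d → ℂ}
  {p : MvPolynomial (Fin d ⊕ Fin d) ℂ} {m n : ℕ}

/-- In ∑ z_j Z_j + conj z_j Zbar_j the zeroth-order terms ±|z|²/4 cancel, so this combination is the
pure Euler field and its coefficient divided by r is the weak radial derivative. -/
lemma isWeakDeriv_sphCoeff (hG : LocallyIntegrable G) (hS : ∀ j, IsZ j G (S j))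
    (hSbar : ∀ j, IsZbar j G (Sbar j)) (hp : IsBihom p m n) :
    IsWeakDeriv (fun r => sphCoeff (fun ζ => G (r • (ζ : Cn d))) p)
      (fun r => (r : ℂ)⁻¹ * sphCoeff (fun ζ => ∑ j, ((r • (ζ : Cn d)) j * S j (r • (ζ : Cn d)) +
        conj ((r • (ζ : Cn d)) j) * Sbar j (r • (ζ : Cn d)))) p) := by
  have h := (IsZ.isWirtinger hG hS hSbar).isWeakDeriv (contDiff_conj_evalPoly p) (m + n)
    (fun r _ z => by rw [hp.evalPoly_smul]; simp)
    (fun z => by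
      rw [Finset.sum_add_distrib, hp.sum_mul_dz_conj_evalPoly, hp.sum_mul_dzbar_conj_evalPoly]
      push_cast; ring)
  have e : ∀ z : Cn d, ∑ j, (z j * (S j z - 1 / 4 * conj (z j) * G z) +
      conj (z j) * (Sbar j z + 1 / 4 * z j * G z)) = ∑ j, (z j * S j z + conj (z j) * Sbar j z) :=
    fun z => Finset.sum_congr rfl fun j _ => by ring
  simp only [e] at h
  exact h

/-- The term conj z_j conj z_k G/4 is symmetric in j, k, so the antisymmetric combination of the S_j
is a pure rotation derivative. The homogeneity of p brings the identity to the unit sphere, with one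
factor r left over from the coefficients of the field. -/
lemma ae_sphCoeff_rot (hG : LocallyIntegrable G) (hS : ∀ j, IsZ j G (S j))
    (hSbar : ∀ j, IsZbar j G (Sbar j)) (hp : IsBihom p m n) (j k : Fin d) :
    ∀ᵐ r : ℝ ∂volume.restrict (Ioi (0 : ℝ)),
      ∫ ζ : Sph d, (conj ((ζ : Cn d) j) * S k (r • (ζ : Cn d)) -
          conj ((ζ : Cn d) k) * S j (r • (ζ : Cn d))) * conj (evalPoly p (ζ : Cn d)) ∂sphMeasure d =
        -((r : ℂ)⁻¹ * sphCoeff (fun ζ => G (r • (ζ : Cn d))) (rotBar j k p)) := by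
  filter_upwards [(IsZ.isWirtinger hG hS hSbar).ae_sphere_integral_rot
    (contDiff_conj_evalPoly p) j k, ae_restrict_mem measurableSet_Ioi] with r h hr
  have hr0 : (r : ℂ) ≠ 0 := by exact_mod_cast (ne_of_gt hr : r ≠ 0)
  have e1 : ∀ ζ : Sph d, (conj ((r • (ζ : Cn d)) j) * (S k (r • (ζ : Cn d)) -
      1 / 4 * conj ((r • (ζ : Cn d)) k) * G (r • (ζ : Cn d))) -
      conj ((r • (ζ : Cn d)) k) * (S j (r • (ζ : Cn d)) -
        1 / 4 * conj ((r • (ζ : Cn d)) j) * G (r • (ζ : Cn d)))) *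
      conj (evalPoly p (r • (ζ : Cn d))) = ((r : ℂ) * (r : ℂ) ^ (m + n)) *
      ((conj ((ζ : Cn d) j) * S k (r • (ζ : Cn d)) -
          conj ((ζ : Cn d) k) * S j (r • (ζ : Cn d))) * conj (evalPoly p (ζ : Cn d))) := by
    intro ζ
    rw [hp.evalPoly_smul]
    simp only [PiLp.smul_apply, Complex.real_smul, map_mul, map_pow, Complex.conj_ofReal]
    ring
  have e2 : ∀ ζ : Sph d, G (r • (ζ : Cn d)) * (conj ((r • (ζ : Cn d)) j) *
      dz k (fun z => conj (evalPoly p z)) (r • (ζ : Cn d)) - conj ((r • (ζ : Cn d)) k) *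
      dz j (fun z => conj (evalPoly p z)) (r • (ζ : Cn d))) = (r : ℂ) ^ (m + n) *
      (G (r • (ζ : Cn d)) * conj (evalPoly (rotBar j k p) (ζ : Cn d))) := by
    intro ζ
    have : conj ((r • (ζ : Cn d)) j) *
      dz k (fun z => conj (evalPoly p z)) (r • (ζ : Cn d)) - conj ((r • (ζ : Cn d)) k) *
      dz j (fun z => conj (evalPoly p z)) (r • (ζ : Cn d)) =
        conj (evalPoly (rotBar j k p) (r • (ζ : Cn d))) := by
      simp only [dz_conj_evalPoly, rotBar, evalPoly_sub, evalPoly_mul, evalPoly_X_inl, map_sub, map_mul]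
    rw [this, hp.evalPoly_rotBar_smul]
    simp only [map_mul, map_pow, Complex.conj_ofReal]
    ring
  simp only [e1, e2, integral_const_mul] at h
  have hp0 : (r : ℂ) ^ (m + n) ≠ 0 := pow_ne_zero _ hr0
  rw [sphCoeff]
  field_simp
  apply mul_left_cancel₀ hp0
  linear_combination h

lemma ae_sphCoeff_rotBar (hG : LocallyIntegrable G) (hS : ∀ j, IsZ j G (S j))
    (hSbar : ∀ j, IsZbar j G (Sbar j)) (hp : IsBihom p m n) (j k : Fin d) :
    ∀ᵐ r : ℝ ∂volume.restrict (Ioi (0 : ℝ)),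
      ∫ ζ : Sph d, ((ζ : Cn d) j * Sbar k (r • (ζ : Cn d)) -
          (ζ : Cn d) k * Sbar j (r • (ζ : Cn d))) * conj (evalPoly p (ζ : Cn d)) ∂sphMeasure d =
        -((r : ℂ)⁻¹ * sphCoeff (fun ζ => G (r • (ζ : Cn d))) (rot j k p)) := by
  filter_upwards [(IsZ.isWirtinger hG hS hSbar).ae_sphere_integral_rotBar
    (contDiff_conj_evalPoly p) j k, ae_restrict_mem measurableSet_Ioi] with r h hr
  have hr0 : (r : ℂ) ≠ 0 := by exact_mod_cast (ne_of_gt hr : r ≠ 0)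
  have e1 : ∀ ζ : Sph d, ((r • (ζ : Cn d)) j * (Sbar k (r • (ζ : Cn d)) +
      1 / 4 * (r • (ζ : Cn d)) k * G (r • (ζ : Cn d))) -
      (r • (ζ : Cn d)) k * (Sbar j (r • (ζ : Cn d)) +
        1 / 4 * (r • (ζ : Cn d)) j * G (r • (ζ : Cn d)))) *
      conj (evalPoly p (r • (ζ : Cn d))) = ((r : ℂ) * (r : ℂ) ^ (m + n)) *
      (((ζ : Cn d) j * Sbar k (r • (ζ : Cn d)) -
          (ζ : Cn d) k * Sbar j (r • (ζ : Cn d))) * conj (evalPoly p (ζ : Cn d))) := by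
    intro ζ
    rw [hp.evalPoly_smul]
    simp only [PiLp.smul_apply, Complex.real_smul, map_mul, map_pow, Complex.conj_ofReal]
    ring
  have e2 : ∀ ζ : Sph d, G (r • (ζ : Cn d)) * ((r • (ζ : Cn d)) j *
      dzbar k (fun z => conj (evalPoly p z)) (r • (ζ : Cn d)) - (r • (ζ : Cn d)) k *
      dzbar j (fun z => conj (evalPoly p z)) (r • (ζ : Cn d))) = (r : ℂ) ^ (m + n) *
      (G (r • (ζ : Cn d)) * conj (evalPoly (rot j k p) (ζ : Cn d))) := by
    intro ζ
    have : (r • (ζ : Cn d)) j *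
      dzbar k (fun z => conj (evalPoly p z)) (r • (ζ : Cn d)) - (r • (ζ : Cn d)) k *
      dzbar j (fun z => conj (evalPoly p z)) (r • (ζ : Cn d)) =
        conj (evalPoly (rot j k p) (r • (ζ : Cn d))) := by
      simp only [dzbar_conj_evalPoly, rot, evalPoly_sub, evalPoly_mul, evalPoly_X_inr, map_sub, map_mul, Complex.conj_conj]
    rw [this, hp.evalPoly_rot_smul]
    simp only [map_mul, map_pow, Complex.conj_ofReal]
    ring
  simp only [e1, e2, integral_const_mul] at h
  have hp0 : (r : ℂ) ^ (m + n) ≠ 0 := pow_ne_zero _ hr0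
  rw [sphCoeff]
  field_simp
  apply mul_left_cancel₀ hp0
  linear_combination h

/-- Here the zeroth-order terms add up instead of cancelling: they contribute |z|²/2 before division
by r, hence r/2. The remaining (m-n)/r is the eigenvalue of the generator of z ↦ e^{iθ}z. -/
lemma ae_sphCoeff_angular (hG : LocallyIntegrable G) (hS : ∀ j, IsZ j G (S j))
    (hSbar : ∀ j, IsZbar j G (Sbar j)) (hp : IsBihom p m n) :
    ∀ᵐ r : ℝ ∂volume.restrict (Ioi (0 : ℝ)),
      sphCoeff (fun ζ => ∑ j, ((ζ : Cn d) j * S j (r • (ζ : Cn d)) -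
        conj ((ζ : Cn d) j) * Sbar j (r • (ζ : Cn d)))) p =
        ((((m : ℝ) - n) / r + r / 2 : ℝ) : ℂ) * sphCoeff (fun ζ => G (r • (ζ : Cn d))) p := by
  have hSi := ae_all_iff.2 fun j => ae_sphere_integrable (hS j).1
  have hSbi := ae_all_iff.2 fun j => ae_sphere_integrable (hSbar j).1
  filter_upwards [(IsZ.isWirtinger hG hS hSbar).ae_sphere_integral_angular
    (contDiff_conj_evalPoly p), ae_restrict_mem measurableSet_Ioi, ae_sphere_integrable hG,
    hSi, hSbi] with r h hr hGi hSi hSbi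
  have hr0 : (r : ℂ) ≠ 0 := by exact_mod_cast (ne_of_gt hr : r ≠ 0)
  have i1 : Integrable (fun ζ : Sph d => (∑ j, ((ζ : Cn d) j * S j (r • (ζ : Cn d)) -
        conj ((ζ : Cn d) j) * Sbar j (r • (ζ : Cn d)))) * conj (evalPoly p (ζ : Cn d)))
        (sphMeasure d) := by
    refine integrable_mul_continuous_sphere (integrable_finsetSum _ fun j _ => ?_)
      (continuous_conj_evalPoly_sphere p)
    have a1 := integrable_mul_continuous_sphere (hSi j)
      (w := fun ζ : Sph d => (ζ : Cn d) j) (by fun_prop)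
    have a2 := integrable_mul_continuous_sphere (hSbi j)
      (w := fun ζ : Sph d => conj ((ζ : Cn d) j)) (by fun_prop)
    refine (a1.sub a2).congr (Filter.Eventually.of_forall fun ζ => ?_)
    simp only [Pi.sub_apply]; ring
  have i2 := integrable_mul_continuous_sphere hGi (continuous_conj_evalPoly_sphere p)
  have e1 : ∀ ζ : Sph d, (∑ j, ((r • (ζ : Cn d)) j * (S j (r • (ζ : Cn d)) -
      1 / 4 * conj ((r • (ζ : Cn d)) j) * G (r • (ζ : Cn d))) -
      conj ((r • (ζ : Cn d)) j) * (Sbar j (r • (ζ : Cn d)) +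
        1 / 4 * (r • (ζ : Cn d)) j * G (r • (ζ : Cn d))))) *
      conj (evalPoly p (r • (ζ : Cn d))) = ((r : ℂ) * (r : ℂ) ^ (m + n)) *
      ((∑ j, ((ζ : Cn d) j * S j (r • (ζ : Cn d)) -
        conj ((ζ : Cn d) j) * Sbar j (r • (ζ : Cn d)))) * conj (evalPoly p (ζ : Cn d))) -
      (1 / 2 * (r : ℂ) ^ 2 * (r : ℂ) ^ (m + n)) *
        (G (r • (ζ : Cn d)) * conj (evalPoly p (ζ : Cn d))) := by
    intro ζ
    have hn : ∑ j, (ζ : Cn d) j * conj ((ζ : Cn d) j) = 1 := by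
      have := congrArg (fun x : ℝ => (x : ℂ)) (sum_norm_sq_sphere ζ)
      simpa [Complex.mul_conj, Complex.normSq_eq_norm_sq] using this
    have e : ∀ j, (r • (ζ : Cn d)) j * (S j (r • (ζ : Cn d)) -
      1 / 4 * conj ((r • (ζ : Cn d)) j) * G (r • (ζ : Cn d))) -
      conj ((r • (ζ : Cn d)) j) * (Sbar j (r • (ζ : Cn d)) +
        1 / 4 * (r • (ζ : Cn d)) j * G (r • (ζ : Cn d))) =
        r * ((ζ : Cn d) j * S j (r • (ζ : Cn d)) -
        conj ((ζ : Cn d) j) * Sbar j (r • (ζ : Cn d))) -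
        (1 / 2 * (r : ℂ) ^ 2 * G (r • (ζ : Cn d))) * ((ζ : Cn d) j * conj ((ζ : Cn d) j)) := by
      intro j
      simp only [PiLp.smul_apply, Complex.real_smul, map_mul, Complex.conj_ofReal]
      ring
    simp only [e]
    rw [Finset.sum_sub_distrib, ← Finset.mul_sum, ← Finset.mul_sum, hn, hp.evalPoly_smul]
    simp only [map_mul, map_pow, Complex.conj_ofReal]
    ring
  have e2 : ∀ ζ : Sph d, G (r • (ζ : Cn d)) * ∑ j, ((r • (ζ : Cn d)) j *
      dz j (fun z => conj (evalPoly p z)) (r • (ζ : Cn d)) - conj ((r • (ζ : Cn d)) j) *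
      dzbar j (fun z => conj (evalPoly p z)) (r • (ζ : Cn d))) =
      (((n : ℂ) - m) * (r : ℂ) ^ (m + n)) *
        (G (r • (ζ : Cn d)) * conj (evalPoly p (ζ : Cn d))) := by
    intro ζ
    rw [Finset.sum_sub_distrib, hp.sum_mul_dz_conj_evalPoly, hp.sum_mul_dzbar_conj_evalPoly,
      hp.evalPoly_smul]
    simp only [map_mul, map_pow, Complex.conj_ofReal]
    ring
  simp only [e1, e2, integral_const_mul] at h
  rw [integral_sub (i1.const_mul _) (i2.const_mul _), integral_const_mul, integral_const_mul] at h
  have hp0 : (r : ℂ) ^ (m + n) ≠ 0 := pow_ne_zero _ hr0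
  rw [sphCoeff, sphCoeff]
  push_cast
  field_simp
  apply mul_left_cancel₀ hp0
  linear_combination 2 * h

lemma memLp_of_integrable_rieszSq {r : ℝ} (h : Integrable (rieszSq S Sbar r) (sphMeasure d))
    {u : Sph d → ℂ} (hu : AEStronglyMeasurable u (sphMeasure d))
    (hle : ∀ ζ, ‖u ζ‖ ^ 2 ≤ rieszSq S Sbar r ζ) : MemLp u 2 (sphMeasure d) :=
  (memLp_two_iff_integrable_sq_norm hu).2 <| h.mono' (hu.norm.pow 2) <|
    Filter.Eventually.of_forall fun ζ => by
      rw [Real.norm_of_nonneg (sq_nonneg _)]; exact hle ζ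

/-- The decomposition needs only a locally integrable G with distributions Z_jG and Zbar_jG given by
locally integrable functions; how G arises as L^{-1/2}f is irrelevant here. The witness for D is the
spherical coefficient of the Euler derivative, divided by r. -/
theorem riesz_sphere_decomp {Y : (m n : ℕ) → Fin (harmDim d m n) → Sph d → ℂ}
    (hY : IsHarmonicBasis d Y) (hG : LocallyIntegrable G) (hS : ∀ j, IsZ j G (S j))
    (hSbar : ∀ j, IsZbar j G (Sbar j)) {F : (m n : ℕ) → Fin (harmDim d m n) → ℝ → ℂ}
    (hF : ∀ m n j r, F m n j r = harmCoeff G (Y m n j) r) :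
    ∃ D : (m n : ℕ) → Fin (harmDim d m n) → ℝ → ℂ,
      (∀ m n j, IsWeakDeriv (F m n j) (D m n j)) ∧
      ∀ᵐ r ∂(volume.restrict (Ioi (0 : ℝ))), Integrable (rieszSq S Sbar r) (sphMeasure d) →
        Summable (term1 F D r) ∧ Summable (term2 F D r) ∧ Summable (term3 F r) ∧
        Summable (term4 F r) ∧ Summable (term5 F r) ∧
        ∫ ζ, rieszSq S Sbar r ζ ∂sphMeasure d =
          (∑' q, term1 F D r q) + (∑' q, term2 F D r q) + (∑' q, term3 F r q) +
            (∑' q, term4 F r q) + ∑' q, term5 F r q := by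
  have hF' : ∀ m n l r, F m n l r = sphCoeff (fun ζ => G (r • (ζ : Cn d))) (hY.poly m n l) := by
    intro m n l r
    rw [hF, harmCoeff, sphCoeff]
    simp only [hY.eq_poly]
  refine ⟨fun m n l r => (r : ℂ)⁻¹ * sphCoeff (fun ζ => ∑ j, ((r • (ζ : Cn d)) j *
    S j (r • (ζ : Cn d)) + conj ((r • (ζ : Cn d)) j) * Sbar j (r • (ζ : Cn d))))
    (hY.poly m n l), fun m n l => ?_, ?_⟩
  · rw [funext (hF' m n l)]
    exact isWeakDeriv_sphCoeff hG hS hSbar (hY.isHarm_poly m n l).1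
  · have hSi := ae_all_iff.2 fun j => ae_sphere_integrable (hS j).1
    have hSbi := ae_all_iff.2 fun j => ae_sphere_integrable (hSbar j).1
    -- The index sets are countable, so a single null set of radii serves all coefficient
    -- identities.
    have hrot := ae_all_iff.2 fun j => ae_all_iff.2 fun k => ae_all_iff.2 fun m =>
      ae_all_iff.2 fun n => ae_all_iff.2 fun l =>
        ae_sphCoeff_rot hG hS hSbar (hY.isHarm_poly m n l).1 j k
    have hrotBar := ae_all_iff.2 fun j => ae_all_iff.2 fun k => ae_all_iff.2 fun m =>
      ae_all_iff.2 fun n => ae_all_iff.2 fun l =>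
        ae_sphCoeff_rotBar hG hS hSbar (hY.isHarm_poly m n l).1 j k
    have hang := ae_all_iff.2 fun m => ae_all_iff.2 fun n => ae_all_iff.2 fun l =>
        ae_sphCoeff_angular hG hS hSbar (hY.isHarm_poly m n l).1
    filter_upwards [ae_restrict_mem measurableSet_Ioi, ae_sphere_integrable hG,
      hSi, hSbi, hrot, hrotBar, hang] with r hr hGi hSi hSbi hrot hrotBar hang hint
    have hr0 : (r : ℂ) ≠ 0 := by exact_mod_cast (ne_of_gt hr : r ≠ 0)
    refine hY.sphere_decomp hr hGi
      (fun j => memLp_of_integrable_rieszSq hint (hSi j).aestronglyMeasurable fun ζ => ?_)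
      (fun j => memLp_of_integrable_rieszSq hint (hSbi j).aestronglyMeasurable fun ζ => ?_)
      (fun m n l => hF' m n l r) (fun m n l => ?_) hang hrot hrotBar
    · exact (Finset.single_le_sum (f := fun j => ‖S j (r • (ζ : Cn d))‖ ^ 2)
        (fun _ _ => sq_nonneg _) (Finset.mem_univ j)).trans
        (le_add_of_nonneg_right (Finset.sum_nonneg fun _ _ => sq_nonneg _))
    · exact (Finset.single_le_sum (f := fun j => ‖Sbar j (r • (ζ : Cn d))‖ ^ 2)
        (fun _ _ => sq_nonneg _) (Finset.mem_univ j)).trans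
        (le_add_of_nonneg_left (Finset.sum_nonneg fun _ _ => sq_nonneg _))
    · rw [sphCoeff, sphCoeff, ← integral_const_mul]
      congr 1 with ζ
      rw [← mul_assoc, Finset.mul_sum]
      refine congrArg (· * _) (Finset.sum_congr rfl fun j _ => ?_)
      simp only [PiLp.smul_apply, Complex.real_smul, map_mul, Complex.conj_ofReal]
      field_simp

end SpecialHermite

namespace SpecialHermite

variable {d : ℕ}

/-! ### The twisted heat kernel -/

lemma dotConj_add_left (z z' w : Cn d) : dotConj (z + z') w = dotConj z w + dotConj z' w := by
  simp [dotConj, add_mul, Finset.sum_add_distrib]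

lemma dotConj_add_right (z w w' : Cn d) : dotConj z (w + w') = dotConj z w + dotConj z w' := by
  simp [dotConj, mul_add, Finset.sum_add_distrib]

lemma dotConj_sub_left (z z' w : Cn d) : dotConj (z - z') w = dotConj z w - dotConj z' w := by
  simp [dotConj, sub_mul, Finset.sum_sub_distrib]

lemma dotConj_sub_right (z w w' : Cn d) : dotConj z (w - w') = dotConj z w - dotConj z w' := by
  simp [dotConj, mul_sub, Finset.sum_sub_distrib]

lemma dotConj_smul_left (a : ℝ) (z w : Cn d) : dotConj (a • z) w = a * dotConj z w := by
  simp [dotConj, Finset.mul_sum, mul_assoc]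

lemma dotConj_smul_right (a : ℝ) (z w : Cn d) : dotConj z (a • w) = a * dotConj z w := by
  simp [dotConj, Finset.mul_sum, mul_left_comm]

lemma conj_dotConj (z w : Cn d) : conj (dotConj z w) = dotConj w z := by
  simp [dotConj, map_sum, mul_comm]

lemma im_dotConj_comm (z w : Cn d) : (dotConj z w).im = -(dotConj w z).im := by
  rw [← conj_dotConj w z, Complex.conj_im]

lemma im_dotConj_self (z : Cn d) : (dotConj z z).im = 0 := by
  have := im_dotConj_comm z z
  linarith

lemma im_dotConj_eq_inner (z w : Cn d) : (dotConj z w).im = inner ℝ ((-Complex.I) • z) w := by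
  simp only [dotConj, PiLp.inner_apply, Complex.inner, Complex.im_sum, PiLp.smul_apply]
  refine Finset.sum_congr rfl fun j _ => ?_
  simp
  ring

@[fun_prop] lemma continuous_dotConj : Continuous fun q : Cn d × Cn d => dotConj q.1 q.2 := by
  unfold dotConj
  fun_prop

lemma heatKernel_pos {t : ℝ} (ht : 0 < t) (z : Cn d) : 0 < heatKernel d t z := by
  have := Real.sinh_pos_iff.2 ht
  unfold heatKernel
  positivity

lemma heatKernel_neg (t : ℝ) (z : Cn d) : heatKernel d t (-z) = heatKernel d t z := by
  simp [heatKernel]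

/-- The integral kernel of `e^{-tL}`. -/
noncomputable def twistedKernel (t : ℝ) (z w : Cn d) : ℂ :=
  (heatKernel d t (z - w) : ℂ) * Complex.exp (-(Complex.I / 2 * ((dotConj z w).im : ℂ)))

lemma norm_exp_I_mul (x : ℝ) : ‖Complex.exp (Complex.I / 2 * (x : ℂ))‖ = 1 := by
  rw [show Complex.I / 2 * (x : ℂ) = ((x / 2 : ℝ) : ℂ) * Complex.I by push_cast; ring]
  exact Complex.norm_exp_ofReal_mul_I _

lemma norm_twistedKernel {t : ℝ} (ht : 0 < t) (z w : Cn d) :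
    ‖twistedKernel t z w‖ = heatKernel d t (z - w) := by
  rw [twistedKernel, norm_mul, Complex.norm_real, Real.norm_of_nonneg (heatKernel_pos ht _).le,
    ← mul_neg, ← Complex.ofReal_neg, norm_exp_I_mul, mul_one]

lemma conj_twistedKernel (t : ℝ) (z w : Cn d) :
    conj (twistedKernel t z w) = twistedKernel t w z := by
  rw [twistedKernel, twistedKernel, map_mul, Complex.conj_ofReal, ← Complex.exp_conj,
    im_dotConj_comm w z, ← heatKernel_neg t (z - w), neg_sub]
  congr 2
  rw [map_neg, map_mul, map_div₀, Complex.conj_I, map_ofNat, Complex.conj_ofReal]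
  push_cast
  ring

/-- The substitution w ↦ z - w moves the variable off f. The phase merely changes sign, because Im(z
· conj z) = 0. -/
lemma heat_eq (t : ℝ) (f : Cn d → ℂ) (z : Cn d) :
    heat t f z = ∫ w, f w * twistedKernel t z w := by
  rw [heat, twistedConv, ← integral_sub_left_eq_self _ _ z]
  congr 1 with w
  rw [sub_sub_cancel, twistedKernel, dotConj_sub_right, Complex.sub_im, im_dotConj_self, mul_assoc]
  congr 3
  push_cast
  ring

lemma continuous_heatKernel (t : ℝ) : Continuous (heatKernel d t) := by
  unfold heatKernel; fun_prop

lemma continuous_twistedKernel (t : ℝ) :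
    Continuous fun q : Cn d × Cn d => twistedKernel t q.1 q.2 := by
  have := continuous_heatKernel (d := d) t
  unfold twistedKernel; fun_prop

lemma measurable_heatKernel : Measurable fun q : ℝ × Cn d => heatKernel d q.1 q.2 := by
  unfold heatKernel; fun_prop

lemma measurable_twistedKernel :
    Measurable fun q : ℝ × Cn d × Cn d => twistedKernel q.1 q.2.1 q.2.2 := by
  have h1 : Measurable fun q : ℝ × Cn d × Cn d => heatKernel d q.1 (q.2.1 - q.2.2) :=
    Measurable.comp (g := fun q : ℝ × Cn d => heatKernel d q.1 q.2)
      (f := fun q : ℝ × Cn d × Cn d => (q.1, q.2.1 - q.2.2)) measurable_heatKernel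
      (measurable_fst.prodMk
        ((measurable_fst.comp measurable_snd).sub (measurable_snd.comp measurable_snd)))
  have h2 : Measurable fun q : ℝ × Cn d × Cn d => dotConj q.2.1 q.2.2 :=
    continuous_dotConj.measurable.comp measurable_snd
  exact h1.complex_ofReal.mul (Complex.measurable_exp.comp
    ((Complex.measurable_ofReal.comp (Complex.measurable_im.comp h2)).const_mul _).neg)

lemma coth_pos {t : ℝ} (ht : 0 < t) : 0 < Real.cosh t / Real.sinh t :=
  div_pos (Real.cosh_pos t) (Real.sinh_pos_iff.2 ht)

/-- The Fourier transform of a Gaussian in real dimension 2d. The linear form Im(ζ · conj y) is the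
real inner product of y with -iζ, and half the real dimension is the exponent d. -/
lemma integral_gaussian {b : ℝ} (hb : 0 < b) (ζ : Cn d) :
    ∫ y : Cn d, Complex.exp (-(b : ℂ) * (‖y‖ : ℂ) ^ 2 - Complex.I / 2 * ((dotConj ζ y).im : ℂ)) =
      (((Real.pi / b) ^ d * Real.exp (-(‖ζ‖ ^ 2 / (16 * b))) : ℝ) : ℂ) := by
  have h := GaussianFourier.integral_cexp_neg_mul_sq_norm_add (V := Cn d) (b := (b : ℂ))
    (by simpa using hb) (-(Complex.I / 2)) ((-Complex.I) • ζ)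
  rw [finrank_Cn, norm_smul, norm_neg, Complex.norm_I, one_mul] at h
  simp only [im_dotConj_eq_inner]
  rw [show ((2 * d : ℕ) : ℂ) / 2 = (d : ℂ) by push_cast; ring, Complex.cpow_natCast] at h
  simp only [sub_eq_add_neg]
  simp only [neg_mul (Complex.I / 2)] at h
  rw [h]
  push_cast
  congr 2
  rw [neg_sq, div_pow, Complex.I_sq]
  field_simp
  ring

lemma integrable_gaussian {b : ℝ} (hb : 0 < b) (ζ : Cn d) :
    Integrable fun y : Cn d =>
      Complex.exp (-(b : ℂ) * (‖y‖ : ℂ) ^ 2 - Complex.I / 2 * ((dotConj ζ y).im : ℂ)) := by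
  have h := GaussianFourier.integrable_cexp_neg_mul_sq_norm_add (V := Cn d) (b := (b : ℂ))
    (by simpa using hb) (-(Complex.I / 2)) ((-Complex.I) • ζ)
  simp only [im_dotConj_eq_inner, sub_eq_add_neg]
  simpa only [neg_mul (Complex.I / 2)] using h

lemma ofReal_heatKernel (t : ℝ) (z : Cn d) : (heatKernel d t z : ℂ) =
    (((4 * Real.pi * Real.sinh t) ^ d)⁻¹ : ℝ) *
      Complex.exp (-((1 / 4 * (Real.cosh t / Real.sinh t) : ℝ) : ℂ) * (‖z‖ : ℂ) ^ 2) := by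
  rw [heatKernel]
  push_cast
  congr 2
  ring

lemma integrable_heatKernel {t : ℝ} (ht : 0 < t) : Integrable (heatKernel d t) := by
  have h := (integrable_gaussian (d := d) (b := 1 / 4 * (Real.cosh t / Real.sinh t))
    (mul_pos (by norm_num) (coth_pos ht)) 0).const_mul ((((4 * Real.pi * Real.sinh t) ^ d)⁻¹ : ℝ) : ℂ)
  have h2 : Integrable fun z : Cn d => (heatKernel d t z : ℂ) := by
    refine h.congr (Filter.Eventually.of_forall fun z => ?_)
    simp only [ofReal_heatKernel]
    simp [dotConj]
  exact h2.re

/-- The Gaussian integral at ζ = 0. The mass is below 1 and decays exponentially as t grows, which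
supplies both contractivity and convergence at infinity of the integral for L^{-1/2}. -/
lemma integral_heatKernel {t : ℝ} (ht : 0 < t) :
    ∫ z : Cn d, heatKernel d t z = (Real.cosh t ^ d)⁻¹ := by
  have hs := Real.sinh_pos_iff.2 ht
  have hc := Real.cosh_pos t
  have h := integral_gaussian (d := d) (b := 1 / 4 * (Real.cosh t / Real.sinh t))
    (mul_pos (by norm_num) (coth_pos ht)) 0
  have h2 : ∫ z : Cn d, (heatKernel d t z : ℂ) = (((Real.cosh t ^ d)⁻¹ : ℝ) : ℂ) := by
    simp only [ofReal_heatKernel, integral_const_mul]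
    simp only [dotConj, PiLp.zero_apply, zero_mul, Finset.sum_const_zero, Complex.zero_im,
      Complex.ofReal_zero, mul_zero, sub_zero] at h
    rw [h, ← Complex.ofReal_mul]
    congr 1
    rw [norm_zero]
    simp only [ne_eq, OfNat.ofNat_ne_zero, not_false_eq_true, zero_pow, zero_div, neg_zero,
      Real.exp_zero, mul_one]
    rw [← inv_pow, ← inv_pow, ← mul_pow]
    congr 1
    field_simp
  exact_mod_cast integral_complex_ofReal.symm.trans h2

/-- Completing the square around the weighted mean of z and v: the mixed terms cancel in this
centring. -/
lemma norm_sq_complete {a b : ℝ} (hab : a + b ≠ 0) (z v y : Cn d) :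
    a * ‖z - (y + ((a / (a + b)) • z + (b / (a + b)) • v))‖ ^ 2 +
      b * ‖(y + ((a / (a + b)) • z + (b / (a + b)) • v)) - v‖ ^ 2 =
      (a + b) * ‖y‖ ^ 2 + a * b / (a + b) * ‖z - v‖ ^ 2 := by
  have e1 : z - (y + ((a / (a + b)) • z + (b / (a + b)) • v)) = (b / (a + b)) • (z - v) - y := by
    have : z = (a / (a + b)) • z + (b / (a + b)) • z := by
      rw [← add_smul, ← add_div, div_self hab, one_smul]
    nth_rw 1 [this]
    rw [smul_sub]; abel
  have e2 : (y + ((a / (a + b)) • z + (b / (a + b)) • v)) - v = (a / (a + b)) • (z - v) + y := by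
    have : v = (a / (a + b)) • v + (b / (a + b)) • v := by
      rw [← add_smul, ← add_div, div_self hab, one_smul]
    nth_rw 2 [this]
    rw [smul_sub]; abel
  rw [e1, e2, norm_sub_sq_real, norm_add_sq_real, inner_smul_left, inner_smul_left, norm_smul,
    norm_smul, mul_pow, mul_pow, Real.norm_eq_abs, Real.norm_eq_abs, sq_abs, sq_abs]
  simp only [conj_trivial]
  field_simp
  ring

/-- In the same centring the two twisting phases combine into the phase of the composed kernel and
one term linear in y, which acts as a Fourier frequency. -/
lemma im_dotConj_complete {a b : ℝ} (hab : a + b ≠ 0) (z v y : Cn d) :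
    (dotConj z (y + ((a / (a + b)) • z + (b / (a + b)) • v))).im +
      (dotConj (y + ((a / (a + b)) • z + (b / (a + b)) • v)) v).im =
      (dotConj z v).im + (dotConj (z - v) y).im := by
  simp only [dotConj_add_left, dotConj_add_right, dotConj_smul_left, dotConj_smul_right,
    dotConj_sub_left, Complex.add_im, Complex.sub_im, Complex.im_ofReal_mul,
    im_dotConj_self, im_dotConj_comm v y]
  field_simp
  ring

/-- The semigroup property on the level of kernels. -/
lemma integral_twistedKernel_mul {s t : ℝ} (hs : 0 < s) (ht : 0 < t) (z v : Cn d) :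
    ∫ w, twistedKernel s z w * twistedKernel t w v = twistedKernel (s + t) z v := by
  have hss := Real.sinh_pos_iff.2 hs
  have hst := Real.sinh_pos_iff.2 ht
  have hsst := Real.sinh_pos_iff.2 (add_pos hs ht)
  set a := Real.cosh s / Real.sinh s with ha
  set b := Real.cosh t / Real.sinh t with hb
  have ha0 : 0 < a := coth_pos hs
  have hb0 : 0 < b := coth_pos ht
  have hab : a + b ≠ 0 := (add_pos ha0 hb0).ne'
  have hsum : a + b = Real.sinh (s + t) / (Real.sinh s * Real.sinh t) := by
    rw [ha, hb, Real.sinh_add]; field_simp; ring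
  -- The addition theorem for coth; ab/(a+b) will come from completing the square and 1/(a+b) from
  -- the Gaussian Fourier transform.
  have hprod : (a * b + 1) / (a + b) = Real.cosh (s + t) / Real.sinh (s + t) := by
    rw [hsum, ha, hb, Real.cosh_add]; field_simp
  rw [← integral_add_right_eq_self _ ((a / (a + b)) • z + (b / (a + b)) • v)]
  have key : ∀ y : Cn d,
      twistedKernel s z (y + ((a / (a + b)) • z + (b / (a + b)) • v)) *
        twistedKernel t (y + ((a / (a + b)) • z + (b / (a + b)) • v)) v =
      (((((4 * Real.pi * Real.sinh s) ^ d)⁻¹ * ((4 * Real.pi * Real.sinh t) ^ d)⁻¹ *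
        Real.exp (-(1 / 4 * (a * b / (a + b)) * ‖z - v‖ ^ 2)) : ℝ) : ℂ) *
        Complex.exp (-(Complex.I / 2 * ((dotConj z v).im : ℂ)))) *
        Complex.exp (-((1 / 4 * (a + b) : ℝ) : ℂ) * (‖y‖ : ℂ) ^ 2 -
          Complex.I / 2 * ((dotConj (z - v) y).im : ℂ)) := by
    intro y
    have h1 := congrArg (fun x : ℝ => (x : ℂ)) (norm_sq_complete hab z v y)
    have h2 := congrArg (fun x : ℝ => (x : ℂ)) (im_dotConj_complete hab z v y)
    simp only [twistedKernel, ofReal_heatKernel]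
    generalize y + ((a / (a + b)) • z + (b / (a + b)) • v) = m at h1 h2 ⊢
    rw [← ha, ← hb]
    push_cast at h1 h2 ⊢
    have h3 : ∀ A B e1 e2 e3 e4 e5 e6 e7 : ℂ, e1 + e2 + e3 + e4 = e5 + e6 + e7 →
        A * Complex.exp e1 * Complex.exp e2 * (B * Complex.exp e3 * Complex.exp e4) =
        A * B * Complex.exp e5 * Complex.exp e6 * Complex.exp e7 := by
      intro A B e1 e2 e3 e4 e5 e6 e7 h
      have : Complex.exp e1 * Complex.exp e2 * Complex.exp e3 * Complex.exp e4 =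
          Complex.exp e5 * Complex.exp e6 * Complex.exp e7 := by
        simp only [← Complex.exp_add, h]
      linear_combination A * B * this
    apply h3
    linear_combination (-1 / 4 : ℂ) * h1 - Complex.I / 2 * h2
  simp only [key]
  rw [integral_const_mul, integral_gaussian (mul_pos (by norm_num) (add_pos ha0 hb0)),
    twistedKernel, heatKernel, mul_right_comm, ← Complex.ofReal_mul]
  congr 2
  rw [← hprod]
  have h4 : Real.exp (-(1 / 4 * (a * b / (a + b)) * ‖z - v‖ ^ 2)) *
      Real.exp (-(‖z - v‖ ^ 2 / (16 * (1 / 4 * (a + b))))) =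
      Real.exp (-(1 / 4) * ‖z - v‖ ^ 2 * ((a * b + 1) / (a + b))) := by
    rw [← Real.exp_add]
    congr 1
    field_simp
    ring
  -- The prefactors combine because a + b = sinh(s+t)/(sinh s sinh t).
  have h5 : ((4 * Real.pi * Real.sinh s) ^ d)⁻¹ * ((4 * Real.pi * Real.sinh t) ^ d)⁻¹ *
      (Real.pi / (1 / 4 * (a + b))) ^ d = ((4 * Real.pi * Real.sinh (s + t)) ^ d)⁻¹ := by
    rw [← inv_pow, ← inv_pow, ← inv_pow, ← mul_pow, ← mul_pow]
    congr 1
    rw [hsum]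
    field_simp
  rw [← h4, ← h5]
  ring

end SpecialHermite

namespace SpecialHermite

variable {d : ℕ}

/-! ### Square integrability and convolution -/

section Young

open scoped ENNReal

lemma sq_lintegral_mul_le {α : Type*} [MeasurableSpace α] (μ : Measure α) {f g : α → ℝ≥0∞}
    (hf : AEMeasurable f μ) (hg : AEMeasurable g μ) :
    (∫⁻ x, f x * g x ∂μ) ^ 2 ≤ (∫⁻ x, f x ^ 2 ∂μ) * ∫⁻ x, g x ^ 2 ∂μ := by
  have h := ENNReal.lintegral_mul_le_Lp_mul_Lq μ Real.HolderConjugate.two_two hf hg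
  simp only [Pi.mul_apply, ENNReal.rpow_ofNat] at h
  calc (∫⁻ x, f x * g x ∂μ) ^ 2
      ≤ ((∫⁻ x, f x ^ 2 ∂μ) ^ (1 / 2 : ℝ) * (∫⁻ x, g x ^ 2 ∂μ) ^ (1 / 2 : ℝ)) ^ 2 := by gcongr
    _ = (∫⁻ x, f x ^ 2 ∂μ) * ∫⁻ x, g x ^ 2 ∂μ := by
      rw [mul_pow, ← ENNReal.rpow_natCast, ← ENNReal.rpow_natCast, ← ENNReal.rpow_mul,
        ← ENNReal.rpow_mul]
      norm_num

/-- Young's inequality for L¹ * L²: Cauchy–Schwarz with respect to the measure k(z - w) dw splits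
off one factor ‖k‖₁, and Tonelli supplies the other. -/
lemma lintegral_conv_sq_le {f k : Cn d → ℝ≥0∞} (hf : AEMeasurable f) (hk : Measurable k) :
    ∫⁻ z, (∫⁻ w, f w * k (z - w)) ^ 2 ≤ (∫⁻ w, k w) ^ 2 * ∫⁻ w, f w ^ 2 := by
  wlog hf' : Measurable f generalizing f
  · have h := this (f := hf.mk f) hf.measurable_mk.aemeasurable hf.measurable_mk
    have e1 : ∀ z, ∫⁻ w, f w * k (z - w) = ∫⁻ w, hf.mk f w * k (z - w) := fun z =>
      lintegral_congr_ae (by filter_upwards [hf.ae_eq_mk] with w hw; rw [hw])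
    have e2 : ∫⁻ w, f w ^ 2 = ∫⁻ w, hf.mk f w ^ 2 :=
      lintegral_congr_ae (by filter_upwards [hf.ae_eq_mk] with w hw; rw [hw])
    simp only [e1, e2]
    exact h
  have hkz : ∀ z : Cn d, Measurable fun w => k (z - w) := fun z =>
    hk.comp (measurable_const.sub measurable_id)
  have h1 : ∀ z, (∫⁻ w, f w * k (z - w)) ^ 2 ≤ (∫⁻ w, k w) * ∫⁻ w, f w ^ 2 * k (z - w) := by
    intro z
    have h := sq_lintegral_mul_le (volume.withDensity fun w => k (z - w)) (f := f)
      (g := fun _ => 1) hf'.aemeasurable aemeasurable_const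
    simp only [mul_one, one_pow] at h
    rw [lintegral_withDensity_eq_lintegral_mul _ (hkz z) hf',
      lintegral_withDensity_eq_lintegral_mul _ (hkz z) (hf'.pow_const 2),
      lintegral_withDensity_eq_lintegral_mul _ (hkz z) measurable_const] at h
    simp only [Pi.mul_apply, mul_one, lintegral_sub_left_eq_self k z] at h
    simpa only [mul_comm] using h
  calc ∫⁻ z, (∫⁻ w, f w * k (z - w)) ^ 2
      ≤ ∫⁻ z, (∫⁻ w, k w) * ∫⁻ w, f w ^ 2 * k (z - w) := lintegral_mono h1
    _ = (∫⁻ w, k w) * ∫⁻ z, ∫⁻ w, f w ^ 2 * k (z - w) := by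
      rw [lintegral_const_mul]
      exact Measurable.lintegral_prod_right'
        (f := fun q : Cn d × Cn d => f q.2 ^ 2 * k (q.1 - q.2))
        (((hf'.comp measurable_snd).pow_const 2).mul (hk.comp (measurable_fst.sub measurable_snd)))
    _ = (∫⁻ w, k w) * ∫⁻ w, ∫⁻ z, f w ^ 2 * k (z - w) := by
      rw [lintegral_lintegral_swap]
      exact (((hf'.comp measurable_snd).pow_const 2).mul
        (hk.comp (measurable_fst.sub measurable_snd))).aemeasurable
    _ = (∫⁻ w, k w) ^ 2 * ∫⁻ w, f w ^ 2 := by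
      have : ∀ w, ∫⁻ z, f w ^ 2 * k (z - w) = f w ^ 2 * ∫⁻ w, k w := fun w => by
        rw [lintegral_const_mul _ (f := fun z => k (z - w)) (hk.comp (measurable_id.sub measurable_const)),
          lintegral_sub_right_eq_self k w]
      simp only [this]
      rw [lintegral_mul_const _ (hf'.pow_const 2)]
      ring

lemma aemeasurable_conv {f k : Cn d → ℝ≥0∞} (hf : AEMeasurable f) (hk : Measurable k) :
    Measurable fun z => ∫⁻ w, f w * k (z - w) := by
  have e1 : (fun z => ∫⁻ w, f w * k (z - w)) = fun z => ∫⁻ w, hf.mk f w * k (z - w) :=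
    funext fun z => lintegral_congr_ae (by filter_upwards [hf.ae_eq_mk] with w hw; rw [hw])
  rw [e1]
  exact Measurable.lintegral_prod_right'
        (f := fun q : Cn d × Cn d => hf.mk f q.2 * k (q.1 - q.2))
        ((hf.measurable_mk.comp measurable_snd).mul (hk.comp (measurable_fst.sub measurable_snd)))

lemma memLp_two_iff_lintegral {f : Cn d → ℂ} (hf : AEStronglyMeasurable f) :
    MemLp f 2 ↔ ∫⁻ z, ‖f z‖ₑ ^ 2 < ⊤ := by
  rw [MemLp, and_iff_right hf, eLpNorm_lt_top_iff_lintegral_rpow_enorm_lt_top (by simp) (by simp)]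
  simp

/-- Provides the absolute convergence behind each use of Fubini for pairings of an L² function with
the operators dominated by convolution. -/
lemma lintegral_mul_conv_lt_top {f g : Cn d → ℂ} (hf : MemLp f 2) (hg : MemLp g 2)
    {k : Cn d → ℝ≥0∞} (hk : Measurable k) (hk' : ∫⁻ w, k w ≠ ⊤) :
    ∫⁻ z, ‖g z‖ₑ * ∫⁻ w, ‖f w‖ₑ * k (z - w) < ⊤ := by
  have h1 := sq_lintegral_mul_le volume hg.1.enorm (aemeasurable_conv hf.1.enorm hk).aemeasurable
  have h2 := lintegral_conv_sq_le hf.1.enorm hk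
  have h3 : (∫⁻ z, ‖g z‖ₑ * ∫⁻ w, ‖f w‖ₑ * k (z - w)) ^ 2 < ⊤ :=
    h1.trans_lt (ENNReal.mul_lt_top ((memLp_two_iff_lintegral hg.1).1 hg)
      (h2.trans_lt (ENNReal.mul_lt_top (ENNReal.pow_lt_top hk'.lt_top)
        ((memLp_two_iff_lintegral hf.1).1 hf))))
  exact (ENNReal.pow_lt_top_iff.1 h3).resolve_right (by norm_num)

end Young

/-! ### The heat semigroup on `L²` -/

section Heat

open scoped ENNReal

variable {f g : Cn d → ℂ} {s t : ℝ}

lemma heat_congr_ae (h : f =ᵐ[volume] g) (t : ℝ) (z : Cn d) : heat t f z = heat t g z := by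
  rw [heat_eq, heat_eq]
  exact integral_congr_ae (by filter_upwards [h] with w hw; rw [hw])

/-- The values of `heat t f` depend only on the almost everywhere class of f. Replacing f by a
measurable representative therefore yields genuine joint measurability in (t, z), not merely up to
null sets. -/
lemma stronglyMeasurable_heat (hf : AEStronglyMeasurable f) :
    StronglyMeasurable fun q : ℝ × Cn d => heat q.1 f q.2 := by
  have e : (fun q : ℝ × Cn d => heat q.1 f q.2) = fun q : ℝ × Cn d =>
      ∫ w, hf.mk f w * twistedKernel q.1 q.2 w := by
    funext q
    rw [heat_congr_ae hf.ae_eq_mk, heat_eq]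
  rw [e]
  refine StronglyMeasurable.integral_prod_right' (f := fun p : (ℝ × Cn d) × Cn d =>
    hf.mk f p.2 * twistedKernel p.1.1 p.1.2 p.2) ?_
  refine (hf.stronglyMeasurable_mk.comp_measurable measurable_snd).mul ?_
  exact (Measurable.comp (g := fun q : ℝ × Cn d × Cn d => twistedKernel q.1 q.2.1 q.2.2)
    (f := fun p : (ℝ × Cn d) × Cn d => (p.1.1, p.1.2, p.2)) measurable_twistedKernel
    ((measurable_fst.comp measurable_fst).prodMk
      ((measurable_snd.comp measurable_fst).prodMk measurable_snd))).stronglyMeasurable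

lemma aestronglyMeasurable_heat (hf : AEStronglyMeasurable f) (t : ℝ) :
    AEStronglyMeasurable (heat t f) :=
  ((stronglyMeasurable_heat hf).comp_measurable
    (measurable_const.prodMk measurable_id : Measurable fun z : Cn d => (t, z))).aestronglyMeasurable

lemma measurable_enorm_heatKernel (t : ℝ) :
    Measurable fun z : Cn d => ENNReal.ofReal (heatKernel d t z) :=
  (continuous_heatKernel t).measurable.ennreal_ofReal

lemma lintegral_heatKernel (ht : 0 < t) :
    ∫⁻ z : Cn d, ENNReal.ofReal (heatKernel d t z) = ENNReal.ofReal ((Real.cosh t ^ d)⁻¹) := by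
  rw [← ofReal_integral_eq_lintegral_ofReal (integrable_heatKernel ht)
    (Filter.Eventually.of_forall fun z => (heatKernel_pos ht z).le), integral_heatKernel ht]

lemma enorm_twistedKernel (ht : 0 < t) (z w : Cn d) :
    ‖twistedKernel t z w‖ₑ = ENNReal.ofReal (heatKernel d t (z - w)) := by
  rw [← ofReal_norm, norm_twistedKernel ht]

lemma enorm_heat_le (ht : 0 < t) (z : Cn d) :
    ‖heat t f z‖ₑ ≤ ∫⁻ w, ‖f w‖ₑ * ENNReal.ofReal (heatKernel d t (z - w)) := by
  rw [heat_eq]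
  refine (enorm_integral_le_lintegral_enorm _).trans (le_of_eq ?_)
  simp only [enorm_mul, enorm_twistedKernel ht]

lemma lintegral_heat_sq_le (ht : 0 < t) (hf : AEStronglyMeasurable f) :
    ∫⁻ z, ‖heat t f z‖ₑ ^ 2 ≤ ENNReal.ofReal ((Real.cosh t ^ d)⁻¹) ^ 2 * ∫⁻ z, ‖f z‖ₑ ^ 2 := by
  rw [← lintegral_heatKernel ht]
  refine (lintegral_mono fun z => ?_).trans
    (lintegral_conv_sq_le hf.enorm (measurable_enorm_heatKernel t))
  gcongr
  exact enorm_heat_le ht z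

lemma memLp_heat (ht : 0 < t) (hf : MemLp f 2) : MemLp (heat t f) 2 := by
  rw [memLp_two_iff_lintegral (aestronglyMeasurable_heat hf.1 t)]
  exact (lintegral_heat_sq_le ht hf.1).trans_lt (ENNReal.mul_lt_top
    (ENNReal.pow_lt_top ENNReal.ofReal_lt_top) ((memLp_two_iff_lintegral hf.1).1 hf))

/-- `e^{-tL}` is symmetric on `L²`. -/
lemma integral_heat_mul_conj (ht : 0 < t) (hf : MemLp f 2) (hg : MemLp g 2) :
    ∫ z, heat t f z * conj (g z) = ∫ w, f w * conj (heat t g w) := by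
  have hint : Integrable (Function.uncurry fun z w : Cn d =>
      f w * twistedKernel t z w * conj (g z)) (volume.prod volume) := by
    have hm : AEStronglyMeasurable (Function.uncurry fun z w : Cn d =>
        f w * twistedKernel t z w * conj (g z)) (volume.prod volume) :=
      ((hf.1.comp_quasiMeasurePreserving Measure.quasiMeasurePreserving_snd).mul
        (continuous_twistedKernel t).aestronglyMeasurable).mul
        (Complex.continuous_conj.comp_aestronglyMeasurable
          (hg.1.comp_quasiMeasurePreserving Measure.quasiMeasurePreserving_fst))
    refine ⟨hm, ?_⟩
    rw [HasFiniteIntegral, lintegral_prod _ hm.enorm]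
    refine (le_of_eq ?_).trans_lt (lintegral_mul_conv_lt_top hf hg
      (measurable_enorm_heatKernel t) (by rw [lintegral_heatKernel ht]; simp))
    refine lintegral_congr fun z => ?_
    rw [← lintegral_const_mul' _ _ (by simp)]
    refine lintegral_congr fun w => ?_
    simp only [Function.uncurry_apply_pair, enorm_mul, enorm_twistedKernel ht, RCLike.enorm_conj]
    ring
  have h1 : ∀ z, heat t f z * conj (g z) = ∫ w, f w * twistedKernel t z w * conj (g z) := by
    intro z
    rw [heat_eq, integral_mul_const]
  have h2 : ∀ w, f w * conj (heat t g w) = ∫ z, f w * twistedKernel t z w * conj (g z) := by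
    intro w
    rw [heat_eq, ← integral_conj, ← integral_const_mul]
    congr 1 with z
    rw [map_mul, conj_twistedKernel]
    ring
  simp only [h1, h2]
  exact integral_integral_swap hint

/-- The semigroup property. -/
lemma heat_heat (hs : 0 < s) (ht : 0 < t) (hf : AEStronglyMeasurable f) {M : ℝ}
    (hM : ∀ z, ‖f z‖ ≤ M) (z : Cn d) : heat s (heat t f) z = heat (s + t) f z := by
  -- Boundedness of f reduces Fubini to the integrability of the product of two heat kernels; this
  -- suffices for the test functions to which the semigroup law is applied.
  have hint : Integrable (Function.uncurry fun w v : Cn d =>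
      f v * (twistedKernel s z w * twistedKernel t w v)) (volume.prod volume) := by
    have h1 : Integrable (fun q : Cn d × Cn d =>
        heatKernel d s (z - q.1) * heatKernel d t (q.1 - q.2)) (volume.prod volume) := by
      rw [integrable_prod_iff]
      · refine ⟨Filter.Eventually.of_forall fun w =>
          ((integrable_heatKernel ht).comp_sub_left w).const_mul (heatKernel d s (z - w)), ?_⟩
        have : ∀ w : Cn d, ∫ v, ‖heatKernel d s (z - w) * heatKernel d t (w - v)‖ =
            heatKernel d s (z - w) * ∫ v : Cn d, heatKernel d t v := by
          intro w
          simp only [norm_mul, Real.norm_of_nonneg (heatKernel_pos hs _).le,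
            Real.norm_of_nonneg (heatKernel_pos ht _).le, integral_const_mul]
          rw [integral_sub_left_eq_self (heatKernel d t)]
        simp only [this]
        exact ((integrable_heatKernel hs).comp_sub_left z).mul_const _
      · exact Continuous.aestronglyMeasurable (by
          have h1 := continuous_heatKernel (d := d) s
          have h2 := continuous_heatKernel (d := d) t
          fun_prop)
    have h2 := (h1.const_mul M)
    refine h2.mono' ?_ (Filter.Eventually.of_forall fun q => ?_)
    · refine (hf.comp_quasiMeasurePreserving Measure.quasiMeasurePreserving_snd).mul ?_
      refine Continuous.aestronglyMeasurable ?_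
      exact ((continuous_twistedKernel s).comp (continuous_const.prodMk continuous_fst)).mul
        (continuous_twistedKernel t)
    · simp only [Function.uncurry_def, norm_mul, norm_twistedKernel hs, norm_twistedKernel ht]
      exact mul_le_mul_of_nonneg_right (hM _)
        (mul_nonneg (heatKernel_pos hs _).le (heatKernel_pos ht _).le)
  have h1 : ∀ w, heat t f w * twistedKernel s z w =
      ∫ v, f v * (twistedKernel s z w * twistedKernel t w v) := by
    intro w
    rw [heat_eq, ← integral_mul_const]
    congr 1 with v
    ring
  rw [heat_eq s]
  simp only [h1]
  rw [integral_integral_swap hint, heat_eq]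
  congr 1 with v
  rw [integral_const_mul, integral_twistedKernel_mul hs ht]

end Heat

end SpecialHermite

namespace SpecialHermite

variable {d : ℕ}

/-! ### The operator `L^{-1/2}` on `L²` -/

section InvSqrt

open scoped ENNReal

variable {f g : Cn d → ℂ}

/-- The convolution kernel dominating `L^{-1/2}`. -/
noncomputable def invSqrtKernel (d : ℕ) (w : Cn d) : ℝ≥0∞ :=
  ∫⁻ t in Ioi (0 : ℝ), ENNReal.ofReal (heatKernel d t w) * ENNReal.ofReal (t ^ (-(1 / 2) : ℝ))

lemma measurable_ofReal_rpow : Measurable fun t : ℝ => ENNReal.ofReal (t ^ (-(1 / 2) : ℝ)) :=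
  (measurable_id.pow_const _).ennreal_ofReal

lemma measurable_invSqrtKernel : Measurable (invSqrtKernel d) :=
  Measurable.lintegral_prod_right' (f := fun q : Cn d × ℝ =>
    ENNReal.ofReal (heatKernel d q.2 q.1) * ENNReal.ofReal (q.2 ^ (-(1 / 2) : ℝ)))
    ((measurable_heatKernel.comp measurable_swap).ennreal_ofReal.mul
      (measurable_ofReal_rpow.comp measurable_snd))

lemma inv_cosh_le (t : ℝ) : (Real.cosh t)⁻¹ ≤ 2 * Real.exp (-t) := by
  rw [inv_le_comm₀ (Real.cosh_pos t) (by positivity), Real.exp_neg, mul_inv, inv_inv,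
    Real.cosh_eq]
  have := Real.exp_pos (-t)
  linarith

/-- By Tonelli the total mass is ∫ (cosh t)^{-d} t^{-1/2} dt. As d ≥ 1 the first factor is at most
2e^{-t}, so a Gamma integral at 1/2 dominates. -/
lemma lintegral_invSqrtKernel_ne_top [NeZero d] : ∫⁻ w, invSqrtKernel d w ≠ ⊤ := by
  have h1 : ∫⁻ w, invSqrtKernel d w = ∫⁻ t in Ioi (0 : ℝ),
      ENNReal.ofReal ((Real.cosh t ^ d)⁻¹) * ENNReal.ofReal (t ^ (-(1 / 2) : ℝ)) := by
    unfold invSqrtKernel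
    rw [lintegral_lintegral_swap]
    · refine setLIntegral_congr_fun measurableSet_Ioi fun t ht => ?_
      rw [lintegral_mul_const _ (measurable_enorm_heatKernel t), lintegral_heatKernel ht]
    · exact ((measurable_heatKernel.comp measurable_swap).ennreal_ofReal.mul
        (measurable_ofReal_rpow.comp measurable_snd)).aemeasurable
  have h2 := (Real.GammaIntegral_convergent (s := 1 / 2) (by norm_num)).const_mul 2
  have h3 : ∫⁻ t in Ioi (0 : ℝ), ENNReal.ofReal (2 * (Real.exp (-t) * t ^ ((1 / 2 : ℝ) - 1))) < ⊤ :=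
    h2.lintegral_lt_top
  rw [h1]
  refine (lt_of_le_of_lt (setLIntegral_mono' measurableSet_Ioi fun t ht => ?_) h3).ne
  have hc := Real.one_le_cosh t
  rw [← ENNReal.ofReal_mul (by positivity)]
  refine ENNReal.ofReal_le_ofReal ?_
  rw [show ((1 / 2 : ℝ) - 1) = -(1 / 2) by norm_num, ← mul_assoc]
  refine mul_le_mul_of_nonneg_right ?_ (Real.rpow_nonneg (le_of_lt ht) _)
  refine le_trans ?_ (inv_cosh_le t)
  exact inv_anti₀ (by linarith) (le_self_pow₀ hc (NeZero.ne d))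

lemma lintegral_heat_majorant (hf : AEStronglyMeasurable f) (z : Cn d) :
    ∫⁻ t in Ioi (0 : ℝ), (∫⁻ w, ‖f w‖ₑ * ENNReal.ofReal (heatKernel d t (z - w))) *
      ENNReal.ofReal (t ^ (-(1 / 2) : ℝ)) = ∫⁻ w, ‖f w‖ₑ * invSqrtKernel d (z - w) := by
  have hk : Measurable fun q : ℝ × Cn d => ENNReal.ofReal (heatKernel d q.1 (z - q.2)) :=
    (Measurable.comp (g := fun q : ℝ × Cn d => heatKernel d q.1 q.2)
      (f := fun q : ℝ × Cn d => (q.1, z - q.2)) measurable_heatKernel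
      (measurable_fst.prodMk (measurable_const.sub measurable_snd))).ennreal_ofReal
  calc ∫⁻ t in Ioi (0 : ℝ), (∫⁻ w, ‖f w‖ₑ * ENNReal.ofReal (heatKernel d t (z - w))) *
      ENNReal.ofReal (t ^ (-(1 / 2) : ℝ))
      = ∫⁻ t in Ioi (0 : ℝ), ∫⁻ w, ‖f w‖ₑ * (ENNReal.ofReal (heatKernel d t (z - w)) *
        ENNReal.ofReal (t ^ (-(1 / 2) : ℝ))) := by
        congr 1 with t
        rw [← lintegral_mul_const' _ _ (by simp)]
        simp only [mul_assoc]
    _ = ∫⁻ w, ∫⁻ t in Ioi (0 : ℝ), ‖f w‖ₑ * (ENNReal.ofReal (heatKernel d t (z - w)) *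
        ENNReal.ofReal (t ^ (-(1 / 2) : ℝ))) := by
        rw [lintegral_lintegral_swap]
        exact (hf.enorm.comp_quasiMeasurePreserving Measure.quasiMeasurePreserving_snd).mul
          (hk.mul (measurable_ofReal_rpow.comp measurable_fst)).aemeasurable
    _ = _ := by
        congr 1 with w
        rw [lintegral_const_mul' _ _ (by simp), invSqrtKernel]

lemma enorm_rpow_ofReal (t : ℝ) (ht : 0 < t) :
    ‖((t ^ (-(1 / 2) : ℝ) : ℝ) : ℂ)‖ₑ = ENNReal.ofReal (t ^ (-(1 / 2) : ℝ)) := by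
  rw [← ofReal_norm, Complex.norm_real, Real.norm_of_nonneg (Real.rpow_nonneg ht.le _)]

lemma lintegral_heat_le (hf : AEStronglyMeasurable f) (z : Cn d) :
    ∫⁻ t in Ioi (0 : ℝ), ‖heat t f z * ((t ^ (-(1 / 2) : ℝ) : ℝ) : ℂ)‖ₑ ≤
      ∫⁻ w, ‖f w‖ₑ * invSqrtKernel d (z - w) := by
  rw [← lintegral_heat_majorant hf]
  refine setLIntegral_mono' measurableSet_Ioi fun t ht => ?_
  rw [enorm_mul, enorm_rpow_ofReal t ht]
  gcongr
  exact enorm_heat_le ht z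

lemma aestronglyMeasurable_invSqrt (hf : AEStronglyMeasurable f) :
    AEStronglyMeasurable (invSqrt f) := by
  refine StronglyMeasurable.aestronglyMeasurable ?_
  refine stronglyMeasurable_const.mul ?_
  refine StronglyMeasurable.integral_prod_right' (f := fun q : Cn d × ℝ =>
    heat q.2 f q.1 * ((q.2 ^ (-(1 / 2) : ℝ) : ℝ) : ℂ)) ?_
  refine ((stronglyMeasurable_heat hf).comp_measurable measurable_swap).mul ?_
  exact (Complex.measurable_ofReal.comp
    (measurable_snd.pow_const (-(1 / 2) : ℝ))).stronglyMeasurable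

lemma memLp_invSqrt [NeZero d] (hf : MemLp f 2) : MemLp (invSqrt f) 2 := by
  rw [memLp_two_iff_lintegral (aestronglyMeasurable_invSqrt hf.1)]
  have h1 : ∀ z, ‖invSqrt f z‖ₑ ^ 2 ≤ ‖(((Real.sqrt Real.pi)⁻¹ : ℝ) : ℂ)‖ₑ ^ 2 *
      (∫⁻ w, ‖f w‖ₑ * invSqrtKernel d (z - w)) ^ 2 := by
    intro z
    rw [← mul_pow, invSqrt, enorm_mul]
    gcongr
    exact (enorm_integral_le_lintegral_enorm _).trans (lintegral_heat_le hf.1 z)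
  refine (lintegral_mono h1).trans_lt ?_
  rw [lintegral_const_mul' _ _ (by simp)]
  refine ENNReal.mul_lt_top (by simp) ?_
  refine (lintegral_conv_sq_le hf.1.enorm measurable_invSqrtKernel).trans_lt ?_
  exact ENNReal.mul_lt_top (ENNReal.pow_lt_top lintegral_invSqrtKernel_ne_top.lt_top)
    ((memLp_two_iff_lintegral hf.1).1 hf)

/-- Convolution of |f| with the integrable majorant kernel is in L², hence finite almost everywhere,
and its finiteness at z is precisely absolute convergence of the double integral there. -/
theorem invSqrtDefined_of_memLp [NeZero d] (hf : MemLp f 2) : InvSqrtDefined f := by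
  refine ⟨?_, (memLp_invSqrt hf).locallyIntegrable (by norm_num)⟩
  have h1 : ∫⁻ z, (∫⁻ w, ‖f w‖ₑ * invSqrtKernel d (z - w)) ^ 2 < ⊤ :=
    (lintegral_conv_sq_le hf.1.enorm measurable_invSqrtKernel).trans_lt
      (ENNReal.mul_lt_top (ENNReal.pow_lt_top lintegral_invSqrtKernel_ne_top.lt_top)
        ((memLp_two_iff_lintegral hf.1).1 hf))
  filter_upwards [ae_lt_top ((aemeasurable_conv hf.1.enorm measurable_invSqrtKernel).pow_const 2)
    h1.ne] with z hz
  have hz' : ∫⁻ w, ‖f w‖ₑ * invSqrtKernel d (z - w) < ⊤ :=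
    (ENNReal.pow_lt_top_iff.1 hz).resolve_right (by norm_num)
  have hfz : AEStronglyMeasurable fun w => f (z - w) :=
    hf.1.comp_quasiMeasurePreserving (quasiMeasurePreserving_sub_left volume z)
  have hp : Measurable fun q : ℝ × Cn d => dotConj z q.2 :=
    continuous_dotConj.measurable.comp (measurable_const.prodMk measurable_snd)
  have hm : AEStronglyMeasurable (fun q : ℝ × Cn d => f (z - q.2) * (heatKernel d q.1 q.2 : ℂ) *
      Complex.exp (Complex.I / 2 * ((dotConj z q.2).im : ℂ)) *
      ((q.1 ^ (-(1 / 2) : ℝ) : ℝ) : ℂ)) ((volume.restrict (Ioi (0 : ℝ))).prod volume) := by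
    refine ((AEStronglyMeasurable.mul ?_ ?_).mul ?_).mul ?_
    · exact hfz.comp_quasiMeasurePreserving Measure.quasiMeasurePreserving_snd
    · exact measurable_heatKernel.complex_ofReal.aestronglyMeasurable
    · exact (Complex.measurable_exp.comp ((Complex.measurable_ofReal.comp
        (Complex.measurable_im.comp hp)).const_mul _)).aestronglyMeasurable
    · exact (Complex.measurable_ofReal.comp
        (measurable_fst.pow_const (-(1 / 2) : ℝ))).aestronglyMeasurable
  refine ⟨hm, ?_⟩
  rw [HasFiniteIntegral, lintegral_prod _ hm.enorm]
  refine (le_of_eq ?_).trans_lt hz'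
  rw [← lintegral_heat_majorant hf.1]
  refine setLIntegral_congr_fun measurableSet_Ioi fun t ht => ?_
  simp only
  rw [← lintegral_mul_const' _ _ (by simp), ← lintegral_sub_left_eq_self _ z]
  refine lintegral_congr fun w => ?_
  rw [enorm_mul, enorm_mul, enorm_mul, enorm_rpow_ofReal t ht, sub_sub_cancel]
  congr 1
  have h1 : ‖Complex.exp (Complex.I / 2 * ((dotConj z (z - w)).im : ℂ))‖ₑ = 1 := by
    rw [← ofReal_norm, norm_exp_I_mul, ENNReal.ofReal_one]
  rw [h1, mul_one]
  congr 1
  rw [← ofReal_norm, Complex.norm_real, Real.norm_of_nonneg (heatKernel_pos ht _).le]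

/-- Pairing with `L^{-1/2} f` as an integral of pairings with `e^{-tL} f`. -/
lemma integral_invSqrt_mul_conj [NeZero d] (hf : MemLp f 2) (hg : MemLp g 2) :
    ∫ z, invSqrt f z * conj (g z) = (((Real.sqrt Real.pi)⁻¹ : ℝ) : ℂ) *
      ∫ t in Ioi (0 : ℝ), ((t ^ (-(1 / 2) : ℝ) : ℝ) : ℂ) * ∫ z, heat t f z * conj (g z) := by
  have hint : Integrable (Function.uncurry fun (z : Cn d) (t : ℝ) =>
      heat t f z * ((t ^ (-(1 / 2) : ℝ) : ℝ) : ℂ) * conj (g z))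
      (volume.prod (volume.restrict (Ioi (0 : ℝ)))) := by
    have hm : AEStronglyMeasurable (Function.uncurry fun (z : Cn d) (t : ℝ) =>
      heat t f z * ((t ^ (-(1 / 2) : ℝ) : ℝ) : ℂ) * conj (g z))
      (volume.prod (volume.restrict (Ioi (0 : ℝ)))) := by
      refine (AEStronglyMeasurable.mul ?_ ?_).mul ?_
      · exact ((stronglyMeasurable_heat hf.1).comp_measurable measurable_swap).aestronglyMeasurable
      · exact (Complex.measurable_ofReal.comp
          (measurable_snd.pow_const (-(1 / 2) : ℝ))).aestronglyMeasurable
      · exact Complex.continuous_conj.comp_aestronglyMeasurable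
          (hg.1.comp_quasiMeasurePreserving Measure.quasiMeasurePreserving_fst)
    refine ⟨hm, ?_⟩
    rw [HasFiniteIntegral, lintegral_prod _ hm.enorm]
    refine (lintegral_mono fun z => ?_).trans_lt (lintegral_mul_conv_lt_top hf hg
      measurable_invSqrtKernel lintegral_invSqrtKernel_ne_top)
    simp only [Function.uncurry_apply_pair]
    simp only [enorm_mul _ (conj (g z)), RCLike.enorm_conj]
    rw [lintegral_mul_const' _ _ (by simp), mul_comm]
    gcongr
    exact lintegral_heat_le hf.1 z
  have h1 : ∀ z, invSqrt f z * conj (g z) = (((Real.sqrt Real.pi)⁻¹ : ℝ) : ℂ) *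
      ∫ t in Ioi (0 : ℝ), heat t f z * ((t ^ (-(1 / 2) : ℝ) : ℝ) : ℂ) * conj (g z) := by
    intro z
    rw [integral_mul_const, invSqrt, mul_assoc]
  simp only [h1, integral_const_mul]
  rw [integral_integral_swap hint]
  congr 2 with t
  rw [← integral_const_mul]
  congr 1 with z
  ring

/-- `L^{-1/2}` is symmetric on `L²`. -/
lemma integral_invSqrt_mul_conj_comm [NeZero d] (hf : MemLp f 2) (hg : MemLp g 2) :
    ∫ z, invSqrt f z * conj (g z) = ∫ z, f z * conj (invSqrt g z) := by
  have h1 : ∫ z, f z * conj (invSqrt g z) = conj (∫ z, invSqrt g z * conj (f z)) := by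
    rw [← integral_conj]
    congr 1 with z
    rw [map_mul, Complex.conj_conj, mul_comm]
  rw [h1, integral_invSqrt_mul_conj hf hg, integral_invSqrt_mul_conj hg hf, map_mul,
    Complex.conj_ofReal, ← integral_conj]
  congr 1
  refine setIntegral_congr_fun measurableSet_Ioi fun t ht => ?_
  rw [integral_heat_mul_conj ht hf hg, map_mul, Complex.conj_ofReal, ← integral_conj]
  congr 2 with z
  rw [map_mul, Complex.conj_conj, mul_comm]

end InvSqrt

end SpecialHermite

namespace SpecialHermite

variable {d : ℕ}

/-! ### The norm of `L^{-1/2} χ` in terms of the energy `⟨e^{-uL} χ, χ⟩` -/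

section Energy

open scoped ENNReal

variable {χ : Cn d → ℂ}

/-- `‖e^{-uL/2} χ‖²`, that is `⟨e^{-uL} χ, χ⟩`. -/
noncomputable def energy (χ : Cn d → ℂ) (u : ℝ) : ℝ≥0∞ := ∫⁻ z, ‖heat (u / 2) χ z‖ₑ ^ 2

lemma measurable_energy (hχ : AEStronglyMeasurable χ) : Measurable (energy χ) :=
  Measurable.lintegral_prod_right' (f := fun q : ℝ × Cn d => ‖heat (q.1 / 2) χ q.2‖ₑ ^ 2)
    (((stronglyMeasurable_heat hχ).comp_measurable
      (g := fun q : ℝ × Cn d => (q.1 / 2, q.2))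
      ((measurable_fst.div_const 2).prodMk measurable_snd)).enorm.pow_const 2)

lemma enorm_integral_mul_conj_self_le (g : Cn d → ℂ) :
    ‖∫ z, g z * conj (g z)‖ₑ ≤ ∫⁻ z, ‖g z‖ₑ ^ 2 := by
  refine (enorm_integral_le_lintegral_enorm _).trans (le_of_eq ?_)
  simp only [enorm_mul, RCLike.enorm_conj, sq]

lemma integral_mul_conj_self (g : Cn d → ℂ) :
    ∫ z, g z * conj (g z) = ((∫ z, ‖g z‖ ^ 2 : ℝ) : ℂ) := by
  rw [← integral_complex_ofReal]
  congr 1 with z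
  rw [Complex.mul_conj, Complex.normSq_eq_norm_sq]

lemma ofReal_integral_norm_sq {g : Cn d → ℂ} (hg : MemLp g 2) :
    ENNReal.ofReal (∫ z, ‖g z‖ ^ 2) = ∫⁻ z, ‖g z‖ₑ ^ 2 := by
  rw [ofReal_integral_eq_lintegral_ofReal (hg.integrable_norm_pow (by simp))
    (Filter.Eventually.of_forall fun z => sq_nonneg _)]
  refine lintegral_congr fun z => ?_
  rw [ENNReal.ofReal_pow (norm_nonneg _), ofReal_norm]

lemma lintegral_le_enorm_integral_mul_conj_self {g : Cn d → ℂ} (hg : MemLp g 2) :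
    ∫⁻ z, ‖g z‖ₑ ^ 2 ≤ ‖∫ z, g z * conj (g z)‖ₑ := by
  rw [integral_mul_conj_self, ← ofReal_integral_norm_sq hg, ← ofReal_norm, Complex.norm_real]
  exact ENNReal.ofReal_le_ofReal (le_abs_self _)

lemma integral_heat_mul_conj_heat {s t : ℝ} (hs : 0 < s) (ht : 0 < t) (hχ : MemLp χ 2) {M : ℝ}
    (hM : ∀ z, ‖χ z‖ ≤ M) :
    ∫ z, heat s χ z * conj (heat t χ z) = ∫ z, heat (s + t) χ z * conj (χ z) := by
  rw [← integral_heat_mul_conj ht (memLp_heat hs hχ) hχ]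
  simp only [heat_heat ht hs hχ.1 hM, add_comm t s]

/-- By symmetry and the semigroup law the pairing depends only on s + t. Splitting the time into two
equal halves turns it into a squared norm. -/
lemma enorm_integral_heat_mul_conj_heat_le {s t : ℝ} (hs : 0 < s) (ht : 0 < t) (hχ : MemLp χ 2)
    {M : ℝ} (hM : ∀ z, ‖χ z‖ ≤ M) :
    ‖∫ z, heat s χ z * conj (heat t χ z)‖ₑ ≤ energy χ (s + t) := by
  have h2 : 0 < (s + t) / 2 := by linarith
  rw [integral_heat_mul_conj_heat hs ht hχ hM, ← add_halves (s + t),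
    ← integral_heat_mul_conj_heat h2 h2 hχ hM, add_halves]
  exact enorm_integral_mul_conj_self_le _

lemma ofReal_inv_cosh_sq_le [NeZero d] {x : ℝ} :
    ENNReal.ofReal ((Real.cosh x ^ d)⁻¹) ^ 2 ≤ ENNReal.ofReal (4 * Real.exp (-(2 * x))) := by
  rw [← ENNReal.ofReal_pow (by have := Real.cosh_pos x; positivity)]
  refine ENNReal.ofReal_le_ofReal ?_
  have hc := Real.one_le_cosh x
  have h1 : (Real.cosh x ^ d)⁻¹ ≤ 2 * Real.exp (-x) :=
    (inv_anti₀ (by linarith) (le_self_pow₀ hc (NeZero.ne d))).trans (inv_cosh_le x)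
  calc ((Real.cosh x ^ d)⁻¹) ^ 2 ≤ (2 * Real.exp (-x)) ^ 2 := by
        gcongr
    _ = 4 * Real.exp (-(2 * x)) := by
        rw [mul_pow, ← Real.exp_nat_mul]; norm_num

/-- The remaining time (u-v)/2 is spent by a semigroup operator whose norm is bounded by the mass of
the kernel. This gives monotonicity as well as exponential decay. -/
lemma energy_le_mul {u v : ℝ} (hv : 0 < v) (huv : v < u) (hχ : MemLp χ 2) {M : ℝ}
    (hM : ∀ z, ‖χ z‖ ≤ M) :
    energy χ u ≤ ENNReal.ofReal ((Real.cosh ((u - v) / 2) ^ d)⁻¹) ^ 2 * energy χ v := by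
  have h1 : ∀ z, heat (u / 2) χ z = heat ((u - v) / 2) (heat (v / 2) χ) z := fun z => by
    rw [heat_heat (by linarith) (by linarith) hχ.1 hM]
    congr 1; ring
  simp only [energy, h1]
  exact lintegral_heat_sq_le (by linarith) (aestronglyMeasurable_heat hχ.1 _)

lemma energy_anti {u v : ℝ} (hv : 0 < v) (huv : v ≤ u) (hχ : MemLp χ 2) {M : ℝ}
    (hM : ∀ z, ‖χ z‖ ≤ M) : energy χ u ≤ energy χ v := by
  rcases huv.eq_or_lt with rfl | huv
  · exact le_rfl
  refine (energy_le_mul hv huv hχ hM).trans ?_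
  refine mul_le_of_le_one_left' ?_
  refine pow_le_one' ?_ 2
  rw [← ENNReal.ofReal_one]
  exact ENNReal.ofReal_le_ofReal (inv_le_one_of_one_le₀ (one_le_pow₀ (Real.one_le_cosh _)))

lemma lintegral_rpow_Ioc {t : ℝ} (ht : 0 < t) :
    ∫⁻ s in Ioc 0 t, ENNReal.ofReal (s ^ (-(1 / 2) : ℝ)) =
      ENNReal.ofReal (2 * t ^ (1 / 2 : ℝ)) := by
  have h1 : IntegrableOn (fun s : ℝ => s ^ (-(1 / 2) : ℝ)) (Ioc 0 t) :=
    (intervalIntegrable_iff_integrableOn_Ioc_of_le ht.le).1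
      (intervalIntegral.intervalIntegrable_rpow' (by norm_num))
  rw [← ofReal_integral_eq_lintegral_ofReal h1
    ((ae_restrict_mem measurableSet_Ioc).mono fun s hs => Real.rpow_nonneg hs.1.le _),
    ← intervalIntegral.integral_of_le ht.le, integral_rpow (Or.inl (by norm_num))]
  congr 1
  norm_num
  ring

/-- Since e decreases, e(s+t) is at most e(max(s,t)). On s ≤ t the inner integral of s^{-1/2} is
2t^{1/2}, which cancels t^{-1/2} and leaves 2e(t); the other half is symmetric. -/
lemma lintegral_lintegral_rpow_mul_le {e : ℝ → ℝ≥0∞} (he : Measurable e)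
    (hanti : ∀ u v, 0 < v → v ≤ u → e u ≤ e v) :
    ∫⁻ t in Ioi (0 : ℝ), ENNReal.ofReal (t ^ (-(1 / 2) : ℝ)) *
      ∫⁻ s in Ioi (0 : ℝ), ENNReal.ofReal (s ^ (-(1 / 2) : ℝ)) * e (s + t) ≤
      4 * ∫⁻ t in Ioi (0 : ℝ), e t := by
  set a : ℝ → ℝ≥0∞ := fun t => ENNReal.ofReal (t ^ (-(1 / 2) : ℝ)) with ha
  have ham : Measurable a := measurable_ofReal_rpow
  let g : ℝ → ℝ → ℝ≥0∞ := fun t s => (Iic t).indicator (fun s => a t * (a s * e t)) s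
  have hg : ∀ t, 0 < t → ∫⁻ s in Ioi (0 : ℝ), g t s = 2 * e t := by
    intro t ht
    simp only [g]
    rw [lintegral_indicator measurableSet_Iic, Measure.restrict_restrict measurableSet_Iic,
      Iic_inter_Ioi, lintegral_const_mul _ (ham.mul_const _), lintegral_mul_const _ ham,
      lintegral_rpow_Ioc ht, ← mul_assoc, ha]
    simp only
    rw [← ENNReal.ofReal_mul (Real.rpow_nonneg ht.le _)]
    congr 1
    rw [mul_left_comm, ← Real.rpow_add ht]
    norm_num
  have hgm : Measurable (Function.uncurry g) := by
    have : Function.uncurry g = {q : ℝ × ℝ | q.2 ≤ q.1}.indicator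
        fun q => a q.1 * (a q.2 * e q.1) := by
      funext q
      simp only [g, Function.uncurry_def, Set.indicator, mem_Iic, mem_ofPred_eq]
    rw [this]
    exact Measurable.indicator ((ham.comp measurable_fst).mul
      ((ham.comp measurable_snd).mul (he.comp measurable_fst)))
      (measurableSet_le measurable_snd measurable_fst)
  have hle : ∀ t, 0 < t → ∀ s, 0 < s → a t * (a s * e (s + t)) ≤ g t s + g s t := by
    intro t ht s hs
    rcases le_total s t with h | h
    · refine le_add_right ?_
      simp only [g]
      rw [Set.indicator_of_mem (by exact h)]
      gcongr
      exact hanti _ _ ht (by linarith)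
    · refine le_add_left ?_
      simp only [g]
      rw [Set.indicator_of_mem (by exact h), mul_left_comm]
      gcongr
      exact hanti _ _ hs (by linarith)
  calc ∫⁻ t in Ioi (0 : ℝ), a t * ∫⁻ s in Ioi (0 : ℝ), a s * e (s + t)
      ≤ ∫⁻ t in Ioi (0 : ℝ), ((∫⁻ s in Ioi (0 : ℝ), g t s) + ∫⁻ s in Ioi (0 : ℝ), g s t) := by
        refine setLIntegral_mono' measurableSet_Ioi fun t ht => ?_
        rw [← lintegral_const_mul' _ _ (by simp [ha]), ← lintegral_add_left
          (f := fun s => g t s)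
          (hgm.comp (measurable_const.prodMk measurable_id : Measurable fun s : ℝ => (t, s)))]
        exact setLIntegral_mono' measurableSet_Ioi fun s hs => hle t ht s hs
    _ = (∫⁻ t in Ioi (0 : ℝ), ∫⁻ s in Ioi (0 : ℝ), g t s) +
        ∫⁻ t in Ioi (0 : ℝ), ∫⁻ s in Ioi (0 : ℝ), g s t :=
        lintegral_add_left (hgm.lintegral_prod_right') _
    _ = (∫⁻ t in Ioi (0 : ℝ), ∫⁻ s in Ioi (0 : ℝ), g t s) +
        ∫⁻ t in Ioi (0 : ℝ), ∫⁻ s in Ioi (0 : ℝ), g t s := by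
        congr 1
        exact lintegral_lintegral_swap (hgm.comp measurable_swap).aemeasurable
    _ = 4 * ∫⁻ t in Ioi (0 : ℝ), e t := by
        rw [setLIntegral_congr_fun measurableSet_Ioi hg, lintegral_const_mul _ he, ← two_mul,
          ← mul_assoc]
        norm_num

/-- By monotonicity the energy at time 1 is below its integral over (0, 1]. Beyond time 1 it decays
like 4e^{-(u-1)} times that value, so the tail costs a factor 4. -/
lemma lintegral_energy_le [NeZero d] (hχ : MemLp χ 2) {M : ℝ} (hM : ∀ z, ‖χ z‖ ≤ M) :
    ∫⁻ u in Ioi (0 : ℝ), energy χ u ≤ 5 * ∫⁻ u in Ioc (0 : ℝ) 1, energy χ u := by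
  have h1 : energy χ 1 ≤ ∫⁻ u in Ioc (0 : ℝ) 1, energy χ u := by
    calc energy χ 1 = ∫⁻ _ in Ioc (0 : ℝ) 1, energy χ 1 := by simp
      _ ≤ _ := setLIntegral_mono' measurableSet_Ioc fun u hu => energy_anti hu.1 hu.2 hχ hM
  have h2 : ∫⁻ u in Ioi (1 : ℝ), energy χ u ≤ 4 * energy χ 1 := by
    have h3 : ∫⁻ u in Ioi (1 : ℝ), ENNReal.ofReal (4 * Real.exp (-(u - 1))) = 4 := by
      have e : ∀ u : ℝ, 4 * Real.exp (-(u - 1)) = 4 * Real.exp 1 * Real.exp (-u) := fun u => by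
        rw [mul_assoc, ← Real.exp_add]; congr 2; ring
      simp only [e]
      rw [← ofReal_integral_eq_lintegral_ofReal ((integrableOn_exp_neg_Ioi 1).const_mul _)
        (Filter.Eventually.of_forall fun u => by positivity), integral_const_mul,
        integral_exp_neg_Ioi, mul_assoc, ← Real.exp_add]
      norm_num
    calc ∫⁻ u in Ioi (1 : ℝ), energy χ u
        ≤ ∫⁻ u in Ioi (1 : ℝ), ENNReal.ofReal (4 * Real.exp (-(u - 1))) * energy χ 1 := by
          refine setLIntegral_mono' measurableSet_Ioi fun u hu => ?_
          refine (energy_le_mul one_pos hu hχ hM).trans ?_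
          gcongr
          refine ofReal_inv_cosh_sq_le.trans (le_of_eq ?_)
          congr 4
          ring
      _ = 4 * energy χ 1 := by rw [lintegral_mul_const _ (by fun_prop), h3]
  rw [← Ioc_union_Ioi_eq_Ioi (zero_le_one' ℝ),
    lintegral_union measurableSet_Ioi (Ioc_disjoint_Ioi le_rfl)]
  calc _ ≤ (∫⁻ u in Ioc (0 : ℝ) 1, energy χ u) + 4 * ∫⁻ u in Ioc (0 : ℝ) 1, energy χ u := by
        gcongr
        exact h2.trans (by gcongr)
    _ = _ := by ring

lemma enorm_inv_sqrt_pi_le : ‖(((Real.sqrt Real.pi)⁻¹ : ℝ) : ℂ)‖ₑ ≤ 1 := by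
  rw [← ofReal_norm, Complex.norm_real, Real.norm_of_nonneg (by positivity), ← ENNReal.ofReal_one]
  refine ENNReal.ofReal_le_ofReal (inv_le_one_of_one_le₀ ?_)
  rw [Real.one_le_sqrt]
  linarith [Real.pi_gt_three]

/-- `‖L^{-1/2} χ‖²` is controlled by `⟨e^{-uL} χ, χ⟩` for `0 < u ≤ 1`. -/
lemma lintegral_invSqrt_sq_le [NeZero d] (hχ : MemLp χ 2) {M : ℝ} (hM : ∀ z, ‖χ z‖ ≤ M) :
    ∫⁻ z, ‖invSqrt χ z‖ₑ ^ 2 ≤ 20 * ∫⁻ u in Ioc (0 : ℝ) 1, energy χ u := by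
  have hG := memLp_invSqrt hχ
  have hpair : ∀ {g : Cn d → ℂ}, MemLp g 2 → ‖∫ z, invSqrt χ z * conj (g z)‖ₑ ≤
      ∫⁻ t in Ioi (0 : ℝ), ENNReal.ofReal (t ^ (-(1 / 2) : ℝ)) *
        ‖∫ z, heat t χ z * conj (g z)‖ₑ := by
    intro g hg
    rw [integral_invSqrt_mul_conj hχ hg, enorm_mul]
    refine (mul_le_of_le_one_left' enorm_inv_sqrt_pi_le).trans ?_
    refine (enorm_integral_le_lintegral_enorm _).trans (le_of_eq ?_)
    refine setLIntegral_congr_fun measurableSet_Ioi fun t ht => ?_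
    rw [enorm_mul, enorm_rpow_ofReal t ht]
  have h1 : ∀ t, 0 < t → ‖∫ z, heat t χ z * conj (invSqrt χ z)‖ₑ ≤
      ∫⁻ s in Ioi (0 : ℝ), ENNReal.ofReal (s ^ (-(1 / 2) : ℝ)) * energy χ (s + t) := by
    intro t ht
    have e : ∫ z, heat t χ z * conj (invSqrt χ z) =
        conj (∫ z, invSqrt χ z * conj (heat t χ z)) := by
      rw [← integral_conj]
      congr 1 with z
      rw [map_mul, Complex.conj_conj, mul_comm]
    rw [e, RCLike.enorm_conj]
    refine (hpair (memLp_heat ht hχ)).trans (setLIntegral_mono' measurableSet_Ioi fun s hs => ?_)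
    gcongr
    exact enorm_integral_heat_mul_conj_heat_le hs ht hχ hM
  -- Both copies of L^{-1/2} are expanded as time integrals, the factors π^{-1/2} being bounded by
  -- 1. The constant 20 is 4 from the double time integral times 5 from discarding times above 1.
  calc ∫⁻ z, ‖invSqrt χ z‖ₑ ^ 2 ≤ ‖∫ z, invSqrt χ z * conj (invSqrt χ z)‖ₑ :=
        lintegral_le_enorm_integral_mul_conj_self hG
    _ ≤ ∫⁻ t in Ioi (0 : ℝ), ENNReal.ofReal (t ^ (-(1 / 2) : ℝ)) *
        ∫⁻ s in Ioi (0 : ℝ), ENNReal.ofReal (s ^ (-(1 / 2) : ℝ)) * energy χ (s + t) := by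
        refine (hpair hG).trans (setLIntegral_mono' measurableSet_Ioi fun t ht => ?_)
        gcongr
        exact h1 t ht
    _ ≤ 4 * ∫⁻ t in Ioi (0 : ℝ), energy χ t :=
        lintegral_lintegral_rpow_mul_le (measurable_energy hχ.1)
          fun u v hv huv => energy_anti hv huv hχ hM
    _ ≤ 4 * (5 * ∫⁻ u in Ioc (0 : ℝ) 1, energy χ u) := by
        gcongr
        exact lintegral_energy_le hχ hM
    _ = _ := by rw [← mul_assoc]; norm_num

end Energy

end SpecialHermite

namespace SpecialHermite

variable {d : ℕ}

/-! ### Differentiation of the twisted heat kernel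

The vector fields `Z_j` and `Zbar_j` are treated simultaneously; the parameter `b` is `true` for
`Z_j` and `false` for `Zbar_j`. -/

/-- `∂/∂z_j` or `∂/∂(conj z_j)`. -/
noncomputable def wirt (b : Bool) (j : Fin d) (u : Cn d → ℂ) (z : Cn d) : ℂ :=
  if b then dz j u z else dzbar j u z

lemma wirt_true (j : Fin d) (u : Cn d → ℂ) : wirt true j u = dz j u := by
  funext z; simp [wirt]

lemma wirt_false (j : Fin d) (u : Cn d → ℂ) : wirt false j u = dzbar j u := by
  funext z; simp [wirt]

/-- `conj x` or `x`. -/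
noncomputable def crd (b : Bool) (x : ℂ) : ℂ := if b then conj x else x

/-- The sign `1` or `-1`. -/
def sgn (b : Bool) : ℝ := if b then 1 else -1

/-- `Z_j φ` or `Zbar_j φ`. -/
noncomputable def field (b : Bool) (j : Fin d) (φ : Cn d → ℂ) (z : Cn d) : ℂ :=
  wirt b j φ z + (sgn b / 4 : ℝ) * crd b (z j) * φ z

lemma crd_sub (b : Bool) (x y : ℂ) : crd b (x - y) = crd b x - crd b y := by
  cases b <;> simp [crd]

lemma crd_mul_crd_not (b : Bool) (x : ℂ) : crd b x * crd (!b) x = ((‖x‖ ^ 2 : ℝ) : ℂ) := by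
  rw [← Complex.normSq_eq_norm_sq, Complex.normSq_eq_conj_mul_self]
  cases b
  · simp [crd, mul_comm]
  · simp [crd]

lemma conj_crd (b : Bool) (x : ℂ) : conj (crd b x) = crd (!b) x := by
  cases b <;> simp [crd]

lemma contDiff_crd (b : Bool) (j : Fin d) : ContDiff ℝ ∞ fun z : Cn d => crd b (z j) := by
  cases b
  · simpa [crd] using contDiff_coord j
  · simpa [crd] using contDiff_conj_coord j

lemma sgn_not (b : Bool) : sgn (!b) = -sgn b := by cases b <;> simp [sgn]

lemma sgn_sq (b : Bool) : sgn b * sgn b = 1 := by cases b <;> simp [sgn]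

lemma wirt_mul (b : Bool) (j : Fin d) {u v : Cn d → ℂ} {z : Cn d} (hu : DifferentiableAt ℝ u z)
    (hv : DifferentiableAt ℝ v z) :
    wirt b j (fun z => u z * v z) z = u z * wirt b j v z + v z * wirt b j u z := by
  cases b
  · simpa [wirt] using dzbar_mul j hu hv
  · simpa [wirt] using dz_mul j hu hv

lemma conj_wirt (b : Bool) (j : Fin d) {u : Cn d → ℂ} {z : Cn d} (hu : DifferentiableAt ℝ u z) :
    conj (wirt b j u z) = wirt (!b) j (fun z => conj (u z)) z := by
  cases b
  · simpa [wirt] using (dz_conj j hu).symm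
  · simpa [wirt] using (dzbar_conj j hu).symm

lemma contDiff_wirt (b : Bool) (j : Fin d) {u : Cn d → ℂ} (hu : ContDiff ℝ ∞ u) :
    ContDiff ℝ ∞ (wirt b j u) := by
  cases b
  · simpa only [wirt_false] using contDiff_dzbar j hu
  · simpa only [wirt_true] using contDiff_dz j hu

lemma hasCompactSupport_wirt (b : Bool) (j : Fin d) {u : Cn d → ℂ} (hu : HasCompactSupport u) :
    HasCompactSupport (wirt b j u) := by
  cases b
  · simpa only [wirt_false] using hasCompactSupport_dzbar j hu
  · simpa only [wirt_true] using hasCompactSupport_dz j hu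

lemma contDiff_field (b : Bool) (j : Fin d) {φ : Cn d → ℂ} (hφ : ContDiff ℝ ∞ φ) :
    ContDiff ℝ ∞ (field b j φ) :=
  (contDiff_wirt b j hφ).add ((contDiff_const.mul (contDiff_crd b j)).mul hφ)

lemma hasCompactSupport_field (b : Bool) (j : Fin d) {φ : Cn d → ℂ} (hc : HasCompactSupport φ) :
    HasCompactSupport (field b j φ) :=
  (hasCompactSupport_wirt b j hc).add hc.mul_left

lemma integral_mul_wirt (b : Bool) (j : Fin d) {u φ : Cn d → ℂ} (hu : ContDiff ℝ ∞ u)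
    (hφ : ContDiff ℝ ∞ φ) (hc : HasCompactSupport φ) :
    ∫ z, u z * wirt b j φ z = -∫ z, wirt b j u z * φ z := by
  have h := isWirtinger_of_contDiff hu
  cases b
  · simp [wirt, h.integral_dzbar φ hφ hc j]
  · simp [wirt, h.integral_dz φ hφ hc j]

lemma wirt_cexp (b : Bool) (j : Fin d) {u : Cn d → ℂ} {z : Cn d} (hu : DifferentiableAt ℝ u z)
    (C : ℂ) : wirt b j (fun z => C * Complex.exp (u z)) z =
      wirt b j u z * (C * Complex.exp (u z)) := by
  have h : fderiv ℝ (fun z => C * Complex.exp (u z)) z =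
      C • (Complex.exp (u z) • fderiv ℝ u z) := (hu.hasFDerivAt.cexp.const_mul C).fderiv
  cases b <;> simp [wirt, dz, dzbar, h] <;> ring

/-- The exponent of the twisted heat kernel, as a polynomial in `w` and `conj w`. -/
noncomputable def kernelPoly (c : ℝ) (z : Cn d) : MvPolynomial (Fin d ⊕ Fin d) ℂ :=
  ∑ i, (MvPolynomial.C (-(c / 4 : ℂ)) * ((MvPolynomial.C (z i) - MvPolynomial.X (Sum.inl i)) *
      (MvPolynomial.C (conj (z i)) - MvPolynomial.X (Sum.inr i))) -
    MvPolynomial.C (1 / 4) * (MvPolynomial.C (z i) * MvPolynomial.X (Sum.inr i) -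
      MvPolynomial.C (conj (z i)) * MvPolynomial.X (Sum.inl i)))

lemma norm_sq_eq_sum (z : Cn d) : ((‖z‖ ^ 2 : ℝ) : ℂ) = ∑ i, z i * conj (z i) := by
  rw [EuclideanSpace.norm_sq_eq]
  push_cast
  refine Finset.sum_congr rfl fun i _ => ?_
  rw [Complex.mul_conj, Complex.normSq_eq_norm_sq, Complex.ofReal_pow]

lemma I_div_two_mul_im (z w : Cn d) : Complex.I / 2 * ((dotConj z w).im : ℂ) =
    1 / 4 * ∑ i, (z i * conj (w i) - conj (z i) * w i) := by
  have h : dotConj z w - conj (dotConj z w) = ∑ i, (z i * conj (w i) - conj (z i) * w i) := by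
    rw [conj_dotConj, dotConj, dotConj, ← Finset.sum_sub_distrib]
    exact Finset.sum_congr rfl fun i _ => by ring
  rw [← h, Complex.sub_conj]
  push_cast
  ring

lemma twistedKernel_eq (t : ℝ) (z w : Cn d) : twistedKernel t z w =
    (((4 * Real.pi * Real.sinh t) ^ d)⁻¹ : ℝ) *
      Complex.exp (evalPoly (kernelPoly (Real.cosh t / Real.sinh t) z) w) := by
  rw [twistedKernel, ofReal_heatKernel, mul_assoc, ← Complex.exp_add, I_div_two_mul_im]
  congr 2
  have := norm_sq_eq_sum (z - w)
  rw [Complex.ofReal_pow] at this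
  rw [this, kernelPoly]
  simp only [evalPoly_sum, evalPoly_sub, evalPoly_mul, evalPoly_C, evalPoly_X_inl, evalPoly_X_inr,
    Finset.mul_sum, ← Finset.sum_neg_distrib, ← Finset.sum_add_distrib]
  refine Finset.sum_congr rfl fun i _ => ?_
  simp only [PiLp.sub_apply, map_sub]
  push_cast
  ring

lemma contDiff_twistedKernel_right (t : ℝ) (z : Cn d) : ContDiff ℝ ∞ (twistedKernel t z) := by
  have e : twistedKernel t z = fun w => (((4 * Real.pi * Real.sinh t) ^ d)⁻¹ : ℝ) *
      Complex.exp (evalPoly (kernelPoly (Real.cosh t / Real.sinh t) z) w) :=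
    funext fun w => twistedKernel_eq t z w
  rw [e]
  exact contDiff_const.mul (contDiff_evalPoly _).cexp

lemma contDiff_twistedKernel_left (t : ℝ) (w : Cn d) :
    ContDiff ℝ ∞ (fun z => twistedKernel t z w) := by
  simp only [← conj_twistedKernel t w]
  exact Complex.conjCLE.contDiff.comp (contDiff_twistedKernel_right t w)

/-- The kernel is a constant times the exponential of a polynomial, so its logarithmic derivative is
read off from that polynomial: a Gaussian part in z - w and a part from the twist. -/
lemma wirt_twistedKernel_right (b : Bool) (j : Fin d) (t : ℝ) (z w : Cn d) :
    wirt b j (twistedKernel t z) w =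
      ((Real.cosh t / Real.sinh t / 4 : ℝ) * crd b (z j - w j) + (sgn b / 4 : ℝ) * crd b (z j)) *
        twistedKernel t z w := by
  have e : twistedKernel t z = fun w => ((((4 * Real.pi * Real.sinh t) ^ d)⁻¹ : ℝ) : ℂ) *
      Complex.exp (evalPoly (kernelPoly (Real.cosh t / Real.sinh t) z) w) :=
    funext fun w => twistedKernel_eq t z w
  rw [e, wirt_cexp b j (differentiableAt_evalPoly _ w)]
  congr 1
  classical
  cases b
  · simp only [wirt, Bool.false_eq_true, if_false, dzbar_evalPoly, kernelPoly, map_sum, map_sub,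
      MvPolynomial.pderiv_mul, MvPolynomial.pderiv_C,
      MvPolynomial.pderiv_X, Pi.single_apply, Sum.inr.injEq, reduceCtorEq, sub_zero, zero_mul,
      zero_add, add_zero, mul_zero, evalPoly_sum, crd, sgn]
    rw [Finset.sum_eq_single j]
    · simp
      ring
    · intro i _ hi
      simp [hi, evalPoly]
    · simp
  · simp only [wirt, if_true, dz_evalPoly, kernelPoly, map_sum, map_sub,
      MvPolynomial.pderiv_mul, MvPolynomial.pderiv_C,
      MvPolynomial.pderiv_X, Pi.single_apply, Sum.inl.injEq, reduceCtorEq, sub_zero, zero_mul,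
      zero_add, add_zero, mul_zero, evalPoly_sum, crd, sgn]
    rw [Finset.sum_eq_single j]
    · simp
      ring
    · intro i _ hi
      simp [hi, evalPoly]
    · simp

/-- Follows from the derivative in the other variable by the Hermitian symmetry of the kernel. -/
lemma wirt_twistedKernel_left (b : Bool) (j : Fin d) (t : ℝ) (z w : Cn d) :
    wirt (!b) j (fun z => twistedKernel t z w) z =
      (-((Real.cosh t / Real.sinh t / 4 : ℝ) * crd (!b) (z j - w j)) +
        (sgn b / 4 : ℝ) * crd (!b) (w j)) * twistedKernel t z w := by
  simp only [← conj_twistedKernel t w]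
  rw [← conj_wirt b j ((contDiff_twistedKernel_right t w).differentiable (by simp) z),
    wirt_twistedKernel_right, map_mul, map_add, map_mul, map_mul, Complex.conj_ofReal,
    Complex.conj_ofReal, conj_crd, conj_crd, crd_sub, crd_sub]
  ring

lemma wirt_not_crd (b : Bool) (j : Fin d) (z a : Cn d) :
    wirt (!b) j (fun z => crd b (z j - a j)) z = 1 := by
  have h1 : DifferentiableAt ℝ (fun z : Cn d => z j) z := (hasFDerivAt_coord j z).differentiableAt
  have h2 : DifferentiableAt ℝ (fun z : Cn d => conj (z j)) z :=
    (hasFDerivAt_conj_coord j z).differentiableAt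
  cases b
  · simp only [wirt, crd, Bool.not_false, if_true, Bool.false_eq_true, if_false, sub_eq_add_neg]
    rw [dz_add j h1 (differentiableAt_const _), dz_coord, dz_const]
    simp
  · simp only [wirt, crd, Bool.not_true, if_true, Bool.false_eq_true, if_false, sub_eq_add_neg,
      map_add]
    rw [dzbar_add j h2 (differentiableAt_const _), dzbar_conj_coord, dzbar_const]
    simp

end SpecialHermite

namespace SpecialHermite

variable {d : ℕ}

/-! ### The energy of `Z_j φ` and `Zbar_j φ` -/

section FieldEnergy

variable {φ : Cn d → ℂ} {t : ℝ}

lemma contDiff_coord_sub_left (b : Bool) (j : Fin d) (w : Cn d) :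
    ContDiff ℝ ∞ fun z : Cn d => crd b (z j - w j) := by
  simp only [crd_sub]
  exact (contDiff_crd b j).sub contDiff_const

lemma continuous_crd (b : Bool) : Continuous (crd b) := by
  cases b
  · exact continuous_id
  · exact Complex.continuous_conj

/-- The first integration by parts. -/
lemma integral_field_mul_twistedKernel (b : Bool) (j : Fin d) (t : ℝ) (hφ : ContDiff ℝ ∞ φ)
    (hc : HasCompactSupport φ) (z : Cn d) :
    ∫ w, field b j φ w * twistedKernel t z w =
      ∫ w, (-((Real.cosh t / Real.sinh t + sgn b) / 4) : ℝ) * crd b (z j - w j) *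
        twistedKernel t z w * φ w := by
  have hT := contDiff_twistedKernel_right t z
  have i1 : Integrable fun w => twistedKernel t z w * wirt b j φ w :=
    integrable_mul_test hT.continuous.locallyIntegrable (contDiff_wirt b j hφ).continuous
      (hasCompactSupport_wirt b j hc)
  have i2 : Integrable fun w => (twistedKernel t z w * ((sgn b / 4 : ℝ) * crd b (w j))) * φ w :=
    integrable_mul_test (hT.mul (contDiff_const.mul (contDiff_crd b j))).continuous.locallyIntegrable
      hφ.continuous hc
  have i3 : Integrable fun w => wirt b j (twistedKernel t z) w * φ w :=
    integrable_mul_test (contDiff_wirt b j hT).continuous.locallyIntegrable hφ.continuous hc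
  have e1 : ∀ w, field b j φ w * twistedKernel t z w = twistedKernel t z w * wirt b j φ w +
      (twistedKernel t z w * ((sgn b / 4 : ℝ) * crd b (w j))) * φ w := fun w => by
    rw [field]; ring
  simp only [e1]
  rw [integral_add i1 i2, integral_mul_wirt b j hT hφ hc, neg_add_eq_sub, ← integral_sub i2 i3]
  congr 1 with w
  -- The zeroth-order term of the field, taken at w, combines with the twist term, taken at z, into
  -- a function of z - w.
  rw [wirt_twistedKernel_right, crd_sub]
  push_cast
  ring

/-- The second integration by parts. -/
lemma integral_crd_mul_conj_field (b : Bool) (j : Fin d) (t : ℝ) (hφ : ContDiff ℝ ∞ φ)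
    (hc : HasCompactSupport φ) (w : Cn d) :
    ∫ z, crd b (z j - w j) * twistedKernel t z w * conj (field b j φ z) =
      ∫ z, (-1 + ((Real.cosh t / Real.sinh t + sgn b) / 4 * ‖z j - w j‖ ^ 2 : ℝ)) *
        twistedKernel t z w * conj (φ z) := by
  have hT := contDiff_twistedKernel_left t w
  have hk := (contDiff_coord_sub_left b j w).mul hT
  have hψ : ContDiff ℝ ∞ fun z => conj (φ z) := Complex.conjCLE.contDiff.comp hφ
  have hψc : HasCompactSupport fun z => conj (φ z) :=
    hc.comp_left (g := fun x : ℂ => conj x) (map_zero _)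
  have i1 : Integrable fun z => crd b (z j - w j) * twistedKernel t z w *
      wirt (!b) j (fun z => conj (φ z)) z :=
    integrable_mul_test hk.continuous.locallyIntegrable (contDiff_wirt _ j hψ).continuous
      (hasCompactSupport_wirt _ j hψc)
  have i2 : Integrable fun z => (crd b (z j - w j) * twistedKernel t z w *
      ((sgn b / 4 : ℝ) * crd (!b) (z j))) * conj (φ z) :=
    integrable_mul_test (hk.mul (contDiff_const.mul
      (contDiff_crd _ j))).continuous.locallyIntegrable hψ.continuous hψc
  have i3 : Integrable fun z => wirt (!b) j (fun z => crd b (z j - w j) * twistedKernel t z w) z *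
      conj (φ z) :=
    integrable_mul_test (contDiff_wirt _ j hk).continuous.locallyIntegrable hψ.continuous hψc
  have e1 : ∀ z, crd b (z j - w j) * twistedKernel t z w * conj (field b j φ z) =
      crd b (z j - w j) * twistedKernel t z w * wirt (!b) j (fun z => conj (φ z)) z +
      (crd b (z j - w j) * twistedKernel t z w * ((sgn b / 4 : ℝ) * crd (!b) (z j))) *
        conj (φ z) := fun z => by
    rw [field, map_add, conj_wirt b j (hφ.differentiable (by simp) z), map_mul, map_mul,
      Complex.conj_ofReal, conj_crd]
    ring
  simp only [e1]
  rw [integral_add i1 i2, integral_mul_wirt _ j hk hψ hψc, neg_add_eq_sub, ← integral_sub i2 i3]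
  congr 1 with z
  have hn := crd_mul_crd_not b (z j - w j)
  -- The constant -1 arises when the derivative falls on the linear factor; when it falls on the
  -- kernel it produces the conjugate linear factor, hence |z_j - w_j|².
  rw [wirt_mul (!b) j ((contDiff_coord_sub_left b j w).differentiable (by simp) z)
    (hT.differentiable (by simp) z), wirt_twistedKernel_left, wirt_not_crd]
  rw [crd_sub (!b)] at hn ⊢
  rw [Complex.ofReal_mul, ← hn]
  push_cast
  ring

lemma hasCompactSupport_prod {u v : Cn d → ℂ} (hu : HasCompactSupport u)
    (hv : HasCompactSupport v) (k : Cn d × Cn d → ℂ) :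
    HasCompactSupport fun q : Cn d × Cn d => k q * (u q.2 * v q.1) := by
  refine HasCompactSupport.of_support_subset_isCompact (hv.isCompact.prod hu.isCompact) ?_
  intro q hq
  have h := right_ne_zero_of_mul (Function.mem_support.1 hq)
  exact ⟨subset_tsupport _ (right_ne_zero_of_mul h), subset_tsupport _ (left_ne_zero_of_mul h)⟩

/-- The weight `(c + σ) (d - (c + σ) |y|² / 4)`, `c = coth t`, coming out of the two integrations
by parts. -/
noncomputable def fieldWeight (b : Bool) (t : ℝ) (y : Cn d) : ℝ :=
  (Real.cosh t / Real.sinh t + sgn b) *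
    (d - (Real.cosh t / Real.sinh t + sgn b) / 4 * ‖y‖ ^ 2)

lemma continuous_fieldWeight (b : Bool) (t : ℝ) :
    Continuous fun q : Cn d × Cn d => fieldWeight b t (q.1 - q.2) := by
  unfold fieldWeight; fun_prop

/-- Two integrations by parts move both fields from φ to the kernel. With C = (coth t + σ)/4 the
first yields -C times a linear factor, and the second yields -1 + C|z_j - w_j|². -/
lemma integral_heat_field (b : Bool) (j : Fin d) (t : ℝ) (hφ : ContDiff ℝ ∞ φ)
    (hc : HasCompactSupport φ) :
    ∫ z, heat t (field b j φ) z * conj (field b j φ z) =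
      ∫ q : Cn d × Cn d, ((Real.cosh t / Real.sinh t + sgn b) / 4 *
        (1 - (Real.cosh t / Real.sinh t + sgn b) / 4 * ‖q.1 j - q.2 j‖ ^ 2) : ℝ) *
        twistedKernel t q.1 q.2 * (φ q.2 * conj (φ q.1)) := by
  set C : ℝ := (Real.cosh t / Real.sinh t + sgn b) / 4 with hC
  have hf := contDiff_field b j hφ
  have hfc := hasCompactSupport_field b j hc
  have hconj : ∀ {u : Cn d → ℂ}, HasCompactSupport u → HasCompactSupport fun z => conj (u z) :=
    fun h => h.comp_left (g := fun x : ℂ => conj x) (map_zero _)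
  have hT := continuous_twistedKernel (d := d) t
  have hcr : Continuous fun q : Cn d × Cn d => crd b (q.1 j - q.2 j) :=
    (continuous_crd b).comp (by fun_prop)
  have hφc := hφ.continuous
  have hfcont := hf.continuous
  have e1 : ∀ z, heat t (field b j φ) z * conj (field b j φ z) =
      ∫ w, (-C : ℝ) * (crd b (z j - w j) * twistedKernel t z w) *
        (φ w * conj (field b j φ z)) := fun z => by
    rw [heat_eq, integral_field_mul_twistedKernel b j t hφ hc, ← integral_mul_const]
    congr 1 with w
    ring
  simp only [e1]
  rw [integral_integral_swap_of_hasCompactSupport]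
  · have e2 : ∀ w, ∫ z, (-C : ℝ) * (crd b (z j - w j) * twistedKernel t z w) *
        (φ w * conj (field b j φ z)) =
        ∫ z, ((C * (1 - C * ‖z j - w j‖ ^ 2) : ℝ) : ℂ) * twistedKernel t z w *
          (φ w * conj (φ z)) := by
      intro w
      have h := congrArg (fun x => (-C : ℝ) * φ w * x) (integral_crd_mul_conj_field b j t hφ hc w)
      simp only [← integral_const_mul] at h
      rw [← hC] at h
      refine Eq.trans ?_ (h.trans ?_)
      · congr 1 with z; ring
      · congr 1 with z; push_cast; ring
    simp only [e2]
    rw [Measure.volume_eq_prod, integral_prod_symm]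
    refine Continuous.integrable_of_hasCompactSupport ?_ (hasCompactSupport_prod hc (hconj hc) _)
    have := Complex.continuous_conj.comp hφc
    fun_prop
  · have := Complex.continuous_conj.comp hfcont
    simp only [Function.uncurry_def]
    fun_prop
  · exact hasCompactSupport_prod hc (hconj hfc)
      (fun q => (-C : ℝ) * (crd b (q.1 j - q.2 j) * twistedKernel t q.1 q.2))

lemma sum_integral_heat_field (b : Bool) (t : ℝ) (hφ : ContDiff ℝ ∞ φ)
    (hc : HasCompactSupport φ) :
    ∑ j, ∫ z, heat t (field b j φ) z * conj (field b j φ z) =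
      ∫ q : Cn d × Cn d, ((fieldWeight b t (q.1 - q.2) / 4 : ℝ) : ℂ) *
        twistedKernel t q.1 q.2 * (φ q.2 * conj (φ q.1)) := by
  have hT := continuous_twistedKernel (d := d) t
  have hφc := hφ.continuous
  have hψ := Complex.continuous_conj.comp hφc
  simp only [integral_heat_field b _ t hφ hc]
  rw [← integral_finsetSum]
  · congr 1 with q
    rw [← Finset.sum_mul, ← Finset.sum_mul, ← Complex.ofReal_sum]
    congr 3
    rw [fieldWeight, ← Finset.mul_sum, Finset.sum_sub_distrib, ← Finset.mul_sum,
      EuclideanSpace.norm_sq_eq]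
    simp
    ring
  · intro j _
    refine Continuous.integrable_of_hasCompactSupport ?_ (hasCompactSupport_prod hc
      (hc.comp_left (g := fun x : ℂ => conj x) (map_zero _)) _)
    fun_prop

end FieldEnergy

end SpecialHermite

namespace SpecialHermite

variable {d : ℕ}

/-! ### The time derivative of the energy -/

lemma cosh_sub_sgn_mul_sinh (b : Bool) (t : ℝ) :
    Real.cosh t - sgn b * Real.sinh t = Real.exp (-(sgn b * t)) := by
  cases b
  · simp [sgn, Real.cosh_add_sinh]
  · simp [sgn, Real.cosh_sub_sinh]

lemma cosh_add_sgn_mul_sinh (b : Bool) (t : ℝ) :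
    Real.cosh t + sgn b * Real.sinh t = Real.exp (sgn b * t) := by
  cases b
  · simp [sgn, ← sub_eq_add_neg, Real.cosh_sub_sinh]
  · simp [sgn, Real.cosh_add_sinh]

lemma heatKernel_eq_exp {t : ℝ} (ht : 0 < t) (y : Cn d) : heatKernel d t y =
    Real.exp (-(d * Real.log (4 * Real.pi * Real.sinh t)) -
      1 / 4 * ‖y‖ ^ 2 * (Real.cosh t / Real.sinh t)) := by
  have hs := Real.sinh_pos_iff.2 ht
  have h4 : 0 < 4 * Real.pi * Real.sinh t := by positivity
  rw [sub_eq_add_neg, Real.exp_add, Real.exp_neg, Real.exp_nat_mul, Real.exp_log h4, heatKernel]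
  congr 2
  ring

/-- This is the kernel form of 4∑ Z_j*Z_j = L - d and Z_jL = (L + 2)Z_j, with both signs reversed
for Zbar_j: the first relation explains the factor e^{σdt}, the second the shift from d to d - 2.
The proof is a direct computation. -/
lemma hasDerivAt_exp_mul_heatKernel (b : Bool) {t : ℝ} (ht : 0 < t) (y : Cn d) :
    HasDerivAt (fun τ => Real.exp (sgn b * d * τ) * heatKernel d τ y)
      (-(Real.exp (sgn b * (d - 2) * t) * (fieldWeight b t y * heatKernel d t y))) t := by
  have hs := Real.sinh_pos_iff.2 ht
  have h4 : 0 < 4 * Real.pi * Real.sinh t := by positivity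
  have h1 : HasDerivAt (fun τ : ℝ => sgn b * d * τ + (-(d * Real.log (4 * Real.pi * Real.sinh τ)) -
      1 / 4 * ‖y‖ ^ 2 * (Real.cosh τ / Real.sinh τ)))
      (sgn b * d + (-(d * (4 * Real.pi * Real.cosh t / (4 * Real.pi * Real.sinh t))) -
        1 / 4 * ‖y‖ ^ 2 * ((Real.sinh t * Real.sinh t - Real.cosh t * Real.cosh t) /
          Real.sinh t ^ 2))) t := by
    refine HasDerivAt.add ?_ (HasDerivAt.sub (HasDerivAt.neg ?_) ?_)
    · simpa using (hasDerivAt_id t).const_mul (sgn b * d)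
    · exact (((Real.hasDerivAt_sinh t).const_mul _).log h4.ne').const_mul _
    · exact ((Real.hasDerivAt_cosh t).div (Real.hasDerivAt_sinh t) hs.ne').const_mul _
  have h2 := h1.exp
  have h3 : (fun τ => Real.exp (sgn b * d * τ) * heatKernel d τ y) =ᶠ[nhds t] fun τ =>
      Real.exp (sgn b * d * τ + (-(d * Real.log (4 * Real.pi * Real.sinh τ)) -
      1 / 4 * ‖y‖ ^ 2 * (Real.cosh τ / Real.sinh τ))) := by
    filter_upwards [Ioi_mem_nhds ht] with τ hτ
    rw [heatKernel_eq_exp hτ, ← Real.exp_add]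
  refine (h2.congr_of_eventuallyEq h3).congr_deriv ?_
  have e1 : Real.exp (sgn b * (d - 2) * t) = Real.exp (sgn b * d * t) *
      (Real.exp (-(sgn b * t)) * Real.exp (-(sgn b * t))) := by
    rw [← Real.exp_add, ← Real.exp_add]; congr 1; ring
  have e2 : Real.exp (sgn b * t) * Real.exp (-(sgn b * t)) = 1 := by
    rw [← Real.exp_add, add_neg_cancel, Real.exp_zero]
  rw [Real.exp_add, ← heatKernel_eq_exp ht, e1, fieldWeight]
  rw [← cosh_sub_sgn_mul_sinh] at e2 ⊢
  rw [← cosh_add_sgn_mul_sinh] at e2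
  have hsq := sgn_sq b
  have hcs := Real.cosh_sq t
  have key : sgn b * d + (-(d * (4 * Real.pi * Real.cosh t / (4 * Real.pi * Real.sinh t))) -
        1 / 4 * ‖y‖ ^ 2 * ((Real.sinh t * Real.sinh t - Real.cosh t * Real.cosh t) /
          Real.sinh t ^ 2)) =
      -((Real.cosh t - sgn b * Real.sinh t) * (Real.cosh t - sgn b * Real.sinh t) *
        ((Real.cosh t / Real.sinh t + sgn b) *
          (d - (Real.cosh t / Real.sinh t + sgn b) / 4 * ‖y‖ ^ 2))) := by
    -- Since cosh t - σ sinh t and cosh t + σ sinh t are mutually inverse exponentials, e^{-σt}(coth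
    -- t + σ) is simply 1/sinh t.
    have e3 : (Real.cosh t - sgn b * Real.sinh t) * (Real.cosh t / Real.sinh t + sgn b) =
        1 / Real.sinh t := by
      field_simp
      linear_combination e2
    have e4 : (Real.cosh t - sgn b * Real.sinh t) * (Real.cosh t - sgn b * Real.sinh t) *
        ((Real.cosh t / Real.sinh t + sgn b) *
          (d - (Real.cosh t / Real.sinh t + sgn b) / 4 * ‖y‖ ^ 2)) =
        (Real.cosh t - sgn b * Real.sinh t) *
          ((Real.cosh t - sgn b * Real.sinh t) * (Real.cosh t / Real.sinh t + sgn b)) * d -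
        ((Real.cosh t - sgn b * Real.sinh t) * (Real.cosh t / Real.sinh t + sgn b)) *
          ((Real.cosh t - sgn b * Real.sinh t) * (Real.cosh t / Real.sinh t + sgn b)) / 4 *
          ‖y‖ ^ 2 := by ring
    rw [e4, e3]
    field_simp
    rw [hcs]
    ring
  rw [key]
  ring

lemma mul_exp_neg_le_one (x : ℝ) : x * Real.exp (-x) ≤ 1 := by
  rw [Real.exp_neg, ← div_eq_mul_inv, div_le_one (Real.exp_pos x)]
  linarith [Real.add_one_le_exp x]

/-- The quadratic growth of the weight is absorbed by the Gaussian through x e^{-x} ≤ 1, so the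
bound does not depend on y. -/
lemma abs_fieldWeight_mul_heatKernel_le (b : Bool) {t : ℝ} (ht : 0 < t) (y : Cn d) :
    |fieldWeight b t y * heatKernel d t y| ≤ (Real.cosh t / Real.sinh t + 1) *
      (d + (Real.cosh t / Real.sinh t + 1) / (Real.cosh t / Real.sinh t)) *
      ((4 * Real.pi * Real.sinh t) ^ d)⁻¹ := by
  have hs := Real.sinh_pos_iff.2 ht
  have hc := coth_pos ht
  rw [fieldWeight, heatKernel]
  generalize Real.cosh t / Real.sinh t = c at hc ⊢
  have hK : 0 ≤ ((4 * Real.pi * Real.sinh t) ^ d)⁻¹ := by positivity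
  generalize ((4 * Real.pi * Real.sinh t) ^ d)⁻¹ = K at hK ⊢
  have hσ : |c + sgn b| ≤ c + 1 := by
    rw [abs_le]
    cases b <;> simp only [sgn, Bool.false_eq_true, if_false, if_true] <;>
      constructor <;> linarith
  have hx0 : 0 ≤ c / 4 * ‖y‖ ^ 2 := by positivity
  have hx := mul_exp_neg_le_one (c / 4 * ‖y‖ ^ 2)
  have he : Real.exp (-(1 / 4) * ‖y‖ ^ 2 * c) = Real.exp (-(c / 4 * ‖y‖ ^ 2)) := by
    congr 1; ring
  have he1 : Real.exp (-(c / 4 * ‖y‖ ^ 2)) ≤ 1 := Real.exp_le_one_iff.2 (by linarith)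
  have h1 : |(d : ℝ) - (c + sgn b) / 4 * ‖y‖ ^ 2| ≤ d + (c + 1) / 4 * ‖y‖ ^ 2 := by
    refine (abs_sub _ _).trans ?_
    rw [abs_of_nonneg (Nat.cast_nonneg d), abs_mul, abs_div, abs_of_nonneg (sq_nonneg ‖y‖),
      abs_of_pos (by norm_num : (0 : ℝ) < 4)]
    gcongr
  have h2 : (d + (c + 1) / 4 * ‖y‖ ^ 2) * Real.exp (-(c / 4 * ‖y‖ ^ 2)) ≤ d + (c + 1) / c := by
    have e : (d + (c + 1) / 4 * ‖y‖ ^ 2) * Real.exp (-(c / 4 * ‖y‖ ^ 2)) =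
        d * Real.exp (-(c / 4 * ‖y‖ ^ 2)) +
        (c + 1) / c * ((c / 4 * ‖y‖ ^ 2) * Real.exp (-(c / 4 * ‖y‖ ^ 2))) := by
      field_simp
    rw [e]
    exact add_le_add (mul_le_of_le_one_right (Nat.cast_nonneg d) he1)
      (mul_le_of_le_one_right (by positivity) hx)
  rw [he, abs_mul, abs_mul, abs_mul, abs_of_nonneg hK, abs_of_pos (Real.exp_pos _)]
  calc |c + sgn b| * |(d : ℝ) - (c + sgn b) / 4 * ‖y‖ ^ 2| *
        (K * Real.exp (-(c / 4 * ‖y‖ ^ 2)))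
      ≤ (c + 1) * (d + (c + 1) / 4 * ‖y‖ ^ 2) * (K * Real.exp (-(c / 4 * ‖y‖ ^ 2))) := by
        gcongr
    _ = (c + 1) * ((d + (c + 1) / 4 * ‖y‖ ^ 2) * Real.exp (-(c / 4 * ‖y‖ ^ 2))) * K := by ring
    _ ≤ _ := by gcongr

/-- Serves as the dominating constant for differentiating under the integral near t; the interval
[t/2, 2t] stays away from the singularity at time 0. -/
lemma exists_bound_fieldWeight_mul_heatKernel (b : Bool) {t : ℝ} (ht : 0 < t) :
    ∃ M : ℝ, ∀ τ ∈ Icc (t / 2) (2 * t), ∀ y : Cn d,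
      |Real.exp (sgn b * (d - 2) * τ) * (fieldWeight b τ y * heatKernel d τ y)| ≤ M := by
  have hpos : ∀ τ ∈ Icc (t / 2) (2 * t), 0 < τ := fun τ hτ => by linarith [hτ.1]
  have hcont : ContinuousOn (fun τ : ℝ => Real.exp (sgn b * (d - 2) * τ) *
      ((Real.cosh τ / Real.sinh τ + 1) *
      (d + (Real.cosh τ / Real.sinh τ + 1) / (Real.cosh τ / Real.sinh τ)) *
      ((4 * Real.pi * Real.sinh τ) ^ d)⁻¹)) (Icc (t / 2) (2 * t)) := by
    have h1 : ContinuousOn (fun τ : ℝ => Real.cosh τ / Real.sinh τ) (Icc (t / 2) (2 * t)) :=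
      Real.continuous_cosh.continuousOn.div Real.continuous_sinh.continuousOn
        fun τ hτ => (Real.sinh_pos_iff.2 (hpos τ hτ)).ne'
    refine ContinuousOn.mul (by fun_prop) (((h1.add continuousOn_const).mul
      (continuousOn_const.add ((h1.add continuousOn_const).div h1
        fun τ hτ => (coth_pos (hpos τ hτ)).ne'))).mul (ContinuousOn.inv₀ (by fun_prop) ?_))
    intro τ hτ
    have := Real.sinh_pos_iff.2 (hpos τ hτ)
    positivity
  obtain ⟨M, hM⟩ := isCompact_Icc.exists_bound_of_continuousOn hcont
  refine ⟨M, fun τ hτ y => le_trans ?_ ((le_abs_self _).trans (hM τ hτ))⟩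
  rw [abs_mul, abs_of_pos (Real.exp_pos _)]
  exact mul_le_mul_of_nonneg_left (abs_fieldWeight_mul_heatKernel_le b (hpos τ hτ) y)
    (Real.exp_pos _).le

section EnergyDerivative

variable {φ : Cn d → ℂ} {t : ℝ}

lemma integrable_kernel_mul_test {k : Cn d × Cn d → ℂ} (hk : Continuous k) (hφ : Continuous φ)
    (hc : HasCompactSupport φ) :
    Integrable fun q : Cn d × Cn d => k q * (φ q.2 * conj (φ q.1)) := by
  refine Continuous.integrable_of_hasCompactSupport ?_ (hasCompactSupport_prod hc
    (hc.comp_left (g := fun x : ℂ => conj x) (map_zero _)) _)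
  have := Complex.continuous_conj.comp hφ
  fun_prop

lemma integral_heat_mul_conj_eq_prod (t : ℝ) (hφ : Continuous φ) (hc : HasCompactSupport φ) :
    ∫ z, heat t φ z * conj (φ z) =
      ∫ q : Cn d × Cn d, twistedKernel t q.1 q.2 * (φ q.2 * conj (φ q.1)) := by
  have h := integrable_kernel_mul_test (continuous_twistedKernel t) hφ hc
  rw [Measure.volume_eq_prod] at h ⊢
  rw [integral_prod _ h]
  congr 1 with z
  rw [heat_eq, ← integral_mul_const]
  congr 1 with w
  ring

/-- The time derivative of the renormalised kernel and the two integrations by parts produce the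
same weight. Compact support of φ and the local uniform bound justify differentiating under the
integral. -/
lemma hasDerivAt_energy (b : Bool) (ht : 0 < t) (hφ : ContDiff ℝ ∞ φ)
    (hc : HasCompactSupport φ) :
    HasDerivAt (fun τ : ℝ => (Real.exp (sgn b * d * τ) : ℂ) * ∫ z, heat τ φ z * conj (φ z))
      (-(4 * Real.exp (sgn b * (d - 2) * t) : ℝ) *
        ∑ j, ∫ z, heat t (field b j φ) z * conj (field b j φ z)) t := by
  set B : Cn d × Cn d → ℂ := fun q =>
    Complex.exp (-(Complex.I / 2 * ((dotConj q.1 q.2).im : ℂ))) * (φ q.2 * conj (φ q.1)) with hB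
  have hBi : Integrable B := by
    refine integrable_kernel_mul_test ?_ hφ.continuous hc
    fun_prop
  obtain ⟨M, hM⟩ := exists_bound_fieldWeight_mul_heatKernel (d := d) b ht
  have hnhds : Icc (t / 2) (2 * t) ∈ nhds t := Icc_mem_nhds (by linarith) (by linarith)
  have hk : ∀ τ, Continuous fun q : Cn d × Cn d =>
      ((Real.exp (sgn b * d * τ) * heatKernel d τ (q.1 - q.2) : ℝ) : ℂ) := fun τ => by
    have := continuous_heatKernel (d := d) τ
    fun_prop
  have hk' : ∀ τ, Continuous fun q : Cn d × Cn d =>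
      ((-(Real.exp (sgn b * (d - 2) * τ) * (fieldWeight b τ (q.1 - q.2) *
        heatKernel d τ (q.1 - q.2))) : ℝ) : ℂ) := fun τ => by
    have h1 := continuous_heatKernel (d := d) τ
    have h2 := continuous_fieldWeight (d := d) b τ
    fun_prop
  have hBm := hBi.aestronglyMeasurable
  have hd := (hasDerivAt_integral_of_dominated_loc_of_deriv_le (μ := volume)
    (F := fun (τ : ℝ) (q : Cn d × Cn d) =>
      ((Real.exp (sgn b * d * τ) * heatKernel d τ (q.1 - q.2) : ℝ) : ℂ) * B q)
    (F' := fun (τ : ℝ) (q : Cn d × Cn d) =>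
      ((-(Real.exp (sgn b * (d - 2) * τ) * (fieldWeight b τ (q.1 - q.2) *
        heatKernel d τ (q.1 - q.2))) : ℝ) : ℂ) * B q)
    (bound := fun q => M * ‖B q‖) hnhds
    (Filter.Eventually.of_forall fun τ => (hk τ).aestronglyMeasurable.mul hBm)
    ?_ ((hk' t).aestronglyMeasurable.mul hBm) ?_ (hBi.norm.const_mul M) ?_).2
  · refine (hd.congr_of_eventuallyEq (Filter.Eventually.of_forall fun τ => ?_)).congr_deriv ?_
    · simp only
      rw [integral_heat_mul_conj_eq_prod τ hφ.continuous hc, ← integral_const_mul]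
      congr 1 with q
      rw [hB, twistedKernel]
      push_cast
      ring
    · rw [sum_integral_heat_field b t hφ hc, ← integral_const_mul]
      congr 1 with q
      rw [hB, twistedKernel]
      push_cast
      ring
  · have h := (integrable_kernel_mul_test (continuous_twistedKernel t) hφ.continuous hc).const_mul
      (Real.exp (sgn b * d * t) : ℂ)
    refine h.congr (Filter.Eventually.of_forall fun q => ?_)
    simp only [hB, twistedKernel]
    push_cast
    ring
  · refine Filter.Eventually.of_forall fun q τ hτ => ?_
    rw [norm_mul, Complex.norm_real, Real.norm_eq_abs, abs_neg]
    exact mul_le_mul_of_nonneg_right (hM τ hτ _) (norm_nonneg _)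
  · refine Filter.Eventually.of_forall fun q τ hτ => ?_
    exact (hasDerivAt_exp_mul_heatKernel b (by linarith [hτ.1]) _).ofReal_comp.mul_const _

end EnergyDerivative

end SpecialHermite

namespace SpecialHermite

variable {d : ℕ}

/-! ### Boundedness of `L^{-1/2} Z_j` and `L^{-1/2} Zbar_j` -/

section Bounded

open scoped ENNReal

variable {φ χ : Cn d → ℂ} {t : ℝ}

lemma memLp_test (hφ : Continuous φ) (hc : HasCompactSupport φ) : MemLp φ 2 :=
  hφ.memLp_of_hasCompactSupport hc

/-- The energy as a real number. -/
noncomputable def realEnergy (χ : Cn d → ℂ) (t : ℝ) : ℝ := ∫ z, ‖heat (t / 2) χ z‖ ^ 2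

lemma realEnergy_nonneg (χ : Cn d → ℂ) (t : ℝ) : 0 ≤ realEnergy χ t :=
  integral_nonneg fun _ => sq_nonneg _

lemma ofReal_realEnergy (ht : 0 < t) (hχ : MemLp χ 2) :
    ENNReal.ofReal (realEnergy χ t) = energy χ t :=
  ofReal_integral_norm_sq (memLp_heat (by linarith) hχ)

lemma integral_heat_mul_conj_self (ht : 0 < t) (hχ : Continuous χ) (hc : HasCompactSupport χ) :
    ∫ z, heat t χ z * conj (χ z) = (realEnergy χ t : ℂ) := by
  obtain ⟨M, hM⟩ := hc.exists_bound_of_continuous hχ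
  have h2 : 0 < t / 2 := by linarith
  have h := integral_heat_mul_conj_heat h2 h2 (memLp_test hχ hc) hM
  rw [add_halves] at h
  rw [← h, integral_mul_conj_self, realEnergy]

lemma realEnergy_le (ht : 0 < t) (hχ : MemLp χ 2) : realEnergy χ t ≤ ∫ z, ‖χ z‖ ^ 2 := by
  rw [← ENNReal.ofReal_le_ofReal_iff (integral_nonneg fun _ => sq_nonneg _),
    ofReal_realEnergy ht hχ, ofReal_integral_norm_sq hχ, energy]
  refine (lintegral_heat_sq_le (by linarith) hχ.1).trans (mul_le_of_le_one_left' ?_)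
  refine pow_le_one' ?_ 2
  rw [← ENNReal.ofReal_one]
  exact ENNReal.ofReal_le_ofReal (inv_le_one_of_one_le₀ (one_le_pow₀ (Real.one_le_cosh _)))

lemma hasDerivAt_realEnergy (b : Bool) (ht : 0 < t) (hφ : ContDiff ℝ ∞ φ)
    (hc : HasCompactSupport φ) :
    HasDerivAt (fun τ => -(Real.exp (sgn b * d * τ) * realEnergy φ τ))
      (4 * Real.exp (sgn b * (d - 2) * t) * ∑ j, realEnergy (field b j φ) t) t := by
  have h := (Complex.reCLM.hasFDerivAt.comp_hasDerivAt t (hasDerivAt_energy b ht hφ hc)).neg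
  refine (h.congr_of_eventuallyEq ?_).congr_deriv ?_
  · filter_upwards [Ioi_mem_nhds ht] with τ hτ
    simp only [Pi.neg_apply, Function.comp_apply, Complex.reCLM_apply]
    rw [integral_heat_mul_conj_self hτ hφ.continuous hc, ← Complex.ofReal_mul, Complex.ofReal_re]
  · simp only [fun j => integral_heat_mul_conj_self ht (contDiff_field b j hφ).continuous
      (hasCompactSupport_field b j hc), Complex.reCLM_apply]
    rw [← Complex.ofReal_sum, neg_mul, ← Complex.ofReal_mul, Complex.neg_re, Complex.ofReal_re,
      neg_neg]

/-- The energy of the field is, up to bounded exponential factors, the derivative of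
-e^{σdt}⟨e^{-tL}φ, φ⟩, whose total variation is at most e^d‖φ‖². The differentiation formula
requires positive times, so the integral starts at ε, with a bound independent of ε. -/
lemma lintegral_energy_field_le_of_pos (b : Bool) (j : Fin d) {ε : ℝ} (hε : 0 < ε) (hε1 : ε ≤ 1)
    (hφ : ContDiff ℝ ∞ φ) (hc : HasCompactSupport φ) :
    ∫⁻ u in Ioc ε 1, energy (field b j φ) u ≤
      ENNReal.ofReal (Real.exp (2 * d + 2)) * ∫⁻ z, ‖φ z‖ₑ ^ 2 := by
  have hφ2 := memLp_test hφ.continuous hc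
  set g : ℝ → ℝ := fun τ => -(Real.exp (sgn b * d * τ) * realEnergy φ τ) with hg
  set g' : ℝ → ℝ := fun t =>
    4 * Real.exp (sgn b * (d - 2) * t) * ∑ j, realEnergy (field b j φ) t with hg'
  have hder : ∀ τ, 0 < τ → HasDerivAt g (g' τ) τ := fun τ hτ => hasDerivAt_realEnergy b hτ hφ hc
  have hcont : ContinuousOn g (Icc ε 1) := fun τ hτ =>
    (hder τ (hε.trans_le hτ.1)).continuousAt.continuousWithinAt
  have hpos : ∀ τ, 0 ≤ g' τ := fun τ => mul_nonneg (by positivity)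
    (Finset.sum_nonneg fun _ _ => realEnergy_nonneg _ _)
  -- A nonnegative derivative of a function continuous on a compact interval is automatically
  -- integrable.
  have hint : IntegrableOn g' (Ioc ε 1) :=
    intervalIntegral.integrableOn_deriv_of_nonneg hcont
      (fun τ hτ => hder τ (hε.trans hτ.1)) fun τ _ => hpos τ
  have hFTC : ∫ τ in Ioc ε 1, g' τ = g 1 - g ε := by
    rw [← intervalIntegral.integral_of_le hε1]
    exact intervalIntegral.integral_eq_sub_of_hasDerivAt_of_le hε1 hcont
      (fun τ hτ => hder τ (hε.trans hτ.1)) ((intervalIntegrable_iff_integrableOn_Ioc_of_le hε1).2 hint)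
  have hsgn : ∀ x : ℝ, sgn b * x ≤ |x| ∧ -|x| ≤ sgn b * x := by
    intro x
    cases b
    · simp only [sgn, Bool.false_eq_true, if_false, neg_one_mul]
      exact ⟨neg_le_abs x, neg_le_neg (le_abs_self x)⟩
    · simp only [sgn, if_true, one_mul]
      exact ⟨le_abs_self x, neg_abs_le x⟩
  have hd0 : (0 : ℝ) ≤ d := Nat.cast_nonneg d
  have hle : g 1 - g ε ≤ Real.exp d * ∫ z, ‖φ z‖ ^ 2 := by
    have h1 : g 1 ≤ 0 := neg_nonpos.2 (mul_nonneg (Real.exp_pos _).le (realEnergy_nonneg _ _))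
    have h2 : -g ε ≤ Real.exp d * ∫ z, ‖φ z‖ ^ 2 := by
      rw [hg]
      simp only [neg_neg]
      refine mul_le_mul (Real.exp_le_exp.2 ?_) (realEnergy_le hε hφ2) (realEnergy_nonneg _ _)
        (Real.exp_pos _).le
      rw [mul_assoc]
      refine (hsgn _).1.trans ?_
      rw [abs_of_nonneg (by positivity)]
      exact mul_le_of_le_one_right hd0 hε1
    linarith
  have hbound : ∀ τ ∈ Ioc ε 1, realEnergy (field b j φ) τ ≤ Real.exp (d + 2) * g' τ := by
    intro τ hτ
    have h1 : realEnergy (field b j φ) τ ≤ ∑ j, realEnergy (field b j φ) τ :=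
      Finset.single_le_sum (f := fun j => realEnergy (field b j φ) τ)
        (fun _ _ => realEnergy_nonneg _ _) (Finset.mem_univ j)
    -- For 0 < τ ≤ 1 the exponent σ(d-2)τ is at least -(d+2), so e^{d+2} compensates the exponential
    -- factor in `g'`.
    have h2 : 1 ≤ Real.exp (d + 2) * (4 * Real.exp (sgn b * (d - 2) * τ)) := by
      have h3 : Real.exp 0 ≤ Real.exp (d + 2 + sgn b * (d - 2) * τ) := by
        refine Real.exp_le_exp.2 ?_
        have h4 := (hsgn ((d - 2) * τ)).2
        have h5 : |((d : ℝ) - 2) * τ| ≤ d + 2 := by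
          rw [abs_mul, abs_of_pos (hε.trans hτ.1)]
          have h6 : |(d : ℝ) - 2| ≤ d + 2 := by
            rw [abs_le]; constructor <;> linarith
          nlinarith [hτ.1, hτ.2, abs_nonneg ((d : ℝ) - 2)]
        rw [mul_assoc]
        linarith
      rw [Real.exp_zero, Real.exp_add] at h3
      have := Real.exp_pos ((d : ℝ) + 2)
      have := Real.exp_pos (sgn b * (d - 2) * τ)
      nlinarith
    have h0 : 0 ≤ ∑ j, realEnergy (field b j φ) τ :=
      Finset.sum_nonneg fun _ _ => realEnergy_nonneg _ _
    calc realEnergy (field b j φ) τ ≤ 1 * ∑ j, realEnergy (field b j φ) τ := by linarith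
      _ ≤ _ := by
        rw [hg', ← mul_assoc]
        exact mul_le_mul_of_nonneg_right h2 h0
  calc ∫⁻ u in Ioc ε 1, energy (field b j φ) u
      ≤ ∫⁻ u in Ioc ε 1, ENNReal.ofReal (Real.exp (d + 2) * g' u) := by
        refine setLIntegral_mono' measurableSet_Ioc fun u hu => ?_
        rw [← ofReal_realEnergy (hε.trans hu.1) (memLp_test (contDiff_field b j hφ).continuous
          (hasCompactSupport_field b j hc))]
        exact ENNReal.ofReal_le_ofReal (hbound u hu)
    _ = ENNReal.ofReal (Real.exp (d + 2) * (g 1 - g ε)) := by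
        rw [← ofReal_integral_eq_lintegral_ofReal (hint.const_mul _)
          (Filter.Eventually.of_forall fun u => mul_nonneg (Real.exp_pos _).le (hpos u)),
          integral_const_mul, hFTC]
    _ ≤ ENNReal.ofReal (Real.exp (2 * d + 2) * ∫ z, ‖φ z‖ ^ 2) := by
        refine ENNReal.ofReal_le_ofReal ?_
        have : Real.exp (2 * d + 2) = Real.exp (d + 2) * Real.exp d := by
          rw [← Real.exp_add]; congr 1; ring
        rw [this, mul_assoc]
        exact mul_le_mul_of_nonneg_left hle (Real.exp_pos _).le
    _ = _ := by rw [ENNReal.ofReal_mul (Real.exp_pos _).le, ofReal_integral_norm_sq hφ2]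

/-- The intervals (1/(n+1), 1] exhaust (0, 1], and the bound on each is uniform in n. -/
lemma lintegral_energy_field_le (b : Bool) (j : Fin d) (hφ : ContDiff ℝ ∞ φ)
    (hc : HasCompactSupport φ) :
    ∫⁻ u in Ioc (0 : ℝ) 1, energy (field b j φ) u ≤
      ENNReal.ofReal (Real.exp (2 * d + 2)) * ∫⁻ z, ‖φ z‖ₑ ^ 2 := by
  have hU : Ioc (0 : ℝ) 1 = ⋃ n : ℕ, Ioc (1 / ((n : ℝ) + 1)) 1 := by
    ext x
    simp only [mem_Ioc, mem_iUnion]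
    constructor
    · rintro ⟨h0, h1⟩
      obtain ⟨n, hn⟩ := exists_nat_one_div_lt h0
      exact ⟨n, hn, h1⟩
    · rintro ⟨n, hn, h1⟩
      exact ⟨lt_trans (by positivity) hn, h1⟩
  rw [hU, setLIntegral_iUnion_of_directed]
  · refine iSup_le fun n => lintegral_energy_field_le_of_pos b j (by positivity) ?_ hφ hc
    rw [div_le_one (by positivity)]
    have : (0 : ℝ) ≤ n := Nat.cast_nonneg n
    linarith
  · exact directed_of_isDirected_le fun m n hmn =>
      Ioc_subset_Ioc_left (Nat.one_div_le_one_div hmn)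

/-- `L^{-1/2} Z_j` and `L^{-1/2} Zbar_j` are bounded on `L²`. -/
lemma lintegral_invSqrt_field_le [NeZero d] (b : Bool) (j : Fin d) (hφ : ContDiff ℝ ∞ φ)
    (hc : HasCompactSupport φ) :
    ∫⁻ z, ‖invSqrt (field b j φ) z‖ₑ ^ 2 ≤
      20 * ENNReal.ofReal (Real.exp (2 * d + 2)) * ∫⁻ z, ‖φ z‖ₑ ^ 2 := by
  have hf := (contDiff_field b j hφ).continuous
  have hfc := hasCompactSupport_field b j hc
  obtain ⟨M, hM⟩ := hfc.exists_bound_of_continuous hf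
  refine (lintegral_invSqrt_sq_le (memLp_test hf hfc) hM).trans ?_
  rw [mul_assoc]
  gcongr
  exact lintegral_energy_field_le b j hφ hc

end Bounded

/-! ### The Riesz transforms on `L²` -/

section Riesz

open scoped ENNReal

/-- The estimate makes l vanish on the kernel of e, so l factors through the range of e as a bounded
functional. Hahn–Banach and Riesz representation do the rest. -/
lemma exists_inner_eq_of_norm_le {V H : Type*} [AddCommGroup V] [Module ℂ V]
    [NormedAddCommGroup H] [InnerProductSpace ℂ H] [CompleteSpace H] (e : V →ₗ[ℂ] H)
    (l : V →ₗ[ℂ] ℂ) (C : ℝ) (h : ∀ v, ‖l v‖ ≤ C * ‖e v‖) :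
    ∃ y : H, ∀ v, l v = inner ℂ y (e v) := by
  have hker : LinearMap.ker e ≤ LinearMap.ker l := by
    intro v hv
    have := h v
    rw [LinearMap.mem_ker] at hv ⊢
    rw [hv, norm_zero, mul_zero] at this
    exact norm_le_zero_iff.1 this
  let g : LinearMap.range e →ₗ[ℂ] ℂ :=
    ((LinearMap.ker e).liftQ l hker).comp e.quotKerEquivRange.symm.toLinearMap
  have hg : ∀ v, g ⟨e v, LinearMap.mem_range_self e v⟩ = l v := by
    intro v
    have : e.quotKerEquivRange.symm ⟨e v, LinearMap.mem_range_self e v⟩ =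
        (LinearMap.ker e).mkQ v := e.quotKerEquivRange_symm_apply_image v _
    simp [g, this]
  have hgb : ∀ x, ‖g x‖ ≤ C * ‖x‖ := by
    rintro ⟨_, v, rfl⟩
    rw [hg]
    exact h v
  obtain ⟨G, hG, -⟩ := exists_extension_norm_eq (LinearMap.range e) (g.mkContinuous C hgb)
  refine ⟨(InnerProductSpace.toDual ℂ H).symm G, fun v => ?_⟩
  rw [InnerProductSpace.toDual_symm_apply]
  have := hG ⟨e v, LinearMap.mem_range_self e v⟩
  rw [this, LinearMap.mkContinuous_apply, hg]

/-- The space of test functions. -/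
def testSpace (d : ℕ) : Submodule ℂ (Cn d → ℂ) where
  carrier := {φ | ContDiff ℝ ∞ φ ∧ HasCompactSupport φ}
  zero_mem' := ⟨contDiff_const, HasCompactSupport.zero⟩
  add_mem' h h' := ⟨h.1.add h'.1, h.2.add h'.2⟩
  smul_mem' c _ h := ⟨contDiff_const.smul h.1, h.2.smul_left⟩

lemma wirt_add (b : Bool) (j : Fin d) {u v : Cn d → ℂ} {z : Cn d} (hu : DifferentiableAt ℝ u z)
    (hv : DifferentiableAt ℝ v z) :
    wirt b j (u + v) z = wirt b j u z + wirt b j v z := by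
  cases b
  · simp only [wirt_false]; exact dzbar_add j hu hv
  · simp only [wirt_true]; exact dz_add j hu hv

lemma wirt_smul (b : Bool) (j : Fin d) (c : ℂ) {u : Cn d → ℂ} {z : Cn d}
    (hu : DifferentiableAt ℝ u z) : wirt b j (c • u) z = c * wirt b j u z := by
  have h : fderiv ℝ (c • u) z = c • fderiv ℝ u z := fderiv_const_smul hu c
  cases b <;> simp [wirt, dz, dzbar, h] <;> ring

/-- The formal transpose of `Z_j` or `Zbar_j`. -/
noncomputable def fieldTranspose (b : Bool) (j : Fin d) (φ : Cn d → ℂ) (z : Cn d) : ℂ :=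
  -wirt b j φ z + (sgn b / 4 : ℝ) * crd b (z j) * φ z

/-- The formal adjoint of Z_j is -Zbar_j and conversely. The distributional pairing is bilinear,
which accounts for the conjugations on both sides of the field. -/
lemma fieldTranspose_eq (b : Bool) (j : Fin d) {φ : Cn d → ℂ} (hφ : ContDiff ℝ ∞ φ) (z : Cn d) :
    fieldTranspose b j φ z = -conj (field (!b) j (fun z => conj (φ z)) z) := by
  have hd : DifferentiableAt ℝ (fun z => conj (φ z)) z :=
    ((Complex.conjCLE.contDiff (n := ∞)).comp hφ).differentiable (by simp) z
  rw [field, map_add, conj_wirt (!b) j hd, map_mul, map_mul, Complex.conj_ofReal, conj_crd,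
    sgn_not, fieldTranspose, Bool.not_not]
  simp only [Complex.conj_conj]
  push_cast
  ring

variable [NeZero d] {f : Cn d → ℂ}

/-- The distribution is an L² function because it is a functional on test functions bounded in the
L² norm. Symmetry of L^{-1/2} moves that operator onto the transposed field of φ, where the energy
estimate applies. -/
theorem exists_memLp_riesz (hf : MemLp f 2) (b : Bool) (j : Fin d) :
    ∃ S : Cn d → ℂ, MemLp S 2 ∧ ∀ φ : Cn d → ℂ, ContDiff ℝ ∞ φ → HasCompactSupport φ →
      ∫ z, S z * φ z = ∫ z, invSqrt f z * fieldTranspose b j φ z := by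
  have hG := memLp_invSqrt hf
  have hGl : LocallyIntegrable (invSqrt f) := hG.locallyIntegrable (by norm_num)
  have hTc : ∀ φ : testSpace d, Continuous (fieldTranspose b j φ.1) := fun φ =>
    (contDiff_wirt b j φ.2.1).continuous.neg.add
      ((continuous_const.mul (contDiff_crd b j).continuous).mul φ.2.1.continuous)
  have hTs : ∀ φ : testSpace d, HasCompactSupport (fieldTranspose b j φ.1) := fun φ =>
    (hasCompactSupport_wirt b j φ.2.2).neg.add φ.2.2.mul_left
  have hTi : ∀ φ : testSpace d, Integrable fun z => invSqrt f z * fieldTranspose b j φ.1 z :=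
    fun φ => integrable_mul_test hGl (hTc φ) (hTs φ)
  let e : testSpace d →ₗ[ℂ] Lp ℂ 2 (volume : Measure (Cn d)) :=
    { toFun := fun φ => (memLp_test φ.2.1.continuous φ.2.2).toLp φ.1
      map_add' := fun _ _ => rfl
      map_smul' := fun _ _ => rfl }
  let l : testSpace d →ₗ[ℂ] ℂ :=
    { toFun := fun φ => ∫ z, invSqrt f z * fieldTranspose b j φ.1 z
      map_add' := fun φ ψ => by
        rw [← integral_add (hTi φ) (hTi ψ)]
        congr 1 with z
        simp only [fieldTranspose, Submodule.coe_add, Pi.add_apply]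
        rw [wirt_add b j (φ.2.1.differentiable (by simp) z) (ψ.2.1.differentiable (by simp) z)]
        ring
      map_smul' := fun c φ => by
        rw [RingHom.id_apply, smul_eq_mul, ← integral_const_mul]
        congr 1 with z
        simp only [fieldTranspose, Submodule.coe_smul, Pi.smul_apply, smul_eq_mul]
        rw [wirt_smul b j c (φ.2.1.differentiable (by simp) z)]
        ring }
  set A : ℝ≥0∞ := (∫⁻ z, ‖f z‖ₑ ^ 2) * (20 * ENNReal.ofReal (Real.exp (2 * d + 2))) with hA
  have hAtop : A ≠ ⊤ := ENNReal.mul_ne_top ((memLp_two_iff_lintegral hf.1).1 hf).ne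
    (ENNReal.mul_ne_top (by simp) (by simp))
  have he : ∀ φ : testSpace d, ‖e φ‖ₑ ^ 2 = ∫⁻ z, ‖φ.1 z‖ₑ ^ 2 := by
    intro φ
    have h1 : ‖e φ‖ₑ = eLpNorm φ.1 2 volume :=
      Lp.enorm_toLp (memLp_test φ.2.1.continuous φ.2.2)
    rw [h1, eLpNorm_eq_lintegral_rpow_enorm_toReal (by simp) (by simp), ← ENNReal.rpow_natCast,
      ← ENNReal.rpow_mul]
    simp
  have hl : ∀ φ : testSpace d, ‖l φ‖ₑ ^ 2 ≤ A * ‖e φ‖ₑ ^ 2 := by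
    intro φ
    have hψ : ContDiff ℝ ∞ fun z => conj (φ.1 z) := Complex.conjCLE.contDiff.comp φ.2.1
    have hψc : HasCompactSupport fun z => conj (φ.1 z) :=
      φ.2.2.comp_left (g := fun x : ℂ => conj x) (map_zero _)
    have hχ2 := memLp_test (contDiff_field (!b) j hψ).continuous
      (hasCompactSupport_field (!b) j hψc)
    -- The field of a test function is again a test function, hence in L², so symmetry of L^{-1/2}
    -- is available for this pairing.
    have h1 : l φ = -∫ z, f z * conj (invSqrt (field (!b) j fun z => conj (φ.1 z)) z) := by
      rw [← integral_invSqrt_mul_conj_comm hf hχ2, ← integral_neg]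
      change ∫ z, invSqrt f z * fieldTranspose b j φ.1 z = _
      congr 1 with z
      rw [fieldTranspose_eq b j φ.2.1, mul_neg]
    have h2 : ‖l φ‖ₑ ≤ ∫⁻ z, ‖f z‖ₑ * ‖invSqrt (field (!b) j fun z => conj (φ.1 z)) z‖ₑ := by
      rw [h1, enorm_neg]
      refine (enorm_integral_le_lintegral_enorm _).trans (le_of_eq ?_)
      simp only [enorm_mul, RCLike.enorm_conj]
    calc ‖l φ‖ₑ ^ 2
        ≤ (∫⁻ z, ‖f z‖ₑ * ‖invSqrt (field (!b) j fun z => conj (φ.1 z)) z‖ₑ) ^ 2 := by gcongr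
      _ ≤ (∫⁻ z, ‖f z‖ₑ ^ 2) * ∫⁻ z, ‖invSqrt (field (!b) j fun z => conj (φ.1 z)) z‖ₑ ^ 2 :=
          sq_lintegral_mul_le volume hf.1.enorm (memLp_invSqrt hχ2).1.enorm
      _ ≤ (∫⁻ z, ‖f z‖ₑ ^ 2) * (20 * ENNReal.ofReal (Real.exp (2 * d + 2)) *
            ∫⁻ z, ‖conj (φ.1 z)‖ₑ ^ 2) := by
          gcongr
          exact lintegral_invSqrt_field_le (!b) j hψ hψc
      _ = A * ‖e φ‖ₑ ^ 2 := by
          rw [he, hA]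
          simp only [RCLike.enorm_conj]
          ring
  obtain ⟨y, hy⟩ := exists_inner_eq_of_norm_le e l (Real.sqrt A.toReal) fun φ => by
    have h1 : ‖l φ‖ ^ 2 ≤ A.toReal * ‖e φ‖ ^ 2 := by
      have := ENNReal.toReal_mono (ENNReal.mul_ne_top hAtop (by simp)) (hl φ)
      simpa [ENNReal.toReal_mul, ENNReal.toReal_pow] using this
    refine abs_le_of_sq_le_sq' ?_ (by positivity) |>.2
    rw [mul_pow, Real.sq_sqrt ENNReal.toReal_nonneg]
    exact h1
  -- The Riesz representative y enters the inner product conjugated, so the function representing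
  -- the bilinear pairing is conj y.
  refine ⟨fun z => conj (y z), (Lp.memLp y).star, fun φ hφ hc => ?_⟩
  have h := hy ⟨φ, hφ, hc⟩
  rw [L2.inner_def] at h
  refine Eq.trans ?_ h.symm
  refine integral_congr_ae ?_
  filter_upwards [(memLp_test hφ.continuous hc).coeFn_toLp] with z hz
  change _ = inner ℂ (y z) (((memLp_test hφ.continuous hc).toLp φ : Lp ℂ 2 volume) z)
  rw [hz, RCLike.inner_apply, mul_comm]

/-- The Riesz transforms of square integrable functions. -/
theorem exists_riesz (hf : MemLp f 2) :
    ∃ S Sbar : Fin d → Cn d → ℂ, IsRiesz f S ∧ IsRieszBar f Sbar ∧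
      (∀ j, MemLp (S j) 2) ∧ (∀ j, MemLp (Sbar j) 2) ∧
      ∀ᵐ r ∂(volume.restrict (Ioi (0 : ℝ))), Integrable (rieszSq S Sbar r) (sphMeasure d) := by
  choose S hS2 hS using exists_memLp_riesz hf true
  choose Sbar hSb2 hSb using exists_memLp_riesz hf false
  refine ⟨S, Sbar, fun j => ⟨(hS2 j).locallyIntegrable (by norm_num), fun φ hφ hc => ?_⟩,
    fun j => ⟨(hSb2 j).locallyIntegrable (by norm_num), fun φ hφ hc => ?_⟩, hS2, hSb2, ?_⟩
  · rw [hS j φ hφ hc]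
    congr 1 with z
    simp [fieldTranspose, wirt_true, sgn, crd]
  · rw [hSb j φ hφ hc]
    congr 1 with z
    simp only [fieldTranspose, wirt_false, sgn, crd, Bool.false_eq_true, if_false]
    push_cast
    ring
  · have h : Integrable fun z : Cn d => (∑ j, ‖S j z‖ ^ 2) + ∑ j, ‖Sbar j z‖ ^ 2 :=
      (integrable_finsetSum _ fun j _ => (hS2 j).integrable_norm_pow (by simp)).add
        (integrable_finsetSum _ fun j _ => (hSb2 j).integrable_norm_pow (by simp))
    filter_upwards [ae_sphere_integrable_of_integrable h] with r hr
    exact hr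

end Riesz

end SpecialHermite

/-! ### The proposition on Riesz transforms and spherical harmonics -/

open SpecialHermite in
theorem proposition3p7 (d : ℕ) (hd : 0 < d)
    (Y : (m n : ℕ) → Fin (harmDim d m n) → Sph d → ℂ) (hY : IsHarmonicBasis d Y)
    (f : Cn d → ℂ) :
    -- for `f ∈ L²` everything is defined, and `⟨Sf, Sf⟩ + ⟨Sbar f, Sbar f⟩` is integrable over
    -- almost every sphere
    (MemLp f 2 → InvSqrtDefined f ∧
      ∃ S Sbar : Fin d → Cn d → ℂ, IsRiesz f S ∧ IsRieszBar f Sbar ∧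
        (∀ j, MemLp (S j) 2) ∧ (∀ j, MemLp (Sbar j) 2) ∧
        ∀ᵐ r ∂(volume.restrict (Ioi (0 : ℝ))), Integrable (rieszSq S Sbar r) (sphMeasure d)) ∧
    -- the decomposition, whenever everything is defined
    (InvSqrtDefined f → ∀ S Sbar : Fin d → Cn d → ℂ, IsRiesz f S → IsRieszBar f Sbar →
      ∀ F : (m n : ℕ) → Fin (harmDim d m n) → ℝ → ℂ,
        (∀ m n j r, F m n j r = harmCoeff (invSqrt f) (Y m n j) r) →
      ∃ D : (m n : ℕ) → Fin (harmDim d m n) → ℝ → ℂ,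
        (∀ m n j, IsWeakDeriv (F m n j) (D m n j)) ∧
        ∀ᵐ r ∂(volume.restrict (Ioi (0 : ℝ))), Integrable (rieszSq S Sbar r) (sphMeasure d) →
          Summable (term1 F D r) ∧ Summable (term2 F D r) ∧ Summable (term3 F r) ∧
          Summable (term4 F r) ∧ Summable (term5 F r) ∧
          ∫ ζ, rieszSq S Sbar r ζ ∂sphMeasure d =
            (∑' q, term1 F D r q) + (∑' q, term2 F D r q) + (∑' q, term3 F r q) +
              (∑' q, term4 F r q) + ∑' q, term5 F r q) := by
  have : NeZero d := ⟨hd.ne'⟩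
  exact ⟨fun hf => ⟨invSqrtDefined_of_memLp hf, exists_riesz hf⟩,
    fun hdef S Sbar hS hSbar F hF => riesz_sphere_decomp hY hdef.2 hS hSbar hF⟩
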